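/- Let $\Bbbk$ be a field. A conic quantum space is a pair $\mathcal A=(\mathbf A_1,\mathbf A)$ of a nonzero associative unital $\Bbbk$-algebra $\mathbf A$ and a finite dimensional subspace $\mathbf A_1$ generating it, with $\mathbf A=\bigoplus_{n\ge 0}\mathbf A_n$, where $\mathbf A_n=(\mathbf A_1)^n$ and $\mathbf A_0=\Bbbk$; let $\mathbf I_n\subseteq\mathbf A_1^{\otimes n}$ be the kernel of the multiplication $\mathbf A_1^{\otimes n}\to\mathbf A$. Morphisms are algebra maps sending the generator space into the generator space. This category $\mathrm{CA}$ is monoidal with $\mathcal A\circ\mathcal B=\bigoplus_n\mathbf A_n\otimes\mathbf B_n$ (generated by $\mathbf A_1\otimes\mathbf B_1$) and unit $\mathcal K=\Bbbk[e]$. For a vector space $V$, let $Z^2[V]$ be the set of counital 2-cocycles: families of linear automorphisms $\psi_{r,s}$ of $V^{\otimes r}\otimes V^{\otimes s}$ with $\psi_{0,s}=\psi_{r,0}=\mathrm{id}$ and $\psi_{r+s,t}(\psi_{r,s}\otimes \mathrm{id})=\psi_{r,s+t}(\mathrm{id}\otimes\psi_{s,t})$. Each $\psi\in Z^2[V]$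 has a unique primitive $\theta=(\theta_n)_n$, $\theta_n\in \mathrm{GL}(V^{\otimes n})$, $\theta_0=\theta_1=\mathrm{id}$, with $\psi=\partial\theta$, $(\partial\theta)_{r,s}=\theta_{r+s}(\theta_r\otimes\theta_s)^{-1}$; put $\mathfrak i\psi=\partial(\theta^{-1})$. Let $\psi^!$ be the transpose of $\psi^{-1}$, acting on $V^{*\otimes r}\otimes V^{*\otimes s}$. A cochain $\chi$ on $\mathbf A_1$ is 2nd $\mathcal A$-admissible if for all $a,b,c,n$, with $P=\mathbf A_1^{\otimes a}\otimes\mathbf I_b\otimes\mathbf A_1^{\otimes c}$ and $m=a+b+c$, one has $\chi_{m,n}(P\otimes\mathbf A_1^{\otimes n})=P\otimes\mathbf A_1^{\otimes n}$ and $\chi_{n,m}(\mathbf A_1^{\otimes n}\otimes P)=\mathbf A_1^{\otimes n}\otimes P$. Let $\{\psi_{\mathcal A}\in Z^2[\mathbf A_1]\}_{\mathcal A\in\mathrm{CA}}$ be a collection such that $\mathfrak i\psi_{\mathcal A}$ is 2nd $\mathcal A$-admissible for every $\mathcal A$, and let $\omega_{\mathcal A,\mathcal B}=\psi_{\mathcal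 B}^!\otimes\psi_{\mathcal A}\otimes\mathrm{id}$, regarded as an element of $Z^2[\mathbf B_1^*\otimes\mathbf A_1\otimes\mathbf B_1]$. For $\mathcal A,\mathcal B\in\mathrm{CA}$ consider the category of pairs $\langle\varphi,\mathcal H\rangle$ with $\mathcal H\in\mathrm{CA}$ and $\varphi:\mathbf A\to\mathbf H\circ\mathbf B$ a homogeneous linear map, the morphisms $\langle\varphi,\mathcal H\rangle\to\langle\varphi',\mathcal H'\rangle$ being the morphisms $\alpha:\mathcal H\to\mathcal H'$ of $\mathrm{CA}$ with $(\alpha\circ\mathrm{id})\varphi=\varphi'$. Write $\varphi(a_i)=\sum_j h_i^j\otimes b_j$ in bases of $\mathbf A_1$ and $\mathbf B_1$, and let $\mathcal H^\varphi\subseteq\mathcal H$ be the quantum space generated by the span $\mathbf H_1^\varphi$ of the $h_i^j$. Let $\Omega^{\mathcal A,\mathcal B}$ be the full subcategory of the pairs for which $\omega_{\mathcal A,\mathcal B}$ descends along $b^j\otimes a_i\otimes b_l\mapsto h_i^j\otimes b_l$ to an element of $Z^2[\mathbf H_1^\varphi\otimes\mathbf B_1]$ that induces an automorphism $\Psi$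 of $(\mathcal H^\varphi\circ\mathcal B)^{\otimes 2}$, and for which $\varphi$ is a morphism of quantum spaces from $\mathcal A$ to $(\mathcal H^\varphi\circ\mathcal B)_\omega$, the twisted space with product $m\circ\Psi$. Theorem. Every $\Omega^{\mathcal A,\mathcal B}$ has an initial object. For any choice of initial objects $\langle\delta_{\mathcal A,\mathcal B},\underline{hom}^\Omega[\mathcal B,\mathcal A]\rangle$, define $z_i^j$ by $\delta_{\mathcal A,\mathcal B}(a_i)=\sum_j z_i^j\otimes b_j$. The $z_i^j$ form a basis of the generator space of $\underline{hom}^\Omega[\mathcal B,\mathcal A]$, and $(\mathcal B,\mathcal A)\mapsto\underline{hom}^\Omega[\mathcal B,\mathcal A]$ defines a $\mathrm{CA}$-cobased category (a category enriched over $\mathrm{CA}^{op}$): there are cocomposition morphisms $$\Delta:\underline{hom}^\Omega[\mathcal C,\mathcal A]\to\underline{hom}^\Omega[\mathcal B,\mathcal A]\circ\underline{hom}^\Omega[\mathcal C,\mathcal B],\qquad z_i^j\mapsto \sum_k z_i^k\otimes z_k^j,$$ and, for $\underline{end}^\Omega[\mathcal A]=\underline{hom}^\Omega[\mathcal A,\mathcal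 A]$, counit morphisms $\varepsilon:\underline{end}^\Omega[\mathcal A]\to\mathcal K$, $z_i^j\mapsto\delta_i^j e$, which are coassociative and counital, and compatible with the coevaluations: $(\Delta\circ\mathrm{id})\,\delta_{\mathcal A,\mathcal C}=(\mathrm{id}\circ\delta_{\mathcal B,\mathcal C})\,\delta_{\mathcal A,\mathcal B}$ and $(\varepsilon\circ\mathrm{id})\,\delta_{\mathcal A,\mathcal A}(a)=e^n\otimes a$ for $a\in\mathbf A_n$. The counit $\varepsilon$ is an epimorphism, indeed surjective, whenever $\mathbf A_1\neq 0$, and the comultiplication $\underline{end}^\Omega[\mathcal A]\to\underline{end}^\Omega[\mathcal A]\circ\underline{end}^\Omega[\mathcal A]$, $z_i^j\mapsto\sum_k z_i^k\otimes z_k^j$, is a monomorphism, indeed injective. -/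

import Mathlib

open CategoryTheory MonoidalCategory TensorProduct

universe u

/-- A conic quantum space over `k`: a pair `(A₁, A)` of an associative unital algebra `A ≠ 0` and a
finite dimensional subspace `gen = A₁` generating it, such that `A` is graded by the powers of `A₁`,
that is, `A = ⨁ₙ A₁ⁿ` with `A₁⁰ = k`. -/
structure ConicQS (k : Type u) [Field k] where
  carrier : Type u
  [ring : Ring carrier]
  [algebra : Algebra k carrier]
  gen : Submodule k carrier
  finite_gen : FiniteDimensional k gen
  adjoin_gen : Algebra.adjoin k (gen : Set carrier) = ⊤
  nontrivial : Nontrivial carrier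
  indep : iSupIndep fun n : ℕ => gen ^ n

namespace ConicQS

attribute [instance] ConicQS.ring ConicQS.algebra ConicQS.finite_gen ConicQS.nontrivial

variable {k : Type u} [Field k]

/-- The homogeneous component of degree `n`. -/
def deg (A : ConicQS k) (n : ℕ) : Submodule k A.carrier := A.gen ^ n

/-- Morphisms of quantum spaces: algebra maps sending `A₁` into `B₁`. -/
@[ext]
structure Hom (A B : ConicQS k) where
  toAlgHom : A.carrier →ₐ[k] B.carrier
  map_gen : ∀ x ∈ A.gen, toAlgHom x ∈ B.gen

instance : Category (ConicQS k) where
  Hom := Hom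
  id A := ⟨AlgHom.id k A.carrier, fun _ h => h⟩
  comp f g := ⟨g.toAlgHom.comp f.toAlgHom, fun x h => g.map_gen _ (f.map_gen x h)⟩

/-- The algebra map underlying a morphism. -/
def alg {A B : ConicQS k} (f : A ⟶ B) : A.carrier →ₐ[k] B.carrier := Hom.toAlgHom f

theorem alg_mem {A B : ConicQS k} (f : A ⟶ B) {x : A.carrier} (hx : x ∈ A.gen) :
    alg f x ∈ B.gen := Hom.map_gen f x hx

@[simp] theorem alg_id (A : ConicQS k) : alg (𝟙 A) = AlgHom.id k A.carrier := rfl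

@[simp] theorem alg_comp {A B C : ConicQS k} (f : A ⟶ B) (g : B ⟶ C) :
    alg (f ≫ g) = (alg g).comp (alg f) := rfl

theorem hom_ext_alg {A B : ConicQS k} {f g : A ⟶ B} (h : alg f = alg g) : f = g := Hom.ext h

/-- The restriction of a morphism to generators. -/
def genMap {A B : ConicQS k} (f : A ⟶ B) : A.gen →ₗ[k] B.gen :=
  (alg f).toLinearMap.restrict fun _ hx => alg_mem f hx

@[simp] theorem coe_genMap {A B : ConicQS k} (f : A ⟶ B) (x : A.gen) :
    (genMap f x : B.carrier) = alg f x := rfl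

@[simp] theorem genMap_id (A : ConicQS k) : genMap (𝟙 A) = LinearMap.id := rfl

@[simp] theorem genMap_comp {A B C : ConicQS k} (f : A ⟶ B) (g : B ⟶ C) :
    genMap (f ≫ g) = genMap g ∘ₗ genMap f := rfl

theorem hom_ext {A B : ConicQS k} {f g : A ⟶ B} (h : ∀ x, genMap f x = genMap g x) : f = g := by
  apply hom_ext_alg
  apply AlgHom.ext_of_adjoin_eq_top A.adjoin_gen
  intro x hx
  exact congrArg Subtype.val (h ⟨x, hx⟩)

theorem iSup_pow_eq_adjoin {R : Type*} [Ring R] [Algebra k R] (U : Submodule k R) :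
    (⨆ n : ℕ, U ^ n) = Subalgebra.toSubmodule (Algebra.adjoin k (U : Set R)) := by
  apply le_antisymm
  · refine iSup_le fun n => ?_
    induction n with
    | zero =>
      rw [pow_zero, Submodule.one_le]
      exact one_mem (Algebra.adjoin k (U : Set R))
    | succ n ih =>
      rw [pow_succ, Submodule.mul_le]
      exact fun x hx y hy => mul_mem (S := Subalgebra k R) (ih hx) (Algebra.subset_adjoin hy)
  · intro x hx
    have hx' : x ∈ Algebra.adjoin k (U : Set R) := hx
    clear hx
    induction hx' using Algebra.adjoin_induction with
    | mem x hx => exact Submodule.mem_iSup_of_mem 1 (by simpa using hx)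
    | algebraMap r =>
      exact Submodule.mem_iSup_of_mem 0 (by rw [pow_zero]; exact Submodule.algebraMap_mem r)
    | add x y _ _ hx hy => exact add_mem hx hy
    | mul x y _ _ hx hy =>
      have h := Submodule.mul_mem_mul hx hy
      rw [Submodule.iSup_mul] at h
      have hle : (⨆ i : ℕ, U ^ i * ⨆ j : ℕ, U ^ j) ≤ ⨆ n : ℕ, U ^ n := by
        refine iSup_le fun i => ?_
        rw [Submodule.mul_iSup]
        refine iSup_le fun j => ?_
        rw [← pow_add]
        exact le_iSup (fun n : ℕ => U ^ n) (i + j)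
      exact hle h

theorem iSup_deg (A : ConicQS k) : (⨆ n : ℕ, A.deg n) = ⊤ := by
  simp only [deg]
  rw [iSup_pow_eq_adjoin, A.adjoin_gen]; rfl

theorem isInternal (A : ConicQS k) : DirectSum.IsInternal A.deg :=
  (DirectSum.isInternal_submodule_iff_iSupIndep_and_iSup_eq_top _).2 ⟨A.indep, A.iSup_deg⟩

/-- The linear map out of `A` given by its restrictions to the homogeneous components. -/
noncomputable def glue (A : ConicQS k) {M : Type*} [AddCommGroup M] [Module k M]
    (f : ∀ n, A.deg n →ₗ[k] M) : A.carrier →ₗ[k] M :=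
  DirectSum.toModule k ℕ M f ∘ₗ
    (LinearEquiv.ofBijective (DirectSum.coeLinearMap A.deg) A.isInternal).symm.toLinearMap

theorem glue_apply (A : ConicQS k) {M : Type*} [AddCommGroup M] [Module k M]
    (f : ∀ n, A.deg n →ₗ[k] M) (n : ℕ) (x : A.deg n) : A.glue f x = f n x := by
  have : (LinearEquiv.ofBijective (DirectSum.coeLinearMap A.deg) A.isInternal).symm
      (x : A.carrier) = DirectSum.lof k ℕ (fun n => A.deg n) n x := by
    rw [LinearEquiv.symm_apply_eq]
    exact (DirectSum.coeLinearMap_lof A.deg n x).symm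
  simp [glue, this]

theorem indep_of_map_le {M N : Type*} [AddCommGroup M] [Module k M] [AddCommGroup N] [Module k N]
    {S : ℕ → Submodule k M} {T : ℕ → Submodule k N} (f : M →ₗ[k] N) (hf : Function.Injective f)
    (hT : iSupIndep T) (h : ∀ n, (S n).map f ≤ T n) : iSupIndep S := by
  rw [iSupIndep_def]
  intro i
  rw [Submodule.disjoint_def]
  intro x hx hx'
  have h1 : f x ∈ T i := h i (Submodule.mem_map_of_mem hx)
  have h2 : f x ∈ ⨆ (j) (_ : j ≠ i), T j := by
    have : f x ∈ (⨆ (j) (_ : j ≠ i), S j).map f := Submodule.mem_map_of_mem hx'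
    simp only [Submodule.map_iSup] at this
    exact (iSup₂_mono fun j _ => h j) this
  exact hf (((Submodule.disjoint_def.1 (iSupIndep_def.1 hT i)) _ h1 h2).trans (map_zero f).symm)

/-- The quantum space `(U, ⟨U⟩)` generated by a finite dimensional subspace `U` of an algebra whose
powers are independent. -/
def ofSubmodule {R : Type u} [Ring R] [Algebra k R] [Nontrivial R] (U : Submodule k R)
    (hU : FiniteDimensional k U) (hi : iSupIndep fun n : ℕ => U ^ n) : ConicQS k where
  carrier := Algebra.adjoin k (U : Set R)
  gen := U.comap (Algebra.adjoin k (U : Set R)).val.toLinearMap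
  finite_gen := by
    have hinj : Function.Injective (Algebra.adjoin k (U : Set R)).val.toLinearMap :=
      Subtype.val_injective
    have hle : (U.comap (Algebra.adjoin k (U : Set R)).val.toLinearMap).map
        (Algebra.adjoin k (U : Set R)).val.toLinearMap ≤ U := Submodule.map_comap_le _ _
    have := Submodule.finiteDimensional_of_le hle
    exact Module.Finite.equiv (Submodule.equivMapOfInjective _ hinj _).symm
  adjoin_gen := Algebra.adjoin_adjoin_coe_preimage
  nontrivial := inferInstance
  indep := by
    refine indep_of_map_le (Algebra.adjoin k (U : Set R)).val.toLinearMap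
      Subtype.val_injective hi fun n => ?_
    have := Submodule.map_pow (U.comap (Algebra.adjoin k (U : Set R)).val.toLinearMap)
      (Algebra.adjoin k (U : Set R)).val n
    refine this.le.trans (pow_le_pow_left' ?_ n)
    exact Submodule.map_comap_le _ _

/-- The inclusion of `ofSubmodule U` into the ambient algebra. -/
def ofSubmoduleVal {R : Type u} [Ring R] [Algebra k R] [Nontrivial R] (U : Submodule k R)
    (hU : FiniteDimensional k U) (hi : iSupIndep fun n : ℕ => U ^ n) :
    (ofSubmodule U hU hi).carrier →ₐ[k] R :=
  (Algebra.adjoin k (U : Set R)).val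

/-- The quantum subspace of `H` generated by a subspace `U` of `H₁`. -/
def sub (H : ConicQS k) (U : Submodule k H.carrier) (hU : U ≤ H.gen) : ConicQS k :=
  ofSubmodule U (Submodule.finiteDimensional_of_le hU)
    (H.indep.mono fun n => pow_le_pow_left' hU n)

/-- The inclusion of a quantum subspace. -/
def subIncl (H : ConicQS k) (U : Submodule k H.carrier) (hU : U ≤ H.gen) : H.sub U hU ⟶ H where
  toAlgHom := (Algebra.adjoin k (U : Set H.carrier)).val
  map_gen _ hx := hU hx

/-- The quantum space `𝒦 = k[e]`, with `𝒦₁` spanned by `e`. -/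
noncomputable def K (k : Type u) [Field k] : ConicQS k where
  carrier := Polynomial k
  gen := Submodule.span k {Polynomial.X}
  finite_gen := inferInstance
  adjoin_gen := by
    rw [Algebra.adjoin_span]
    exact Polynomial.adjoin_X
  nontrivial := inferInstance
  indep := by
    simp only [Submodule.span_pow, Set.singleton_pow]
    have := (Polynomial.basisMonomials k).linearIndependent.iSupIndep_span_singleton
    simpa [Polynomial.X_pow_eq_monomial] using this

/-- The generator `e` of `𝒦`. -/
noncomputable def e (k : Type u) [Field k] : (K k).gen :=
  ⟨(Polynomial.X : Polynomial k),
    Submodule.mem_span_singleton_self (R := k) (M := Polynomial k) Polynomial.X⟩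

/-- The subspace `A₁ ⊗ B₁` of `A ⊗ B`. -/
noncomputable def genTensor (A B : ConicQS k) : Submodule k (A.carrier ⊗[k] B.carrier) :=
  LinearMap.range (TensorProduct.mapIncl A.gen B.gen)

theorem tmul_mem_genTensor {A B : ConicQS k} {a : A.carrier} {b : B.carrier} (ha : a ∈ A.gen)
    (hb : b ∈ B.gen) : a ⊗ₜ[k] b ∈ genTensor A B :=
  ⟨(⟨a, ha⟩ : A.gen) ⊗ₜ (⟨b, hb⟩ : B.gen), rfl⟩

theorem genTensor_eq (A B : ConicQS k) :
    genTensor A B = Submodule.map₂ (TensorProduct.mk k _ _) A.gen B.gen :=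
  (TensorProduct.map₂_eq_range_lift_comp_mapIncl _ _ _).trans (by
    rw [TensorProduct.lift_mk, LinearMap.id_comp]; rfl) |>.symm

theorem genTensor_pow_le (A B : ConicQS k) (n : ℕ) :
    genTensor A B ^ n ≤ Submodule.map₂ (TensorProduct.mk k _ _) (A.deg n) (B.deg n) := by
  induction n with
  | zero =>
    rw [pow_zero, Submodule.one_le]
    exact Submodule.apply_mem_map₂ (TensorProduct.mk k _ _)
      (show (1 : A.carrier) ∈ A.gen ^ 0 by rw [pow_zero]; exact Submodule.one_le.1 le_rfl)
      (show (1 : B.carrier) ∈ B.gen ^ 0 by rw [pow_zero]; exact Submodule.one_le.1 le_rfl)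
  | succ n ih =>
    rw [pow_succ]
    refine (mul_le_mul' ih (genTensor_eq A B).le).trans ?_
    rw [Submodule.map₂_eq_span_image2, Submodule.map₂_eq_span_image2, Submodule.span_mul_span,
      Submodule.span_le]
    rintro _ ⟨_, ⟨a, ha, b, hb, rfl⟩, _, ⟨a', ha', b', hb', rfl⟩, rfl⟩
    show (a ⊗ₜ[k] b) * (a' ⊗ₜ[k] b') ∈ _
    rw [Algebra.TensorProduct.tmul_mul_tmul]
    refine Submodule.apply_mem_map₂ (TensorProduct.mk k _ _) ?_ ?_
    · exact (pow_succ A.gen n).ge (Submodule.mul_mem_mul ha ha')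
    · exact (pow_succ B.gen n).ge (Submodule.mul_mem_mul hb hb')

/-- The projection onto the component of degree `n`. -/
noncomputable def proj (A : ConicQS k) (n : ℕ) : A.carrier →ₗ[k] A.carrier :=
  A.glue fun m => if m = n then (A.deg m).subtype else 0

theorem proj_same (A : ConicQS k) {n : ℕ} {x : A.carrier} (hx : x ∈ A.deg n) :
    A.proj n x = x := by
  have := A.glue_apply (fun m => if m = n then (A.deg m).subtype else 0) n ⟨x, hx⟩
  simpa [proj] using this

theorem proj_ne (A : ConicQS k) {m n : ℕ} (h : m ≠ n) {x : A.carrier} (hx : x ∈ A.deg m) :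
    A.proj n x = 0 := by
  have := A.glue_apply (fun m => if m = n then (A.deg m).subtype else 0) m ⟨x, hx⟩
  simpa [proj, h] using this

theorem indep_of_proj {M : Type*} [AddCommGroup M] [Module k M] {S : ℕ → Submodule k M}
    (q : ℕ → M →ₗ[k] M) (h1 : ∀ n, ∀ x ∈ S n, q n x = x)
    (h2 : ∀ m n, m ≠ n → ∀ x ∈ S m, q n x = 0) : iSupIndep S := by
  rw [iSupIndep_def]
  intro i
  rw [Submodule.disjoint_def]
  intro x hx hx'
  have : (⨆ (j) (_ : j ≠ i), S j) ≤ LinearMap.ker (q i) :=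
    iSup₂_le fun j hj y hy => h2 j i hj y hy
  rw [← h1 i x hx]
  exact this hx'

theorem genTensor_indep (A B : ConicQS k) : iSupIndep fun n : ℕ => genTensor A B ^ n := by
  have h : iSupIndep fun n : ℕ =>
    Submodule.map₂ (TensorProduct.mk k A.carrier B.carrier) (A.deg n) (B.deg n) := ?_
  · exact h.mono fun n => genTensor_pow_le A B n
  refine indep_of_proj (fun n => TensorProduct.map (A.proj n) (B.proj n)) ?_ ?_
  · intro n
    have : Submodule.map₂ (TensorProduct.mk k _ _) (A.deg n) (B.deg n) ≤
        LinearMap.eqLocus (TensorProduct.map (A.proj n) (B.proj n)) LinearMap.id := by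
      rw [Submodule.map₂_le]
      intro a ha b hb
      simp [LinearMap.mem_eqLocus, proj_same _ ha, proj_same _ hb]
    exact this
  · intro m n hmn
    have : Submodule.map₂ (TensorProduct.mk k _ _) (A.deg m) (B.deg m) ≤
        LinearMap.ker (TensorProduct.map (A.proj n) (B.proj n)) := by
      rw [Submodule.map₂_le]
      intro a ha b hb
      simp [proj_ne _ hmn ha]
    exact this

/-- The product `A ∘ B = ⨁ₙ Aₙ ⊗ Bₙ`, the subalgebra of `A ⊗ B` generated by `A₁ ⊗ B₁`. -/
noncomputable def circ (A B : ConicQS k) : ConicQS k :=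
  ofSubmodule (genTensor A B) (Module.Finite.range _) (genTensor_indep A B)

/-- The inclusion of `A ∘ B` into `A ⊗ B`. -/
noncomputable def circVal (A B : ConicQS k) : (circ A B).carrier →ₐ[k] A.carrier ⊗[k] B.carrier :=
  (Algebra.adjoin k (genTensor A B : Set (A.carrier ⊗[k] B.carrier))).val

theorem circVal_injective (A B : ConicQS k) : Function.Injective (circVal A B) :=
  Subtype.val_injective

theorem mem_circ_gen {A B : ConicQS k} {x : (circ A B).carrier} :
    x ∈ (circ A B).gen ↔ circVal A B x ∈ genTensor A B := Iff.rfl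

theorem map_circ_gen (A B : ConicQS k) :
    (circ A B).gen.map (circVal A B).toLinearMap = genTensor A B := by
  refine le_antisymm (Submodule.map_comap_le _ _) fun x hx => ?_
  exact ⟨⟨x, Algebra.subset_adjoin hx⟩, hx, rfl⟩

/-- The canonical isomorphism `A₁ ⊗ B₁ ≃ (A ∘ B)₁`. -/
noncomputable def genEquiv (A B : ConicQS k) : A.gen ⊗[k] B.gen ≃ₗ[k] (circ A B).gen :=
  LinearEquiv.ofBijective
    (LinearMap.codRestrict (circ A B).gen
      (LinearMap.codRestrict (Subalgebra.toSubmodule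
        (Algebra.adjoin k (genTensor A B : Set (A.carrier ⊗[k] B.carrier))))
        (TensorProduct.mapIncl A.gen B.gen)
        fun x => Algebra.subset_adjoin (LinearMap.mem_range_self _ x))
      fun x => LinearMap.mem_range_self (TensorProduct.mapIncl A.gen B.gen) x) (by
    constructor
    · intro x y h
      have h' : TensorProduct.mapIncl A.gen B.gen x = TensorProduct.mapIncl A.gen B.gen y :=
        congrArg (fun z : (circ A B).gen => circVal A B z) h
      exact TensorProduct.map_injective_of_flat_flat _ _ (Submodule.subtype_injective _)
        (Submodule.subtype_injective _) h'
    · rintro ⟨x, y, hy⟩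
      exact ⟨y, Subtype.ext (Subtype.ext hy)⟩)

theorem circVal_genEquiv (A B : ConicQS k) (x : A.gen ⊗[k] B.gen) :
    circVal A B (genEquiv A B x : (circ A B).carrier) = TensorProduct.mapIncl A.gen B.gen x := rfl

theorem circVal_genEquiv_tmul (A B : ConicQS k) (a : A.gen) (b : B.gen) :
    circVal A B (genEquiv A B (a ⊗ₜ b) : (circ A B).carrier) =
      (a : A.carrier) ⊗ₜ[k] (b : B.carrier) := rfl

theorem circ_induction {A B : ConicQS k} {P : (circ A B).gen → Prop}
    (tmul : ∀ a b, P (genEquiv A B (a ⊗ₜ b))) (add : ∀ x y, P x → P y → P (x + y)) (x) : P x := by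
  obtain ⟨x, rfl⟩ := (genEquiv A B).surjective x
  induction x with
  | zero => simpa using tmul 0 0
  | tmul a b => exact tmul a b
  | add x y hx hy => rw [map_add]; exact add _ _ hx hy

theorem circ_hom_ext {A B C : ConicQS k} {f g : circ A B ⟶ C}
    (h : ∀ a b, genMap f (genEquiv A B (a ⊗ₜ b)) = genMap g (genEquiv A B (a ⊗ₜ b))) : f = g :=
  hom_ext fun x => circ_induction (P := fun x => genMap f x = genMap g x) h
    (fun x y hx hy => by simp only [map_add, hx, hy]) x

theorem mem_range_of_gen {A B : ConicQS k} {R : Type*} [Ring R] [Algebra k R]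
    (f : A.carrier →ₐ[k] R) (g : B.carrier →ₐ[k] R)
    (h : ∀ x ∈ A.gen, ∃ y ∈ B.gen, g y = f x) (x : A.carrier) : f x ∈ g.range := by
  have hx : x ∈ Algebra.adjoin k (A.gen : Set A.carrier) := A.adjoin_gen ▸ Algebra.mem_top
  have : Algebra.adjoin k (A.gen : Set A.carrier) ≤ g.range.comap f :=
    Algebra.adjoin_le fun x hx => by
      obtain ⟨y, _, hy⟩ := h x hx
      exact ⟨y, hy⟩
  exact this hx

/-- The morphism `h : A ⟶ B` with `g ∘ h = f`, for algebra maps `f : A → R` and `g : B → R` with `g`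
injective and `f(A₁) ⊆ g(B₁)`. -/
noncomputable def liftHom {A B : ConicQS k} {R : Type*} [Ring R] [Algebra k R]
    (f : A.carrier →ₐ[k] R) (g : B.carrier →ₐ[k] R) (hg : Function.Injective g)
    (h : ∀ x ∈ A.gen, ∃ y ∈ B.gen, g y = f x) : A ⟶ B where
  toAlgHom := ((AlgEquiv.ofInjective g hg).symm : g.range →ₐ[k] B.carrier).comp
    (f.codRestrict g.range (mem_range_of_gen f g h))
  map_gen x hx := by
    obtain ⟨y, hy, hyx⟩ := h x hx
    have : (AlgEquiv.ofInjective g hg).symm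
        (f.codRestrict g.range (mem_range_of_gen f g h) x) = y := by
      rw [AlgEquiv.symm_apply_eq]
      exact Subtype.ext hyx.symm
    exact this ▸ hy

theorem liftHom_spec {A B : ConicQS k} {R : Type*} [Ring R] [Algebra k R]
    (f : A.carrier →ₐ[k] R) (g : B.carrier →ₐ[k] R) (hg : Function.Injective g)
    (h : ∀ x ∈ A.gen, ∃ y ∈ B.gen, g y = f x) (x : A.carrier) :
    g (alg (liftHom f g hg h) x) = f x :=
  congrArg Subtype.val ((AlgEquiv.ofInjective g hg).apply_symm_apply
    (f.codRestrict g.range (mem_range_of_gen f g h) x))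

/-- Two quantum spaces with the same image in an algebra are isomorphic. -/
noncomputable def liftIso {A B : ConicQS k} {R : Type*} [Ring R] [Algebra k R]
    (f : A.carrier →ₐ[k] R) (g : B.carrier →ₐ[k] R) (hf : Function.Injective f)
    (hg : Function.Injective g) (h : ∀ x ∈ A.gen, ∃ y ∈ B.gen, g y = f x)
    (h' : ∀ y ∈ B.gen, ∃ x ∈ A.gen, f x = g y) : A ≅ B where
  hom := liftHom f g hg h
  inv := liftHom g f hf h'
  hom_inv_id := hom_ext_alg <| AlgHom.ext fun x => hf <| by
    simp [liftHom_spec]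
  inv_hom_id := hom_ext_alg <| AlgHom.ext fun x => hg <| by
    simp [liftHom_spec]

theorem liftIso_spec {A B : ConicQS k} {R : Type*} [Ring R] [Algebra k R]
    (f : A.carrier →ₐ[k] R) (g : B.carrier →ₐ[k] R) (hf : Function.Injective f)
    (hg : Function.Injective g) (h : ∀ x ∈ A.gen, ∃ y ∈ B.gen, g y = f x)
    (h' : ∀ y ∈ B.gen, ∃ x ∈ A.gen, f x = g y) (x : A.carrier) :
    g (alg (liftIso f g hf hg h h').hom x) = f x :=
  liftHom_spec f g hg h x

/-- The tensor product `f ∘ g : A ∘ B ⟶ C ∘ D` of morphisms. -/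
noncomputable def circMap {A B C D : ConicQS k} (f : A ⟶ C) (g : B ⟶ D) : circ A B ⟶ circ C D :=
  liftHom ((Algebra.TensorProduct.map (alg f) (alg g)).comp (circVal A B)) (circVal C D)
    (circVal_injective C D) fun x hx => by
      refine circ_induction (P := fun x => ∃ y ∈ (circ C D).gen, circVal C D y =
        ((Algebra.TensorProduct.map (alg f) (alg g)).comp (circVal A B)) x) ?_ ?_ ⟨x, hx⟩
      · exact fun a b => ⟨genEquiv C D (genMap f a ⊗ₜ genMap g b), Subtype.prop _, rfl⟩
      · rintro x y ⟨x', hx', ex⟩ ⟨y', hy', ey⟩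
        exact ⟨x' + y', add_mem hx' hy', by
          rw [map_add, ex, ey, Submodule.coe_add, map_add]⟩

theorem circVal_circMap {A B C D : ConicQS k} (f : A ⟶ C) (g : B ⟶ D) (x : (circ A B).carrier) :
    circVal C D (alg (circMap f g) x) =
      Algebra.TensorProduct.map (alg f) (alg g) (circVal A B x) :=
  liftHom_spec _ _ _ _ _

theorem gen_ext {A B : ConicQS k} {x y : (circ A B).gen}
    (h : circVal A B x = circVal A B y) : x = y :=
  Subtype.ext (circVal_injective A B h)

@[simp] theorem genMap_circMap {A B C D : ConicQS k} (f : A ⟶ C) (g : B ⟶ D) (a : A.gen)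
    (b : B.gen) : genMap (circMap f g) (genEquiv A B (a ⊗ₜ b)) =
      genEquiv C D (genMap f a ⊗ₜ genMap g b) :=
  gen_ext (circVal_circMap f g _)

/-- The inclusion `(A ∘ B) ∘ C → A ⊗ (B ⊗ C)`. -/
noncomputable def assocVal₁ (A B C : ConicQS k) :
    (circ (circ A B) C).carrier →ₐ[k] A.carrier ⊗[k] (B.carrier ⊗[k] C.carrier) :=
  ((Algebra.TensorProduct.assoc k k k A.carrier B.carrier C.carrier).toAlgHom.comp
    (Algebra.TensorProduct.map (circVal A B) (AlgHom.id k C.carrier))).comp (circVal (circ A B) C)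

/-- The inclusion `A ∘ (B ∘ C) → A ⊗ (B ⊗ C)`. -/
noncomputable def assocVal₂ (A B C : ConicQS k) :
    (circ A (circ B C)).carrier →ₐ[k] A.carrier ⊗[k] (B.carrier ⊗[k] C.carrier) :=
  (Algebra.TensorProduct.map (AlgHom.id k A.carrier) (circVal B C)).comp (circVal A (circ B C))

theorem assocVal₁_injective (A B C : ConicQS k) : Function.Injective (assocVal₁ A B C) := by
  refine ((Algebra.TensorProduct.assoc k k k A.carrier B.carrier C.carrier).injective.comp
    ?_).comp (circVal_injective _ _)
  exact TensorProduct.map_injective_of_flat_flat (circVal A B).toLinearMap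
    (AlgHom.id k C.carrier).toLinearMap (circVal_injective A B) Function.injective_id

theorem assocVal₂_injective (A B C : ConicQS k) : Function.Injective (assocVal₂ A B C) := by
  have h := TensorProduct.map_injective_of_flat_flat (AlgHom.id k A.carrier).toLinearMap
    (circVal B C).toLinearMap Function.injective_id (circVal_injective B C)
  exact h.comp (circVal_injective A (circ B C))

theorem assocVal₁_gen {A B C : ConicQS k} (a : A.gen) (b : B.gen) (c : C.gen) :
    assocVal₁ A B C (genEquiv (circ A B) C (genEquiv A B (a ⊗ₜ b) ⊗ₜ c)) =
      (a : A.carrier) ⊗ₜ[k] ((b : B.carrier) ⊗ₜ[k] (c : C.carrier)) := rfl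

theorem assocVal₂_gen {A B C : ConicQS k} (a : A.gen) (b : B.gen) (c : C.gen) :
    assocVal₂ A B C (genEquiv A (circ B C) (a ⊗ₜ genEquiv B C (b ⊗ₜ c))) =
      (a : A.carrier) ⊗ₜ[k] ((b : B.carrier) ⊗ₜ[k] (c : C.carrier)) := rfl

theorem circ_induction_left {A B C : ConicQS k} {P : (circ (circ A B) C).gen → Prop}
    (tmul : ∀ a b c, P (genEquiv (circ A B) C (genEquiv A B (a ⊗ₜ b) ⊗ₜ c)))
    (add : ∀ x y, P x → P y → P (x + y)) (x) : P x :=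
  circ_induction (fun p c => circ_induction
    (P := fun p => P (genEquiv (circ A B) C (p ⊗ₜ c))) (fun a b => tmul a b c)
    (fun p q hp hq => by rw [TensorProduct.add_tmul, map_add]; exact add _ _ hp hq) p) add x

theorem circ_induction_right {A B C : ConicQS k} {P : (circ A (circ B C)).gen → Prop}
    (tmul : ∀ a b c, P (genEquiv A (circ B C) (a ⊗ₜ genEquiv B C (b ⊗ₜ c))))
    (add : ∀ x y, P x → P y → P (x + y)) (x) : P x :=
  circ_induction (fun a p => circ_induction
    (P := fun p => P (genEquiv A (circ B C) (a ⊗ₜ p))) (fun b c => tmul a b c)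
    (fun p q hp hq => by rw [TensorProduct.tmul_add, map_add]; exact add _ _ hp hq) p) add x

/-- The associator `(A ∘ B) ∘ C ≅ A ∘ (B ∘ C)`. -/
noncomputable def assocIso (A B C : ConicQS k) : circ (circ A B) C ≅ circ A (circ B C) :=
  liftIso (assocVal₁ A B C) (assocVal₂ A B C) (assocVal₁_injective A B C)
    (assocVal₂_injective A B C)
    (fun x hx => by
      refine circ_induction_left (P := fun x => ∃ y ∈ (circ A (circ B C)).gen,
        assocVal₂ A B C y = assocVal₁ A B C x) (fun a b c => ⟨_, Subtype.prop _,
          (assocVal₂_gen a b c).trans (assocVal₁_gen a b c).symm⟩) ?_ ⟨x, hx⟩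
      rintro x y ⟨x', hx', ex⟩ ⟨y', hy', ey⟩
      exact ⟨x' + y', add_mem hx' hy', by rw [map_add, ex, ey, Submodule.coe_add, map_add]⟩)
    (fun x hx => by
      refine circ_induction_right (P := fun x => ∃ y ∈ (circ (circ A B) C).gen,
        assocVal₁ A B C y = assocVal₂ A B C x) (fun a b c => ⟨_, Subtype.prop _,
          (assocVal₁_gen a b c).trans (assocVal₂_gen a b c).symm⟩) ?_ ⟨x, hx⟩
      rintro x y ⟨x', hx', ex⟩ ⟨y', hy', ey⟩
      exact ⟨x' + y', add_mem hx' hy', by rw [map_add, ex, ey, Submodule.coe_add, map_add]⟩)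

theorem assocVal₂_assocIso (A B C : ConicQS k) (x : (circ (circ A B) C).carrier) :
    assocVal₂ A B C (alg (assocIso A B C).hom x) = assocVal₁ A B C x := by
  unfold assocIso; exact liftIso_spec _ _ _ _ _ _ x

@[simp] theorem genMap_assocIso (A B C : ConicQS k) (a : A.gen) (b : B.gen) (c : C.gen) :
    genMap (assocIso A B C).hom (genEquiv (circ A B) C (genEquiv A B (a ⊗ₜ b) ⊗ₜ c)) =
      genEquiv A (circ B C) (a ⊗ₜ genEquiv B C (b ⊗ₜ c)) :=
  Subtype.ext (assocVal₂_injective A B C ((assocVal₂_assocIso A B C _).trans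
    ((assocVal₁_gen a b c).trans (assocVal₂_gen a b c).symm)))

/-- Evaluation `e ↦ 1`, an algebra map `𝒦 → k`. -/
noncomputable def evalOne (k : Type u) [Field k] : (K k).carrier →ₐ[k] k :=
  Polynomial.aeval (R := k) (1 : k)

theorem evalOne_e : evalOne k (e k : (K k).carrier) = 1 := Polynomial.aeval_X (R := k) (1 : k)

theorem K_deg (n : ℕ) : (K k).deg n = Submodule.span k {(e k : (K k).carrier) ^ n} :=
  (Submodule.span_pow {(e k : (K k).carrier)} n).trans (by rw [Set.singleton_pow]; rfl)

theorem evalOne_deg {n : ℕ} {x : (K k).carrier} (hx : x ∈ (K k).deg n) :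
    evalOne k x • (e k : (K k).carrier) ^ n = x := by
  rw [K_deg, Submodule.mem_span_singleton] at hx
  obtain ⟨r, rfl⟩ := hx
  simp [evalOne_e]

theorem circVal_deg {A B : ConicQS k} {n : ℕ} {x : (circ A B).carrier}
    (hx : x ∈ (circ A B).deg n) :
    circVal A B x ∈ Submodule.map₂ (TensorProduct.mk k _ _) (A.deg n) (B.deg n) := by
  have h := Submodule.map_pow (circ A B).gen (circVal A B) n
  refine genTensor_pow_le A B n ?_
  rw [← map_circ_gen]
  exact h.le (Submodule.mem_map_of_mem hx)

theorem deg_induction (A : ConicQS k) {P : A.carrier → Prop} (zero : P 0)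
    (add : ∀ x y, P x → P y → P (x + y)) (deg : ∀ n, ∀ x ∈ A.deg n, P x) (x : A.carrier) :
    P x := by
  have hx : x ∈ ⨆ n : ℕ, A.deg n := A.iSup_deg ▸ Submodule.mem_top
  exact Submodule.iSup_induction _ (motive := P) hx deg zero add

/-- `e ⊗ a ↦ a`, as an algebra map `𝒦 ∘ A → A`. -/
noncomputable def lunitVal (A : ConicQS k) : (circ (K k) A).carrier →ₐ[k] A.carrier :=
  ((Algebra.TensorProduct.lid k A.carrier).toAlgHom.comp
    (Algebra.TensorProduct.map (evalOne k) (AlgHom.id k A.carrier))).comp (circVal (K k) A)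

/-- `a ⊗ e ↦ a`, as an algebra map `A ∘ 𝒦 → A`. -/
noncomputable def runitVal (A : ConicQS k) : (circ A (K k)).carrier →ₐ[k] A.carrier :=
  ((Algebra.TensorProduct.rid k k A.carrier).toAlgHom.comp
    (Algebra.TensorProduct.map (AlgHom.id k A.carrier) (evalOne k))).comp (circVal A (K k))

theorem lunitVal_injective (A : ConicQS k) : Function.Injective (lunitVal A) := by
  let s : A.carrier →ₗ[k] (K k).carrier ⊗[k] A.carrier :=
    A.glue fun n => TensorProduct.mk k _ _ ((e k : (K k).carrier) ^ n) ∘ₗ (A.deg n).subtype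
  have key : ∀ x, s (lunitVal A x) = circVal (K k) A x := by
    intro x
    refine deg_induction _ (P := fun x => s (lunitVal A x) = circVal (K k) A x) (by simp)
      (fun x y hx hy => by simp only [map_add, hx, hy]) (fun n x hx => ?_) x
    have hle : Submodule.map₂ (TensorProduct.mk k _ _) ((K k).deg n) (A.deg n) ≤
        LinearMap.eqLocus (s ∘ₗ ((Algebra.TensorProduct.lid k A.carrier).toAlgHom.comp
    (Algebra.TensorProduct.map (evalOne k) (AlgHom.id k A.carrier))).toLinearMap)
          LinearMap.id := by
      rw [Submodule.map₂_le]
      intro p hp a ha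
      have hs : s a = ((e k : (K k).carrier) ^ n) ⊗ₜ[k] a := A.glue_apply _ n ⟨a, ha⟩
      rw [LinearMap.mem_eqLocus]
      change s (evalOne k p • a) = p ⊗ₜ[k] a
      rw [map_smul, hs, TensorProduct.smul_tmul', evalOne_deg hp]
    exact hle (circVal_deg hx)
  exact fun x y hxy => circVal_injective _ _ (by rw [← key, ← key, hxy])

theorem runitVal_injective (A : ConicQS k) : Function.Injective (runitVal A) := by
  let s : A.carrier →ₗ[k] A.carrier ⊗[k] (K k).carrier :=
    A.glue fun n => (TensorProduct.mk k _ _).flip ((e k : (K k).carrier) ^ n) ∘ₗ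
      (A.deg n).subtype
  have key : ∀ x, s (runitVal A x) = circVal A (K k) x := by
    intro x
    refine deg_induction _ (P := fun x => s (runitVal A x) = circVal A (K k) x) (by simp)
      (fun x y hx hy => by simp only [map_add, hx, hy]) (fun n x hx => ?_) x
    have hle : Submodule.map₂ (TensorProduct.mk k _ _) (A.deg n) ((K k).deg n) ≤
        LinearMap.eqLocus (s ∘ₗ ((Algebra.TensorProduct.rid k k A.carrier).toAlgHom.comp
    (Algebra.TensorProduct.map (AlgHom.id k A.carrier) (evalOne k))).toLinearMap)
          LinearMap.id := by
      rw [Submodule.map₂_le]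
      intro a ha p hp
      have hs : s a = a ⊗ₜ[k] ((e k : (K k).carrier) ^ n) := A.glue_apply _ n ⟨a, ha⟩
      rw [LinearMap.mem_eqLocus]
      change s (evalOne k p • a) = a ⊗ₜ[k] p
      rw [map_smul, hs, ← TensorProduct.tmul_smul, evalOne_deg hp]
    exact hle (circVal_deg hx)
  exact fun x y hxy => circVal_injective _ _ (by rw [← key, ← key, hxy])

theorem lunitVal_gen {A : ConicQS k} (p : (K k).gen) (a : A.gen) :
    lunitVal A (genEquiv (K k) A (p ⊗ₜ a)) = evalOne k p • (a : A.carrier) := rfl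

theorem runitVal_gen {A : ConicQS k} (a : A.gen) (p : (K k).gen) :
    runitVal A (genEquiv A (K k) (a ⊗ₜ p)) = evalOne k p • (a : A.carrier) := rfl

theorem lunitVal_mem (A : ConicQS k) : ∀ x ∈ (circ (K k) A).gen, ∃ y ∈ A.gen,
    AlgHom.id k A.carrier y = lunitVal A x := by
  intro x hx
  refine circ_induction (P := fun x => ∃ y ∈ A.gen,
    AlgHom.id k A.carrier y = lunitVal A x) (fun p a => ⟨evalOne k p • (a : A.carrier),
      A.gen.smul_mem _ a.2, rfl⟩) ?_ ⟨x, hx⟩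
  rintro x y ⟨x', hx', ex⟩ ⟨y', hy', ey⟩
  exact ⟨x' + y', add_mem hx' hy', by rw [map_add, ex, ey, Submodule.coe_add, map_add]⟩

/-- The left unitor `𝒦 ∘ A ≅ A`, whose inverse is `a ↦ eⁿ ⊗ a` in degree `n`. -/
noncomputable def lunitIso (A : ConicQS k) : circ (K k) A ≅ A :=
  liftIso (lunitVal A) (AlgHom.id k A.carrier) (lunitVal_injective A) Function.injective_id
    (lunitVal_mem A)
    (fun x hx => ⟨genEquiv (K k) A (e k ⊗ₜ ⟨x, hx⟩), Subtype.prop _, by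
      rw [lunitVal_gen, evalOne_e, one_smul]; rfl⟩)

theorem runitVal_mem (A : ConicQS k) : ∀ x ∈ (circ A (K k)).gen, ∃ y ∈ A.gen,
    AlgHom.id k A.carrier y = runitVal A x := by
  intro x hx
  refine circ_induction (P := fun x => ∃ y ∈ A.gen,
    AlgHom.id k A.carrier y = runitVal A x) (fun a p => ⟨evalOne k p • (a : A.carrier),
      A.gen.smul_mem _ a.2, rfl⟩) ?_ ⟨x, hx⟩
  rintro x y ⟨x', hx', ex⟩ ⟨y', hy', ey⟩
  exact ⟨x' + y', add_mem hx' hy', by rw [map_add, ex, ey, Submodule.coe_add, map_add]⟩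

/-- The right unitor `A ∘ 𝒦 ≅ A`. -/
noncomputable def runitIso (A : ConicQS k) : circ A (K k) ≅ A :=
  liftIso (runitVal A) (AlgHom.id k A.carrier) (runitVal_injective A) Function.injective_id
    (runitVal_mem A)
    (fun x hx => ⟨genEquiv A (K k) (⟨x, hx⟩ ⊗ₜ e k), Subtype.prop _, by
      rw [runitVal_gen, evalOne_e, one_smul]; rfl⟩)

theorem alg_lunitIso (A : ConicQS k) (x) : alg (lunitIso A).hom x = lunitVal A x := by
  exact liftHom_spec (lunitVal A) (AlgHom.id k A.carrier) Function.injective_id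
    (lunitVal_mem A) x

@[simp] theorem genMap_lunitIso (A : ConicQS k) (p : (K k).gen) (a : A.gen) :
    genMap (lunitIso A).hom (genEquiv (K k) A (p ⊗ₜ a)) = evalOne k p • a :=
  Subtype.ext ((alg_lunitIso A _).trans (lunitVal_gen p a))

theorem alg_runitIso (A : ConicQS k) (x) : alg (runitIso A).hom x = runitVal A x := by
  exact liftHom_spec (runitVal A) (AlgHom.id k A.carrier) Function.injective_id
    (runitVal_mem A) x

@[simp] theorem genMap_runitIso (A : ConicQS k) (a : A.gen) (p : (K k).gen) :
    genMap (runitIso A).hom (genEquiv A (K k) (a ⊗ₜ p)) = evalOne k p • a :=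
  Subtype.ext ((alg_runitIso A _).trans (runitVal_gen a p))

noncomputable instance : MonoidalCategoryStruct (ConicQS k) where
  tensorObj := circ
  whiskerLeft A _ _ f := circMap (𝟙 A) f
  whiskerRight f A := circMap f (𝟙 A)
  tensorHom f g := circMap f g
  tensorUnit := K k
  associator := assocIso
  leftUnitor := lunitIso
  rightUnitor := runitIso

theorem circ_hom_ext_left {A B C D : ConicQS k} {f g : circ (circ A B) C ⟶ D}
    (h : ∀ a b c, genMap f (genEquiv (circ A B) C (genEquiv A B (a ⊗ₜ b) ⊗ₜ c)) =
      genMap g (genEquiv (circ A B) C (genEquiv A B (a ⊗ₜ b) ⊗ₜ c))) : f = g :=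
  hom_ext fun x => circ_induction_left (P := fun x => genMap f x = genMap g x) h
    (fun x y hx hy => by simp only [map_add, hx, hy]) x

theorem circMap_comp {A B C A' B' C' : ConicQS k} (f : A ⟶ B) (g : B ⟶ C) (f' : A' ⟶ B')
    (g' : B' ⟶ C') : circMap f f' ≫ circMap g g' = circMap (f ≫ g) (f' ≫ g') :=
  circ_hom_ext fun a b => by simp

theorem circMap_id (A B : ConicQS k) : circMap (𝟙 A) (𝟙 B) = 𝟙 (circ A B) :=
  circ_hom_ext fun a b => by simp

noncomputable instance : MonoidalCategory (ConicQS k) where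
  tensorHom_def f g := by
    change circMap f g = circMap f (𝟙 _) ≫ circMap (𝟙 _) g
    rw [circMap_comp, Category.comp_id, Category.id_comp]
  id_tensorHom_id A B := circMap_id A B
  tensorHom_comp_tensorHom f g f' g' := circMap_comp f f' g g'
  whiskerLeft_id A B := circMap_id A B
  id_whiskerRight A B := circMap_id A B
  associator_naturality {A B C A' B' C'} f g h := by
    change circMap (circMap f g) h ≫ (assocIso A' B' C').hom =
      (assocIso A B C).hom ≫ circMap f (circMap g h)
    exact circ_hom_ext_left fun a b c => by simp
  leftUnitor_naturality {A B} f := by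
    change circMap (𝟙 (K k)) f ≫ (lunitIso B).hom = (lunitIso A).hom ≫ f
    exact circ_hom_ext fun a b => by simp
  rightUnitor_naturality {A B} f := by
    change circMap f (𝟙 (K k)) ≫ (runitIso B).hom = (runitIso A).hom ≫ f
    exact circ_hom_ext fun a b => by simp
  pentagon A B C D := by
    change circMap (assocIso A B C).hom (𝟙 D) ≫ (assocIso A (circ B C) D).hom ≫
        circMap (𝟙 A) (assocIso B C D).hom =
      (assocIso (circ A B) C D).hom ≫ (assocIso A B (circ C D)).hom
    refine circ_hom_ext fun x d => circ_induction_left (P := fun x =>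
      genMap (circMap (assocIso A B C).hom (𝟙 D) ≫ (assocIso A (circ B C) D).hom ≫
        circMap (𝟙 A) (assocIso B C D).hom) (genEquiv (circ (circ A B) C) D (x ⊗ₜ d)) =
      genMap ((assocIso (circ A B) C D).hom ≫ (assocIso A B (circ C D)).hom)
        (genEquiv (circ (circ A B) C) D (x ⊗ₜ d))) (fun a b c => by simp)
      (fun x y hx hy => by simp only [TensorProduct.add_tmul, map_add, hx, hy]) x
  triangle A B := by
    change (assocIso A (K k) B).hom ≫ circMap (𝟙 A) (lunitIso B).hom =
      circMap (runitIso A).hom (𝟙 B)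
    exact circ_hom_ext_left fun a p b => by simp [← TensorProduct.smul_tmul']

end ConicQS

/-- A graded vector space. -/
structure GrVct (k : Type u) [Field k] where
  carrier : Type u
  [addCommGroup : AddCommGroup carrier]
  [module : Module k carrier]
  deg : ℕ → Submodule k carrier
  internal : DirectSum.IsInternal deg

namespace GrVct

attribute [instance] GrVct.addCommGroup GrVct.module

variable {k : Type u} [Field k]

/-- Homogeneous linear maps. -/
@[ext]
structure Hom (V W : GrVct k) where
  toLin : V.carrier →ₗ[k] W.carrier
  map_deg : ∀ n, ∀ x ∈ V.deg n, toLin x ∈ W.deg n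

instance : Category (GrVct k) where
  Hom := Hom
  id V := ⟨LinearMap.id, fun _ _ h => h⟩
  comp f g := ⟨g.toLin ∘ₗ f.toLin, fun n x h => g.map_deg n _ (f.map_deg n x h)⟩

/-- The linear map underlying a morphism of graded vector spaces. -/
def lin {V W : GrVct k} (f : V ⟶ W) : V.carrier →ₗ[k] W.carrier := Hom.toLin f

theorem lin_mem {V W : GrVct k} (f : V ⟶ W) {n : ℕ} {x : V.carrier} (hx : x ∈ V.deg n) :
    lin f x ∈ W.deg n := Hom.map_deg f n x hx

end GrVct

namespace ConicQS

variable {k : Type u} [Field k]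

theorem alg_mem_deg {A B : ConicQS k} (f : A ⟶ B) {n : ℕ} {x : A.carrier} (hx : x ∈ A.deg n) :
    alg f x ∈ B.deg n := by
  have h : A.gen.map (alg f).toLinearMap ≤ B.gen := by
    rintro _ ⟨y, hy, rfl⟩
    exact alg_mem f hy
  have h' := Submodule.map_pow A.gen (alg f) n
  exact (h'.le.trans (pow_le_pow_left' h n)) (Submodule.mem_map_of_mem hx)

/-- The forgetful functor from conic quantum spaces to graded vector spaces. -/
noncomputable def forgetGr (k : Type u) [Field k] : ConicQS k ⥤ GrVct k where
  obj A := { carrier := A.carrier, deg := A.deg, internal := A.isInternal }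
  map f := { toLin := (alg f).toLinearMap, map_deg := fun _ _ hx => alg_mem_deg f hx }

/-- A homogeneous linear map between quantum spaces, as a map of the underlying algebras. -/
noncomputable def grLin {A B : ConicQS k} (φ : (forgetGr k).obj A ⟶ (forgetGr k).obj B) :
    A.carrier →ₗ[k] B.carrier := GrVct.lin φ

theorem grLin_mem {A B : ConicQS k} (φ : (forgetGr k).obj A ⟶ (forgetGr k).obj B) {n : ℕ}
    {x : A.carrier} (hx : x ∈ A.deg n) : grLin φ x ∈ B.deg n := GrVct.lin_mem φ hx

/-- The restriction of a homogeneous linear map to degree one. -/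
noncomputable def grLinGen {A B : ConicQS k} (φ : (forgetGr k).obj A ⟶ (forgetGr k).obj B) :
    A.gen →ₗ[k] B.gen :=
  (grLin φ).restrict fun x hx => by
    have h := grLin_mem φ (n := 1) (x := x) (by rw [deg, pow_one]; exact hx)
    rwa [deg, pow_one] at h

/-- Multiplication `A₁^{⊗n} → A`. -/
noncomputable def prodMap (A : ConicQS k) (n : ℕ) : ⨂[k]^n A.gen →ₗ[k] A.carrier :=
  PiTensorProduct.lift
    ((MultilinearMap.mkPiAlgebraFin k n A.carrier).compLinearMap fun _ => A.gen.subtype)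

/-- The relations `Iₙ ⊆ A₁^{⊗n}` of degree `n` of `A`: the kernel of multiplication. -/
noncomputable def rel (A : ConicQS k) (n : ℕ) : Submodule k (⨂[k]^n A.gen) :=
  LinearMap.ker (A.prodMap n)

end ConicQS

section Cochains

variable (k : Type*) [Field k] (V : Type*) [AddCommMonoid V] [Module k V]

/-- `C¹[V]`: homogeneous linear automorphisms of the tensor algebra `V^⊗`. -/
abbrev Cochain1 := ∀ n : ℕ, ⨂[k]^n V ≃ₗ[k] ⨂[k]^n V

/-- `C²[V]`: bihomogeneous linear automorphisms of `V^⊗ ⊗ V^⊗`. -/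
abbrev Cochain2 := ∀ r s : ℕ, (⨂[k]^r V ⊗[k] ⨂[k]^s V) ≃ₗ[k] (⨂[k]^r V ⊗[k] ⨂[k]^s V)

variable {k V}

namespace Cochain2

/-- `ψ` is the identity whenever one of the two arguments has degree `0`. -/
def IsCounital (ψ : Cochain2 k V) : Prop :=
  (∀ s, ψ 0 s = LinearEquiv.refl k _) ∧ (∀ r, ψ r 0 = LinearEquiv.refl k _)

/-- `ψ ⊗ 𝕀` on `V^{⊗r} ⊗ V^{⊗s} ⊗ V^{⊗t}`. -/
noncomputable def tensorRightId (ψ : Cochain2 k V) (r s t : ℕ) :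
    ((⨂[k]^r V ⊗[k] ⨂[k]^s V) ⊗[k] ⨂[k]^t V) ≃ₗ[k] ((⨂[k]^r V ⊗[k] ⨂[k]^s V) ⊗[k] ⨂[k]^t V) :=
  TensorProduct.congr (ψ r s) (LinearEquiv.refl k _)

/-- `𝕀 ⊗ ψ` on `V^{⊗r} ⊗ V^{⊗s} ⊗ V^{⊗t}`. -/
noncomputable def tensorLeftId (ψ : Cochain2 k V) (r s t : ℕ) :
    (⨂[k]^r V ⊗[k] (⨂[k]^s V ⊗[k] ⨂[k]^t V)) ≃ₗ[k] (⨂[k]^r V ⊗[k] (⨂[k]^s V ⊗[k] ⨂[k]^t V)) :=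
  TensorProduct.congr (LinearEquiv.refl k _) (ψ s t)

/-- `ψ_{r+s,t}` on `V^{⊗r} ⊗ V^{⊗s} ⊗ V^{⊗t}`. -/
noncomputable def mergeLeft (ψ : Cochain2 k V) (r s t : ℕ) :
    ((⨂[k]^r V ⊗[k] ⨂[k]^s V) ⊗[k] ⨂[k]^t V) ≃ₗ[k] ((⨂[k]^r V ⊗[k] ⨂[k]^s V) ⊗[k] ⨂[k]^t V) :=
  TensorProduct.congr TensorPower.mulEquiv (LinearEquiv.refl k _) ≪≫ₗ ψ (r + s) t ≪≫ₗ
    (TensorProduct.congr TensorPower.mulEquiv (LinearEquiv.refl k _)).symm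

/-- `ψ_{r,s+t}` on `V^{⊗r} ⊗ V^{⊗s} ⊗ V^{⊗t}`. -/
noncomputable def mergeRight (ψ : Cochain2 k V) (r s t : ℕ) :
    (⨂[k]^r V ⊗[k] (⨂[k]^s V ⊗[k] ⨂[k]^t V)) ≃ₗ[k] (⨂[k]^r V ⊗[k] (⨂[k]^s V ⊗[k] ⨂[k]^t V)) :=
  TensorProduct.congr (LinearEquiv.refl k _) TensorPower.mulEquiv ≪≫ₗ ψ r (s + t) ≪≫ₗ
    (TensorProduct.congr (LinearEquiv.refl k _) TensorPower.mulEquiv).symm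

/-- The cocycle condition `ψ_{r+s,t} (ψ_{r,s} ⊗ 𝕀) = ψ_{r,s+t} (𝕀 ⊗ ψ_{s,t})`, that is, associativity
of the product `m ∘ ψ` on the tensor algebra. -/
def IsCocycle (ψ : Cochain2 k V) : Prop :=
  ∀ r s t : ℕ, tensorRightId ψ r s t ≪≫ₗ mergeLeft ψ r s t ≪≫ₗ TensorProduct.assoc k _ _ _ =
    TensorProduct.assoc k _ _ _ ≪≫ₗ tensorLeftId ψ r s t ≪≫ₗ mergeRight ψ r s t

/-- `ψ ∈ Z²[V]`: counital 2-cocycles. -/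
def IsZ2 (ψ : Cochain2 k V) : Prop := ψ.IsCounital ∧ ψ.IsCocycle

/-- The coboundary `(∂θ)_{r,s} = θ_{r+s} (θ_r ⊗ θ_s)⁻¹` of `θ ∈ C¹[V]`. -/
noncomputable def coboundary (θ : Cochain1 k V) : Cochain2 k V := fun r s =>
  (TensorProduct.congr (θ r) (θ s)).symm ≪≫ₗ
    (TensorPower.mulEquiv ≪≫ₗ θ (r + s) ≪≫ₗ TensorPower.mulEquiv.symm)

/-- The primitive `θ` of a counital 2-cocycle `ψ`, that is, the 1-cochain with `θ₀ = 𝕀`, `θ₁ = 𝕀` and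
`ψ = ∂θ`. It is determined by `θ_{n+1} = ψ_{n,1} (θ_n ⊗ 𝕀)`. -/
noncomputable def primitive (ψ : Cochain2 k V) : Cochain1 k V
  | 0 => LinearEquiv.refl k _
  | n + 1 => TensorPower.mulEquiv.symm ≪≫ₗ
      (TensorProduct.congr (primitive ψ n) (LinearEquiv.refl k (⨂[k]^1 V)) ≪≫ₗ ψ n 1) ≪≫ₗ
        TensorPower.mulEquiv

/-- The inverse twist `𝔦ψ = ∂(θ⁻¹)` of `ψ = ∂θ`. -/
noncomputable def inv (ψ : Cochain2 k V) : Cochain2 k V :=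
  coboundary fun n => (primitive ψ n).symm

section Dual

variable {U : Type*} [AddCommGroup U] [Module k U] [Module.Finite k U]

/-- The canonical isomorphism `U*^{⊗n} ≃ (U^{⊗n})*`. -/
noncomputable def dualPower (n : ℕ) :
    ⨂[k]^n (Module.Dual k U) ≃ₗ[k] Module.Dual k (⨂[k]^n U) :=
  PiTensorProduct.dualDistribEquiv (M := fun _ : Fin n => U)

/-- The canonical isomorphism `U*^{⊗r} ⊗ U*^{⊗s} ≃ (U^{⊗r} ⊗ U^{⊗s})*`. -/
noncomputable def dualPairing (r s : ℕ) :
    (⨂[k]^r (Module.Dual k U) ⊗[k] ⨂[k]^s (Module.Dual k U)) ≃ₗ[k]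
      Module.Dual k (⨂[k]^r U ⊗[k] ⨂[k]^s U) :=
  TensorProduct.congr (dualPower r) (dualPower s) ≪≫ₗ
    TensorProduct.dualDistribEquiv k (⨂[k]^r U) (⨂[k]^s U)

/-- `ψ^! ∈ C²[U*]`, the transpose of `ψ⁻¹`. -/
noncomputable def dual (ψ : Cochain2 k U) : Cochain2 k (Module.Dual k U) := fun r s =>
  dualPairing r s ≪≫ₗ (ψ r s).symm.dualMap ≪≫ₗ (dualPairing r s).symm

end Dual

end Cochain2

variable {W : Type*} [AddCommMonoid W] [Module k W]

/-- The map `V^{⊗n} ⊗ W^{⊗n} → (V ⊗ W)^{⊗n}`,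
`(v₁ ⋯ vₙ) ⊗ (w₁ ⋯ wₙ) ↦ (v₁ ⊗ w₁) ⋯ (vₙ ⊗ wₙ)`. -/
noncomputable def tensorPowerZip (n : ℕ) :
    (⨂[k]^n V ⊗[k] ⨂[k]^n W) →ₗ[k] ⨂[k]^n (V ⊗[k] W) :=
  TensorProduct.lift (PiTensorProduct.map₂ fun _ => TensorProduct.mk k V W)

theorem tensorPowerZip_tprod (n : ℕ) (v : Fin n → V) (w : Fin n → W) :
    tensorPowerZip n (PiTensorProduct.tprod k v ⊗ₜ[k] PiTensorProduct.tprod k w) =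
      PiTensorProduct.tprod k fun i => v i ⊗ₜ[k] w i := by
  simp [tensorPowerZip, PiTensorProduct.map₂_tprod_tprod]

theorem tensorPowerZip_bijective (n : ℕ) :
    Function.Bijective (tensorPowerZip (k := k) (V := V) (W := W) n) := by
  have hV : Module.Free k V := by
    let := Module.addCommMonoidToAddCommGroup k (M := V)
    exact Module.Free.of_divisionRing k V
  have hW : Module.Free k W := by
    let := Module.addCommMonoidToAddCommGroup k (M := W)
    exact Module.Free.of_divisionRing k W
  let b := Module.Free.chooseBasis k V
  let c := Module.Free.chooseBasis k W
  let b' := Basis.piTensorProduct (R := k) (fun _ : Fin n => b)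
  let c' := Basis.piTensorProduct (R := k) (fun _ : Fin n => c)
  let d' := Basis.piTensorProduct (R := k) (fun _ : Fin n => b.tensorProduct c)
  let E := (b'.tensorProduct c').equiv d' (Equiv.arrowProdEquivProdArrow _ _ _).symm
  have : tensorPowerZip (k := k) (V := V) (W := W) n = E.toLinearMap := by
    refine (b'.tensorProduct c').ext fun ⟨p, q⟩ => ?_
    have h1 : (b'.tensorProduct c') (p, q) = PiTensorProduct.tprod k (fun i => b (p i)) ⊗ₜ[k]
        PiTensorProduct.tprod k (fun i => c (q i)) := by
      simp [b', c', Module.Basis.tensorProduct_apply]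
    have h2 : E ((b'.tensorProduct c') (p, q)) =
        PiTensorProduct.tprod k (fun i => b (p i) ⊗ₜ[k] c (q i)) := by
      rw [Module.Basis.equiv_apply]
      simp [d', Module.Basis.tensorProduct_apply]
    rw [LinearEquiv.coe_coe, h2, h1, tensorPowerZip_tprod]
  rw [this]
  exact E.bijective

/-- The canonical isomorphism `V^{⊗n} ⊗ W^{⊗n} ≃ (V ⊗ W)^{⊗n}`. -/
noncomputable def tensorPowerShuffle (n : ℕ) :
    (⨂[k]^n V ⊗[k] ⨂[k]^n W) ≃ₗ[k] ⨂[k]^n (V ⊗[k] W) :=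
  LinearEquiv.ofBijective (tensorPowerZip n) (tensorPowerZip_bijective n)

/-- The cochain `𝔧(ψ, χ) ∈ C²[V ⊗ W]` of `ψ ∈ C²[V]` and `χ ∈ C²[W]`: it acts on
`(V ⊗ W)^{⊗r} ⊗ (V ⊗ W)^{⊗s} ≃ (V^{⊗r} ⊗ V^{⊗s}) ⊗ (W^{⊗r} ⊗ W^{⊗s})` as `ψ ⊗ χ`. -/
noncomputable def Cochain2.prod (ψ : Cochain2 k V) (χ : Cochain2 k W) :
    Cochain2 k (V ⊗[k] W) := fun r s =>
  let sh := TensorProduct.tensorTensorTensorComm k (⨂[k]^r V) (⨂[k]^s V) (⨂[k]^r W) (⨂[k]^s W) ≪≫ₗ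
    TensorProduct.congr (tensorPowerShuffle r) (tensorPowerShuffle s)
  sh.symm ≪≫ₗ TensorProduct.congr (ψ r s) (χ r s) ≪≫ₗ sh

/-- The identity cochain. -/
noncomputable def Cochain2.one : Cochain2 k V := fun _ _ => LinearEquiv.refl k _

end Cochains

namespace ConicQS

variable {k : Type u} [Field k]

/-- The automorphism `Ψ` of `A ⊗ A` is induced by the cochain `ψ ∈ C²[A₁]`. -/
def Induces (A : ConicQS k) (ψ : Cochain2 k A.gen)
    (Ψ : (A.carrier ⊗[k] A.carrier) ≃ₗ[k] (A.carrier ⊗[k] A.carrier)) : Prop :=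
  ∀ (r s : ℕ) (t : ⨂[k]^r A.gen ⊗[k] ⨂[k]^s A.gen),
    Ψ (TensorProduct.map (A.prodMap r) (A.prodMap s) t) =
      TensorProduct.map (A.prodMap r) (A.prodMap s) (ψ r s t)

/-- `P ⊗ Q ⊆ V^{⊗(m+n)}` for `P ⊆ V^{⊗m}` and `Q ⊆ V^{⊗n}`. -/
noncomputable def concat {V : Type*} [AddCommMonoid V] [Module k V] {m n : ℕ}
    (P : Submodule k (⨂[k]^m V)) (Q : Submodule k (⨂[k]^n V)) :
    Submodule k (⨂[k]^(m + n) V) :=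
  (Submodule.map₂ (TensorProduct.mk k _ _) P Q).map
    (TensorPower.mulEquiv (R := k) (M := V) (n := m) (m := n)).toLinearMap

/-- The cochain `χ ∈ C²[A₁]` is 2nd `A`-admissible: in each of its two arguments, `χ` preserves each
of the subspaces `A₁^{⊗a} ⊗ I_b ⊗ A₁^{⊗c}` that span the ideal of relations of `A`. -/
def SecondAdmissible (A : ConicQS k) (χ : Cochain2 k A.gen) : Prop :=
  ∀ a b c n : ℕ,
    let P : Submodule k (⨂[k]^(a + b + c) A.gen) := concat (concat ⊤ (A.rel b)) ⊤
    (Submodule.map₂ (TensorProduct.mk k _ (⨂[k]^n A.gen)) P ⊤).map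
        (χ (a + b + c) n).toLinearMap = Submodule.map₂ (TensorProduct.mk k _ _) P ⊤ ∧
    (Submodule.map₂ (TensorProduct.mk k (⨂[k]^n A.gen) _) ⊤ P).map
        (χ n (a + b + c)).toLinearMap = Submodule.map₂ (TensorProduct.mk k _ _) ⊤ P

/-- The comma category `(𝔥(A) ↓ 𝔥(CA ∘ B))` of pairs `⟨φ, H⟩` with `φ : A → H ∘ B` homogeneous
linear. -/
abbrev Diag (A B : ConicQS k) : Type _ :=
  StructuredArrow ((forgetGr k).obj A) (tensorRight B ⋙ forgetGr k)

namespace Diag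

variable {A B : ConicQS k}

/-- The map `φ` of a diagram `⟨φ, H⟩`. -/
noncomputable def map (X : Diag A B) : (forgetGr k).obj A ⟶ (forgetGr k).obj (X.right ⊗ B) := X.hom

/-- `B₁* ⊗ A₁ → H₁`, `b^j ⊗ a_i ↦ h_i^j`, where `φ(a_i) = Σ_j h_i^j ⊗ b_j`. -/
noncomputable def coeff (X : Diag A B) : Module.Dual k B.gen ⊗[k] A.gen →ₗ[k] X.right.gen :=
  TensorProduct.lift
    ((LinearMap.lcomp k X.right.gen
        ((genEquiv X.right B).symm.toLinearMap ∘ₗ grLinGen X.map)) ∘ₗ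
      (LinearMap.llcomp k (X.right.gen ⊗[k] B.gen) (X.right.gen ⊗[k] k) X.right.gen
        (TensorProduct.rid k X.right.gen).toLinearMap) ∘ₗ
      LinearMap.lTensorHom X.right.gen)

/-- The subspace `H₁^φ` of `H₁` spanned by the `h_i^j`. -/
noncomputable def coeffSpace (X : Diag A B) : Submodule k X.right.carrier :=
  (LinearMap.range X.coeff).map X.right.gen.subtype

theorem coeffSpace_le (X : Diag A B) : X.coeffSpace ≤ X.right.gen :=
  Submodule.map_subtype_le _ _

/-- The quantum space `H^φ` generated by `H₁^φ`. -/
noncomputable def core (X : Diag A B) : ConicQS k := X.right.sub X.coeffSpace X.coeffSpace_le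

/-- The inclusion of `H^φ` into `H`. -/
noncomputable def coreIncl (X : Diag A B) : X.core ⟶ X.right :=
  X.right.subIncl X.coeffSpace X.coeffSpace_le

/-- The surjection `π^φ : B₁* ⊗ A₁ → H₁^φ`. -/
noncomputable def coreCoeff (X : Diag A B) : Module.Dual k B.gen ⊗[k] A.gen →ₗ[k] X.core.gen :=
  LinearMap.codRestrict X.core.gen
    (LinearMap.codRestrict
      (Subalgebra.toSubmodule (Algebra.adjoin k (X.coeffSpace : Set X.right.carrier)))
      (X.right.gen.subtype ∘ₗ X.coeff)
      fun x => Algebra.subset_adjoin (Submodule.mem_map_of_mem (LinearMap.mem_range_self _ x)))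
    fun x => Submodule.mem_map_of_mem (LinearMap.mem_range_self X.coeff x)

/-- `π^φ ⊗ 𝕀 : B₁* ⊗ A₁ ⊗ B₁ → H₁^φ ⊗ B₁ = (H^φ ∘ B)₁`. -/
noncomputable def coreProj (X : Diag A B) :
    (Module.Dual k B.gen ⊗[k] A.gen) ⊗[k] B.gen →ₗ[k] (X.core ⊗ B : ConicQS k).gen :=
  (genEquiv X.core B).toLinearMap ∘ₗ LinearMap.rTensor B.gen X.coreCoeff

/-- Membership in `Ω^{A,B}`: the cochain `ω ∈ C²[B₁* ⊗ A₁ ⊗ B₁]` descends along `π^φ` to a counital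
2-cocycle `ω' ∈ Z²[H₁^φ ⊗ B₁]`, which is admissible for `H^φ ∘ B`, that is, induces an automorphism
`Ψ` of `(H^φ ∘ B) ⊗ (H^φ ∘ B)`, and `φ` is a morphism of quantum spaces `A → (H^φ ∘ B)_ω`, where the
twisted space `(H^φ ∘ B)_ω` is the graded vector space `H^φ ∘ B` with the same generators, the same
unit and the product `m ∘ Ψ`. -/
def InOmega (ω : Cochain2 k ((Module.Dual k B.gen ⊗[k] A.gen) ⊗[k] B.gen)) (X : Diag A B) :
    Prop :=
  ∃ ω' : Cochain2 k (X.core ⊗ B : ConicQS k).gen, ω'.IsZ2 ∧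
    (∀ r s t, ω' r s (TensorProduct.map (PiTensorProduct.map fun _ => X.coreProj)
        (PiTensorProduct.map fun _ => X.coreProj) t) =
      TensorProduct.map (PiTensorProduct.map fun _ => X.coreProj)
        (PiTensorProduct.map fun _ => X.coreProj) (ω r s t)) ∧
    ∃ Ψ, (X.core ⊗ B).Induces ω' Ψ ∧
      ∃ g : (forgetGr k).obj A ⟶ (forgetGr k).obj (X.core ⊗ B),
        g ≫ (forgetGr k).map (X.coreIncl ▷ B) = X.map ∧
        grLin g 1 = 1 ∧
        ∀ x y : A.carrier, grLin g (x * y) = LinearMap.mul' k _ (Ψ (grLin g x ⊗ₜ[k] grLin g y))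

end Diag

/-- The full subcategory `Ω^{A,B}` of the comma category. -/
abbrev Omega (A B : ConicQS k)
    (ω : Cochain2 k ((Module.Dual k B.gen ⊗[k] A.gen) ⊗[k] B.gen)) : Type _ :=
  (show ObjectProperty (Diag A B) from Diag.InOmega ω).FullSubcategory

/-- The collection `{ω_{A,B}}` is factorizable through `{ψ_A}`:
`ω_{A,B} = 𝔧(ψ_B^!, ψ_A, 𝕀)` for all `A` and `B`, with `ψ_A ∈ Z²[A₁]`. -/
def Factorizes (ω : ∀ A B : ConicQS k, Cochain2 k ((Module.Dual k B.gen ⊗[k] A.gen) ⊗[k] B.gen))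
    (ψ : ∀ A : ConicQS k, Cochain2 k A.gen) : Prop :=
  (∀ A, (ψ A).IsZ2) ∧ ∀ A B, ω A B = ((ψ B).dual.prod (ψ A)).prod Cochain2.one

end ConicQS

/-- A `V`-cobased category (a category enriched over `Vᵒᵖ`) with objects `C` and the object of
morphisms from `X` to `Y` given by `hom X Y`. -/
structure CobasedCategory {V : Type*} [Category* V] [MonoidalCategory V] {C : Type*}
    (hom : C → C → V) where
  /-- The cocomposition. -/
  cocomp : ∀ X Y Z : C, hom X Z ⟶ hom Y Z ⊗ hom X Y
  /-- The counit. -/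
  counit : ∀ X : C, hom X X ⟶ 𝟙_ V
  counit_left : ∀ X Y : C, cocomp X Y Y ≫ counit Y ▷ hom X Y ≫ (λ_ (hom X Y)).hom = 𝟙 (hom X Y)
  counit_right : ∀ X Y : C, cocomp X X Y ≫ hom X Y ◁ counit X ≫ (ρ_ (hom X Y)).hom = 𝟙 (hom X Y)
  coassoc : ∀ W X Y Z : C,
    cocomp W X Z ≫ cocomp X Y Z ▷ hom W X ≫ (α_ (hom Y Z) (hom X Y) (hom W X)).hom =
      cocomp W Y Z ≫ hom Y Z ◁ cocomp W X Y

/-! Write ψ_A = ∂θ_A. Then ω_{A,B} is the coboundary of θ_B^! ⊗ θ_A ⊗ id (`dual_prod_prod_one_eq`),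
so a morphism φ into the twisted space is determined by its coefficients h : B₁* ⊗ A₁ → H₁: the
value φ(a₁⋯aₙ) is found by coevaluating every letter, applying θ_B^! ⊗ θ_A ⊗ id and multiplying in H
⊗ B. In the canonical element Σ_J b^J ⊗ b_J the contragredient of θ_B on the dual leg equals θ_B⁻¹
on the other leg (`map_comp_coevTensor`). With μ_A = m_A θ_A⁻¹, whose kernel in degree n is θ_A(Iₙ),
the condition becomes φ(μ_A s) = Σ_J hⁿ(b^J ⊗ s) ⊗ μ_B(b_J), which is `IsTwisted`: the cocycles have
been absorbed into the relations of A and B.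

For given h such a φ exists exactly when the right side vanishes for s in θ_A(Iₙ(A)). By
`map_coevTensor_eq_zero_iff` this says that hⁿ kills θ_B(Iₙ(B))^⊥ ⊗ θ_A(Iₙ(A)), which is
`PairKills`. Every object of Ω satisfies these relations (`isTwisted_of_inOmega`), so the quotient
of the tensor algebra of B₁* ⊗ A₁ by them maps uniquely to each of them. The relations vanish in
degrees 0 and 1, hence the b^j ⊗ a_i stay a basis of the generators.

It remains to see that the universal pair lies in Ω, that is, that ω descends to it. Here
admissibility is needed. Stability of a subspace under 𝔦ψ = ∂(θ⁻¹) means that θ is multiplicative on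
it; therefore θ maps A₁^{⊗a} ⊗ I_b ⊗ A₁^{⊗c} onto A₁^{⊗a} ⊗ θ(I_b) ⊗ A₁^{⊗c}, and ψ preserves the
latter in each argument (`twistedIdeal_eq`, `twistedIdeal_stable`). Consequently ψ_B^! ⊗ ψ_A
preserves the kernel of multiplication (`exists_descent`).

The cobased structure comes from composing killing conditions. If the coefficients of A → H ∘ B kill
Q^⊥ ⊗ P and those of B → H' ∘ C kill N^⊥ ⊗ Q, then their matrix product kills N^⊥ ⊗ P
(`pairKills_convGen`), and the identity matrix kills P^⊥ ⊗ P. Both conditions involve the same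
twisted relations Q of B, so cocomposition and counit exist by universality. The axioms are
identities between morphisms and hold because they hold on generators. -/

section Coev

/-! ### Factorization through kernels and the canonical element of E* ⊗ E -/

variable {k : Type*} [Field k] {E : Type*} [AddCommGroup E] [Module k E]

/-- Over a field the range of f has a complement, so a section over the range extends to all of N.
The domain may be a mere additive monoid, so that tensor powers of such modules qualify; negation
comes from the scalar -1. -/
theorem exists_linear_section {M N : Type*} [AddCommMonoid M] [Module k M] [AddCommGroup N]
    [Module k N] (f : M →ₗ[k] N) : ∃ σ : N →ₗ[k] M, ∀ x, f (σ (f x)) = f x := by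
  let := Module.addCommMonoidToAddCommGroup k (M := M)
  obtain ⟨σ, hσ⟩ := LinearMap.exists_rightInverse_of_surjective f.rangeRestrict
    (LinearMap.range_rangeRestrict f)
  obtain ⟨p, hp⟩ := Submodule.exists_isCompl (LinearMap.range f)
  refine ⟨σ ∘ₗ (LinearMap.range f).projectionOnto p hp, fun x => ?_⟩
  have h1 : (LinearMap.range f).projectionOnto p hp (f x) = ⟨f x, LinearMap.mem_range_self f x⟩ :=
    Submodule.projectionOnto_apply_left hp ⟨f x, LinearMap.mem_range_self f x⟩
  have h2 := LinearMap.congr_fun hσ ⟨f x, LinearMap.mem_range_self f x⟩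
  simpa [h1] using congrArg Subtype.val h2

theorem exists_projection (P : Submodule k E) :
    ∃ π : E →ₗ[k] E, (∀ x, π x ∈ P) ∧ ∀ x ∈ P, π x = x := by
  obtain ⟨p, hp⟩ := Submodule.exists_isCompl P
  exact ⟨P.subtype ∘ₗ P.projectionOnto p hp, fun x => Subtype.prop _, fun x hx =>
    congrArg Subtype.val (Submodule.projectionOnto_apply_left hp ⟨x, hx⟩)⟩

/-- A linear map vanishing on `ker f ⊗ N` and `M ⊗ ker g` factors through `f ⊗ g`. -/
theorem exists_factor_map {M N M' N' Q : Type*} [AddCommMonoid M] [Module k M] [AddCommMonoid N]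
    [Module k N] [AddCommGroup M'] [Module k M'] [AddCommGroup N'] [Module k N']
    [AddCommGroup Q] [Module k Q] (f : M →ₗ[k] M') (g : N →ₗ[k] N') (q : M ⊗[k] N →ₗ[k] Q)
    (hf : ∀ x y, f x = 0 → q (x ⊗ₜ y) = 0) (hg : ∀ x y, g y = 0 → q (x ⊗ₜ y) = 0) :
    ∃ Φ : M' ⊗[k] N' →ₗ[k] Q, Φ ∘ₗ TensorProduct.map f g = q := by
  let := Module.addCommMonoidToAddCommGroup k (M := M)
  let := Module.addCommMonoidToAddCommGroup k (M := N)
  obtain ⟨σ, hσ⟩ := exists_linear_section f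
  obtain ⟨τ, hτ⟩ := exists_linear_section g
  refine ⟨q ∘ₗ TensorProduct.map σ τ, TensorProduct.ext' fun x y => ?_⟩
  have h1 : q ((σ (f x) - x) ⊗ₜ τ (g y)) = 0 := hf _ _ (by rw [map_sub, hσ, sub_self])
  have h2 : q (x ⊗ₜ (τ (g y) - y)) = 0 := hg _ _ (by rw [map_sub, hτ, sub_self])
  rw [TensorProduct.sub_tmul, map_sub, sub_eq_zero] at h1
  rw [TensorProduct.tmul_sub, map_sub, sub_eq_zero] at h2
  simp [h1, h2]

theorem exists_factor {M M' Q : Type*} [AddCommMonoid M] [Module k M] [AddCommGroup M']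
    [Module k M'] [AddCommGroup Q] [Module k Q] (f : M →ₗ[k] M') (q : M →ₗ[k] Q)
    (hf : ∀ x, f x = 0 → q x = 0) : ∃ Φ : M' →ₗ[k] Q, Φ ∘ₗ f = q := by
  let := Module.addCommMonoidToAddCommGroup k (M := M)
  obtain ⟨σ, hσ⟩ := exists_linear_section f
  refine ⟨q ∘ₗ σ, LinearMap.ext fun x => ?_⟩
  have h1 : q (σ (f x) - x) = 0 := hf _ (by rw [map_sub, hσ, sub_self])
  rw [map_sub, sub_eq_zero] at h1
  simpa using h1

variable [FiniteDimensional k E]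

variable (k E) in
/-- The canonical element of `E* ⊗ E`. -/
noncomputable def coevTensor : Module.Dual k E ⊗[k] E := (dualTensorHomEquiv k E E).symm LinearMap.id

theorem dualTensorHom_coevTensor : dualTensorHom k E E (coevTensor k E) = LinearMap.id :=
  (dualTensorHomEquiv k E E).apply_symm_apply LinearMap.id

theorem dualTensorHom_inj {x y : Module.Dual k E ⊗[k] E}
    (h : dualTensorHom k E E x = dualTensorHom k E E y) : x = y :=
  (dualTensorHomEquiv k E E).injective h

theorem coevTensor_eq_sum {ι : Type*} [Fintype ι] (b : Module.Basis ι k E) :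
    coevTensor k E = ∑ i, b.coord i ⊗ₜ b i := by
  apply dualTensorHom_inj
  rw [dualTensorHom_coevTensor]
  ext x
  simp [b.sum_repr]

/-- Under E* ⊗ E ≃ End E the canonical element is the identity, and the two sides are id followed by
T and T followed by id. -/
theorem lTensor_coevTensor (T : E →ₗ[k] E) :
    TensorProduct.map LinearMap.id T (coevTensor k E) =
      TensorProduct.map T.dualMap LinearMap.id (coevTensor k E) := by
  apply dualTensorHom_inj
  have h1 : ∀ x, dualTensorHom k E E (TensorProduct.map LinearMap.id T x) =
      T ∘ₗ dualTensorHom k E E x := by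
    intro x
    induction x with
    | zero => simp
    | tmul f e => ext; simp
    | add x y hx hy => simp only [map_add, hx, hy, LinearMap.comp_add]
  have h2 : ∀ x, dualTensorHom k E E (TensorProduct.map T.dualMap LinearMap.id x) =
      dualTensorHom k E E x ∘ₗ T := by
    intro x
    induction x with
    | zero => simp
    | tmul f e => ext; simp
    | add x y hx hy => simp only [map_add, hx, hy, LinearMap.add_comp]
  rw [h1, h2, dualTensorHom_coevTensor]
  rfl

variable {M N : Type*} [AddCommGroup M] [Module k M] [AddCommGroup N] [Module k N]

/-- This trade between the two legs of the canonical element is what later turns the twist of B₁*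
into an inverse twist of B₁. -/
theorem map_comp_coevTensor (p : Module.Dual k E →ₗ[k] M) (q : E →ₗ[k] N) (T : E →ₗ[k] E) :
    TensorProduct.map p (q ∘ₗ T) (coevTensor k E) =
      TensorProduct.map (p ∘ₗ T.dualMap) q (coevTensor k E) := by
  have h := congrArg (TensorProduct.map p q) (lTensor_coevTensor T)
  rw [← LinearMap.comp_apply, ← LinearMap.comp_apply, ← TensorProduct.map_comp,
    ← TensorProduct.map_comp] at h
  simpa using h

theorem map_dual_coevTensor (p : Module.Dual k E →ₗ[k] M) (l : Module.Dual k E) :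
    TensorProduct.rid k M (TensorProduct.map p l (coevTensor k E)) = p l := by
  rw [coevTensor_eq_sum (Module.finBasis k E)]
  simp only [map_sum, TensorProduct.map_tmul, TensorProduct.rid_tmul, ← map_smul]
  rw [← map_sum]
  congr 1
  ext x
  simp

theorem map_dual_coevTensor_left (l : Module.Dual k (Module.Dual k E)) (q : E →ₗ[k] N) (e : E)
    (hl : ∀ f, l f = f e) :
    TensorProduct.lid k N (TensorProduct.map l q (coevTensor k E)) = q e := by
  rw [coevTensor_eq_sum (Module.finBasis k E)]
  simp only [map_sum, TensorProduct.map_tmul, TensorProduct.lid_tmul, hl, ← map_smul]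
  rw [← map_sum]
  congr 1
  exact (Module.finBasis k E).sum_repr e

/-- Contracting the second leg with a functional l gives p(l ∘ q), and the functionals l ∘ q are
exactly those killing ker q. Conversely, if π projects onto ker q, then q = q(1 - π), and moving 1 -
π to the dual leg leaves p evaluated only on functionals that kill ker q. -/
theorem map_coevTensor_eq_zero_iff (p : Module.Dual k E →ₗ[k] M) (q : E →ₗ[k] N) :
    TensorProduct.map p q (coevTensor k E) = 0 ↔
      ∀ f : Module.Dual k E, (∀ x, q x = 0 → f x = 0) → p f = 0 := by
  constructor
  · intro h f hf
    obtain ⟨l, rfl⟩ := exists_factor q f hf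
    have := congrArg (TensorProduct.map LinearMap.id l) h
    rw [← LinearMap.comp_apply, ← TensorProduct.map_comp, map_zero, LinearMap.id_comp] at this
    rw [← map_dual_coevTensor p (l ∘ₗ q), this, map_zero]
  · intro h
    obtain ⟨π, h1, h2⟩ := exists_projection (LinearMap.ker q)
    have hq : q = q ∘ₗ (LinearMap.id - π) := by
      ext x
      simp [show q (π x) = 0 from h1 x]
    have hp : p ∘ₗ (LinearMap.id - π).dualMap = 0 := by
      ext f
      refine h _ fun x hx => ?_
      simp [h2 x hx]
    rw [hq, map_comp_coevTensor, hp, TensorProduct.map_zero_left, LinearMap.zero_apply]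

/-- Functionals on `E ⊗ E'` killing `P ⊗ E'` are spanned by the `f ⊗ f'` with `f` killing `P`. -/
theorem mem_span_dualDistrib_left {E' : Type*} [AddCommGroup E'] [Module k E']
    [FiniteDimensional k E'] (P : Submodule k E) (F : Module.Dual k (E ⊗[k] E'))
    (hF : ∀ x ∈ P, ∀ y, F (x ⊗ₜ y) = 0) :
    F ∈ Submodule.span k {G | ∃ (f : Module.Dual k E) (f' : Module.Dual k E'), (∀ x ∈ P, f x = 0) ∧
      G = TensorProduct.dualDistrib k E E' (f ⊗ₜ f')} := by
  obtain ⟨π, h1, h2⟩ := exists_projection P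
  -- F is unchanged when the P-component of the first argument is removed. Doing the same in an
  -- expansion of F into products makes every left factor kill P.
  have hF' : F = F ∘ₗ TensorProduct.map (LinearMap.id - π) LinearMap.id := by
    ext x y
    simp [TensorProduct.sub_tmul, hF _ (h1 x)]
  have : ∀ t, TensorProduct.dualDistrib k E E' t ∘ₗ TensorProduct.map (LinearMap.id - π) LinearMap.id ∈
      Submodule.span k {G | ∃ (f : Module.Dual k E) (f' : Module.Dual k E'), (∀ x ∈ P, f x = 0) ∧
      G = TensorProduct.dualDistrib k E E' (f ⊗ₜ f')} := by
    intro t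
    induction t with
    | zero => simp
    | tmul f f' =>
      refine Submodule.subset_span ⟨f ∘ₗ (LinearMap.id - π), f', fun x hx => by simp [h2 x hx], ?_⟩
      ext x y
      simp
    | add x y hx hy => rw [map_add, LinearMap.add_comp]; exact add_mem hx hy
  rw [hF']
  obtain ⟨t, rfl⟩ := (TensorProduct.dualDistribEquiv k E E').surjective F
  exact this t

theorem mem_span_dualDistrib_right {E' : Type*} [AddCommGroup E'] [Module k E']
    [FiniteDimensional k E'] (P : Submodule k E') (F : Module.Dual k (E ⊗[k] E'))
    (hF : ∀ x, ∀ y ∈ P, F (x ⊗ₜ y) = 0) :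
    F ∈ Submodule.span k {G | ∃ (f : Module.Dual k E) (f' : Module.Dual k E'), (∀ x ∈ P, f' x = 0) ∧
      G = TensorProduct.dualDistrib k E E' (f ⊗ₜ f')} := by
  obtain ⟨π, h1, h2⟩ := exists_projection P
  have hF' : F = F ∘ₗ TensorProduct.map LinearMap.id (LinearMap.id - π) := by
    ext x y
    simp [TensorProduct.tmul_sub, hF _ _ (h1 y)]
  have : ∀ t, TensorProduct.dualDistrib k E E' t ∘ₗ TensorProduct.map LinearMap.id (LinearMap.id - π) ∈
      Submodule.span k {G | ∃ (f : Module.Dual k E) (f' : Module.Dual k E'), (∀ x ∈ P, f' x = 0) ∧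
      G = TensorProduct.dualDistrib k E E' (f ⊗ₜ f')} := by
    intro t
    induction t with
    | zero => simp
    | tmul f f' =>
      refine Submodule.subset_span ⟨f, f' ∘ₗ (LinearMap.id - π), fun x hx => by simp [h2 x hx], ?_⟩
      ext x y
      simp
    | add x y hx hy => rw [map_add, LinearMap.add_comp]; exact add_mem hx hy
  rw [hF']
  obtain ⟨t, rfl⟩ := (TensorProduct.dualDistribEquiv k E E').surjective F
  exact this t

end Coev

/-! ### Tensor powers and the powers of a linear map into an algebra -/

section TensorPowers

variable {k : Type*} [Field k] {U V W : Type*} [AddCommMonoid U] [Module k U]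
  [AddCommMonoid V] [Module k V] [AddCommMonoid W] [Module k W] {R S : Type*} [Ring R] [Algebra k R] [Ring S]
  [Algebra k S]

theorem mulEquiv_tprod {r s : ℕ} (a : Fin r → V) (b : Fin s → V) :
    TensorPower.mulEquiv (PiTensorProduct.tprod k a ⊗ₜ[k] PiTensorProduct.tprod k b) =
      PiTensorProduct.tprod k (Fin.append a b) :=
  TensorPower.tprod_mul_tprod k a b

theorem mulEquiv_symm_tprod {r s : ℕ} (a : Fin r → V) (b : Fin s → V) :
    TensorPower.mulEquiv.symm (PiTensorProduct.tprod k (Fin.append a b)) =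
      PiTensorProduct.tprod k a ⊗ₜ[k] PiTensorProduct.tprod k b := by
  rw [← mulEquiv_tprod, LinearEquiv.symm_apply_apply]

theorem map_mulEquiv (f : U →ₗ[k] V) {r s : ℕ} (x : ⨂[k]^r U ⊗[k] ⨂[k]^s U) :
    PiTensorProduct.map (fun _ => f) (TensorPower.mulEquiv x) =
      TensorPower.mulEquiv (TensorProduct.map (PiTensorProduct.map fun _ => f)
        (PiTensorProduct.map fun _ => f) x) := by
  have : PiTensorProduct.map (fun _ => f) ∘ₗ (TensorPower.mulEquiv (n := r) (m := s)).toLinearMap =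
      (TensorPower.mulEquiv (R := k)).toLinearMap ∘ₗ TensorProduct.map (PiTensorProduct.map fun _ => f)
        (PiTensorProduct.map fun _ => f) := by
    ext a b
    simp only [LinearMap.compMultilinearMap_apply, TensorProduct.AlgebraTensorModule.curry_apply,
      LinearMap.restrictScalars_self, TensorProduct.curry_apply, LinearMap.comp_apply,
      LinearEquiv.coe_coe, TensorProduct.map_tmul, mulEquiv_tprod, PiTensorProduct.map_tprod]
    congr 1
    ext i
    refine Fin.addCases (fun i => ?_) (fun i => ?_) i <;> simp
  exact LinearMap.congr_fun this x

/-- The `n`-th power of a linear map `f : U → R` into an algebra: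
`u₁ ⋯ uₙ ↦ f(u₁) ⋯ f(uₙ)`. -/
noncomputable def powMap (f : U →ₗ[k] R) (n : ℕ) : ⨂[k]^n U →ₗ[k] R :=
  PiTensorProduct.lift ((MultilinearMap.mkPiAlgebraFin k n R).compLinearMap fun _ => f)

theorem powMap_tprod (f : U →ₗ[k] R) {n : ℕ} (a : Fin n → U) :
    powMap f n (PiTensorProduct.tprod k a) = (List.ofFn fun i => f (a i)).prod := by
  simp [powMap]

theorem powMap_comp (f : V →ₗ[k] R) (g : U →ₗ[k] V) (n : ℕ) :
    powMap (f ∘ₗ g) n = powMap f n ∘ₗ PiTensorProduct.map fun _ => g := by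
  ext a
  simp [powMap_tprod]

theorem algHom_powMap (φ : R →ₐ[k] S) (f : U →ₗ[k] R) (n : ℕ) (x : ⨂[k]^n U) :
    φ (powMap f n x) = powMap (φ.toLinearMap ∘ₗ f) n x := by
  have : φ.toLinearMap ∘ₗ powMap f n = powMap (φ.toLinearMap ∘ₗ f) n := by
    ext a
    simp [powMap_tprod, map_list_prod, List.map_ofFn, Function.comp_def]
  exact LinearMap.congr_fun this x

theorem powMap_mulEquiv (f : U →ₗ[k] R) {r s : ℕ} (x : ⨂[k]^r U ⊗[k] ⨂[k]^s U) :
    powMap f (r + s) (TensorPower.mulEquiv x) =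
      LinearMap.mul' k R (TensorProduct.map (powMap f r) (powMap f s) x) := by
  have : powMap f (r + s) ∘ₗ (TensorPower.mulEquiv (n := r) (m := s)).toLinearMap =
      LinearMap.mul' k R ∘ₗ TensorProduct.map (powMap f r) (powMap f s) := by
    ext a b
    simp only [LinearMap.compMultilinearMap_apply, TensorProduct.AlgebraTensorModule.curry_apply,
      LinearMap.restrictScalars_self, TensorProduct.curry_apply, LinearMap.comp_apply,
      LinearEquiv.coe_coe, TensorProduct.map_tmul, mulEquiv_tprod, powMap_tprod,
      LinearMap.mul'_apply]
    rw [← List.prod_append, ← List.ofFn_fin_append]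
    congr 2
    ext i
    refine Fin.addCases (fun i => ?_) (fun i => ?_) i <;> simp
  exact LinearMap.congr_fun this x

theorem powMap_mulEquiv_tmul (f : U →ₗ[k] R) {r s : ℕ} (x : ⨂[k]^r U) (y : ⨂[k]^s U) :
    powMap f (r + s) (TensorPower.mulEquiv (x ⊗ₜ y)) = powMap f r x * powMap f s y :=
  powMap_mulEquiv f (x ⊗ₜ y)

theorem powMap_mem_pow (f : U →ₗ[k] R) (n : ℕ) (x : ⨂[k]^n U) :
    powMap f n x ∈ LinearMap.range f ^ n := by
  induction x using PiTensorProduct.induction_on with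
  | smul_tprod r a =>
    rw [map_smul, powMap_tprod]
    refine Submodule.smul_mem _ _ ?_
    induction n with
    | zero =>
      rw [pow_zero, List.ofFn_zero, List.prod_nil]
      exact Submodule.one_le.1 le_rfl
    | succ n ih =>
      rw [List.ofFn_succ, List.prod_cons, pow_succ']
      exact Submodule.mul_mem_mul (LinearMap.mem_range_self f _) (ih fun i => a i.succ)
  | add x y hx hy => rw [map_add]; exact add_mem hx hy

/-- The one-letter tensor. -/
noncomputable def oneLetter (v : V) : ⨂[k]^1 V := PiTensorProduct.tprod k fun _ => v

theorem powMap_oneLetter (f : U →ₗ[k] R) (v : U) : powMap f 1 (oneLetter v) = f v := by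
  simp [oneLetter, powMap_tprod]

theorem exists_oneLetter (x : ⨂[k]^1 V) : ∃ v, x = oneLetter v := by
  refine ⟨PiTensorProduct.subsingletonEquiv (0 : Fin 1) x, ?_⟩
  exact ((LinearEquiv.symm_apply_apply _ x).symm.trans
    (PiTensorProduct.subsingletonEquiv_symm_apply' (0 : Fin 1) _))

theorem range_powMap (f : U →ₗ[k] R) (n : ℕ) :
    LinearMap.range (powMap f n) = LinearMap.range f ^ n := by
  apply le_antisymm
  · rintro _ ⟨x, rfl⟩
    exact powMap_mem_pow f n x
  · induction n with
    | zero =>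
      rw [pow_zero, Submodule.one_le]
      exact ⟨PiTensorProduct.tprod k Fin.elim0, by simp [powMap_tprod]⟩
    | succ n ih =>
      rw [pow_succ, Submodule.mul_le]
      rintro x hx _ ⟨v, rfl⟩
      obtain ⟨y, rfl⟩ := ih hx
      exact ⟨TensorPower.mulEquiv (y ⊗ₜ oneLetter v), by
        rw [powMap_mulEquiv_tmul, powMap_oneLetter]⟩

theorem powMap_zero (f : U →ₗ[k] R) (x : ⨂[k]^0 U) :
    powMap f 0 x = algebraMap k R (PiTensorProduct.isEmptyEquiv (Fin 0) x) := by
  induction x using PiTensorProduct.induction_on with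
  | smul_tprod r a => simp [powMap_tprod, Algebra.algebraMap_eq_smul_one]
  | add x y hx hy => rw [map_add, hx, hy, map_add, map_add]

theorem tensorPowerZip_mulEquiv {r s : ℕ} (x : ⨂[k]^r V) (y : ⨂[k]^s V) (x' : ⨂[k]^r W)
    (y' : ⨂[k]^s W) :
    tensorPowerZip (r + s) (TensorPower.mulEquiv (x ⊗ₜ[k] y) ⊗ₜ[k] TensorPower.mulEquiv (x' ⊗ₜ[k] y')) =
      TensorPower.mulEquiv (tensorPowerZip r (x ⊗ₜ x') ⊗ₜ tensorPowerZip s (y ⊗ₜ y')) := by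
  induction x using PiTensorProduct.induction_on with
  | add x₁ x₂ h₁ h₂ => simp only [TensorProduct.add_tmul, map_add, h₁, h₂]
  | smul_tprod c a =>
  simp only [← TensorProduct.smul_tmul', map_smul]
  congr 1
  induction y using PiTensorProduct.induction_on with
  | add x₁ x₂ h₁ h₂ => simp only [TensorProduct.add_tmul, TensorProduct.tmul_add, map_add, h₁, h₂]
  | smul_tprod c b =>
  simp only [← TensorProduct.smul_tmul', TensorProduct.tmul_smul, map_smul]
  congr 1
  induction x' using PiTensorProduct.induction_on with
  | add x₁ x₂ h₁ h₂ => simp only [TensorProduct.add_tmul, TensorProduct.tmul_add, map_add, h₁, h₂]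
  | smul_tprod c a' =>
  simp only [← TensorProduct.smul_tmul', TensorProduct.tmul_smul, map_smul]
  congr 1
  induction y' using PiTensorProduct.induction_on with
  | add x₁ x₂ h₁ h₂ => simp only [TensorProduct.tmul_add, map_add, h₁, h₂]
  | smul_tprod c b' =>
  simp only [TensorProduct.tmul_smul, map_smul]
  congr 1
  simp only [mulEquiv_tprod, tensorPowerZip_tprod]
  congr 1
  ext i
  refine Fin.addCases (fun i => ?_) (fun i => ?_) i <;> simp

theorem powMap_map_zip (f : V →ₗ[k] R) (g : W →ₗ[k] S) (n : ℕ) (x : ⨂[k]^n V ⊗[k] ⨂[k]^n W) :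
    powMap (TensorProduct.map f g) n (tensorPowerZip n x) =
      TensorProduct.map (powMap f n) (powMap g n) x := by
  have : powMap (TensorProduct.map f g) n ∘ₗ tensorPowerZip n =
      TensorProduct.map (powMap f n) (powMap g n) := by
    ext a b
    simp only [LinearMap.compMultilinearMap_apply, TensorProduct.AlgebraTensorModule.curry_apply,
      LinearMap.restrictScalars_self, TensorProduct.curry_apply, LinearMap.comp_apply,
      TensorProduct.map_tmul, tensorPowerZip_tprod, powMap_tprod]
    clear x
    induction n with
    | zero => simp; rfl
    | succ n ih =>
      simp only [List.ofFn_succ, List.prod_cons]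
      rw [ih, Algebra.TensorProduct.tmul_mul_tmul]
  exact LinearMap.congr_fun this x

theorem toTensorAlgebra_eq_powMap (n : ℕ) :
    TensorPower.toTensorAlgebra = powMap (TensorAlgebra.ι k : U →ₗ[k] _) n := by
  ext a
  simp [powMap_tprod, TensorAlgebra.tprod_apply]

/-- The tensor algebra is the direct sum of the tensor powers, and this map is the inclusion of the
n-th summand. -/
theorem powMap_ι_injective (n : ℕ) :
    Function.Injective (powMap (TensorAlgebra.ι k : U →ₗ[k] _) n) := by
  rw [← toTensorAlgebra_eq_powMap]
  have h : ∀ x : ⨂[k]^n U, TensorAlgebra.toDirectSum (TensorPower.toTensorAlgebra x) =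
      DirectSum.of (fun n => ⨂[k]^n U) n x := by
    intro x
    induction x using PiTensorProduct.induction_on with
    | smul_tprod r a =>
      rw [map_smul, map_smul, TensorPower.toTensorAlgebra_tprod,
        TensorAlgebra.toDirectSum_tensorPower_tprod]
      exact ((DirectSum.lof k ℕ (fun n => ⨂[k]^n U) n).map_smul r _).symm
    | add x y hx hy => simp only [map_add, hx, hy]
  intro x y hxy
  apply DirectSum.of_injective (β := fun n => ⨂[k]^n U) n
  rw [← h, ← h, hxy]

/-- The product of functionals on tensor powers. -/
noncomputable def dualMul {r s : ℕ} (f : Module.Dual k (⨂[k]^r W)) (g : Module.Dual k (⨂[k]^s W)) :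
    Module.Dual k (⨂[k]^(r + s) W) :=
  TensorProduct.dualDistrib k _ _ (f ⊗ₜ g) ∘ₗ TensorPower.mulEquiv.symm.toLinearMap

theorem dualMul_apply {r s : ℕ} (f : Module.Dual k (⨂[k]^r W)) (g : Module.Dual k (⨂[k]^s W))
    (x : ⨂[k]^r W) (y : ⨂[k]^s W) :
    dualMul f g (TensorPower.mulEquiv (x ⊗ₜ y)) = f x * g y := by
  simp [dualMul]

end TensorPowers

/-! ### Functionals on tensor powers and their pairing with tensors -/

section Dual

variable {k : Type*} [Field k] {V W : Type*} [AddCommGroup V] [Module k V] [AddCommGroup W]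
  [Module k W] [FiniteDimensional k W] {R S : Type*} [Ring R] [Algebra k R] [Ring S] [Algebra k S]

theorem dualPower_tprod {n : ℕ} (f : Fin n → Module.Dual k W) (w : Fin n → W) :
    Cochain2.dualPower n (PiTensorProduct.tprod k f) (PiTensorProduct.tprod k w) =
      ∏ i, f i (w i) :=
  PiTensorProduct.dualDistrib_apply f w

theorem dualPower_mulEquiv {r s : ℕ} (f : ⨂[k]^r (Module.Dual k W)) (g : ⨂[k]^s (Module.Dual k W)) :
    Cochain2.dualPower (r + s) (TensorPower.mulEquiv (f ⊗ₜ g)) =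
      dualMul (Cochain2.dualPower r f) (Cochain2.dualPower s g) := by
  induction f using PiTensorProduct.induction_on with
  | add x₁ x₂ h₁ h₂ => 
    simp only [dualMul] at h₁ h₂ ⊢
    simp only [TensorProduct.add_tmul, map_add, h₁, h₂, LinearMap.add_comp]
  | smul_tprod c a =>
  simp only [dualMul, ← TensorProduct.smul_tmul', map_smul, LinearMap.smul_comp]
  congr 1
  induction g using PiTensorProduct.induction_on with
  | add x₁ x₂ h₁ h₂ => simp only [TensorProduct.tmul_add, map_add, h₁, h₂, LinearMap.add_comp]
  | smul_tprod c b =>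
  simp only [TensorProduct.tmul_smul, map_smul, LinearMap.smul_comp]
  congr 1
  rw [mulEquiv_tprod]
  ext w
  obtain ⟨x, y, rfl⟩ : ∃ (x : Fin r → W) (y : Fin s → W), w = Fin.append x y :=
    ⟨_, _, (Fin.append_castAdd_natAdd (f := w)).symm⟩
  simp [dualPower_tprod, mulEquiv_symm_tprod, Fin.prod_univ_add]

theorem dualPower_symm_dualMul {r s : ℕ} (f : Module.Dual k (⨂[k]^r W))
    (g : Module.Dual k (⨂[k]^s W)) :
    (Cochain2.dualPower (r + s)).symm (dualMul f g) =
      TensorPower.mulEquiv ((Cochain2.dualPower r).symm f ⊗ₜ (Cochain2.dualPower s).symm g) := by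
  rw [LinearEquiv.symm_apply_eq, dualPower_mulEquiv, LinearEquiv.apply_symm_apply,
    LinearEquiv.apply_symm_apply]

/-- The power of `h : W* ⊗ V → R` as a bilinear map on `(W^{⊗n})* × V^{⊗n}`. -/
noncomputable def pairPow (h : Module.Dual k W ⊗[k] V →ₗ[k] R) (n : ℕ) :
    Module.Dual k (⨂[k]^n W) →ₗ[k] ⨂[k]^n V →ₗ[k] R :=
  TensorProduct.curry (powMap h n ∘ₗ tensorPowerZip n) ∘ₗ (Cochain2.dualPower n).symm.toLinearMap

theorem pairPow_apply (h : Module.Dual k W ⊗[k] V →ₗ[k] R) {n : ℕ} (f : Module.Dual k (⨂[k]^n W))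
    (x : ⨂[k]^n V) :
    pairPow h n f x = powMap h n (tensorPowerZip n ((Cochain2.dualPower n).symm f ⊗ₜ x)) := rfl

/-- Multiplicativity in functional and tensor jointly: it is the reason why vanishing on a pair of
subspaces propagates to the ideals they generate. -/
theorem pairPow_dualMul (h : Module.Dual k W ⊗[k] V →ₗ[k] R) {r s : ℕ}
    (f : Module.Dual k (⨂[k]^r W)) (g : Module.Dual k (⨂[k]^s W)) (x : ⨂[k]^r V) (y : ⨂[k]^s V) :
    pairPow h (r + s) (dualMul f g) (TensorPower.mulEquiv (x ⊗ₜ y)) =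
      pairPow h r f x * pairPow h s g y := by
  rw [pairPow_apply, dualPower_symm_dualMul, tensorPowerZip_mulEquiv, powMap_mulEquiv_tmul]
  rfl

theorem algHom_pairPow (φ : R →ₐ[k] S) (h : Module.Dual k W ⊗[k] V →ₗ[k] R) {n : ℕ}
    (f : Module.Dual k (⨂[k]^n W)) (x : ⨂[k]^n V) :
    φ (pairPow h n f x) = pairPow (φ.toLinearMap ∘ₗ h) n f x :=
  algHom_powMap φ h n _

theorem pairPow_tprod (h : Module.Dual k W ⊗[k] V →ₗ[k] R) {n : ℕ} (f : Fin n → Module.Dual k W)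
    (v : Fin n → V) :
    pairPow h n (Cochain2.dualPower n (PiTensorProduct.tprod k f)) (PiTensorProduct.tprod k v) =
      (List.ofFn fun i => h (f i ⊗ₜ v i)).prod := by
  rw [pairPow_apply, LinearEquiv.symm_apply_apply, tensorPowerZip_tprod, powMap_tprod]

/-- The basis dual to the words in a basis of W consists of the products of coordinate functionals.
Thus the canonical element of the n-th power is the n-th power of the canonical element. -/
theorem coevTensor_power {ι : Type*} [Fintype ι] [DecidableEq ι] (b : Module.Basis ι k W) (n : ℕ) :
    coevTensor k (⨂[k]^n W) = ∑ J : Fin n → ι,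
      Cochain2.dualPower n (PiTensorProduct.tprod k fun i => b.coord (J i)) ⊗ₜ
        PiTensorProduct.tprod k fun i => b (J i) := by
  rw [coevTensor_eq_sum (Basis.piTensorProduct fun _ : Fin n => b)]
  refine Finset.sum_congr rfl fun J _ => ?_
  congr 1
  · ext w
    simp [dualPower_tprod, Basis.piTensorProduct_repr_tprod_apply]
  · simp

end Dual

/-! ### Associativity and unit of concatenation, up to transport of the degree -/

section Casts

variable {k : Type*} [Field k] {V : Type*} [AddCommMonoid V] [Module k V]

theorem mulEquiv_assoc {r s t : ℕ} (x : ⨂[k]^r V) (y : ⨂[k]^s V) (z : ⨂[k]^t V) :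
    TensorPower.cast k V (add_assoc r s t)
        (TensorPower.mulEquiv (TensorPower.mulEquiv (x ⊗ₜ[k] y) ⊗ₜ[k] z)) =
      TensorPower.mulEquiv (x ⊗ₜ TensorPower.mulEquiv (y ⊗ₜ z)) :=
  TensorPower.mul_assoc x y z

theorem tensorPower_zero_eq_smul (x : ⨂[k]^0 V) :
    x = (PiTensorProduct.isEmptyEquiv (Fin 0) x) • PiTensorProduct.tprod k Fin.elim0 := by
  apply (PiTensorProduct.isEmptyEquiv (Fin 0)).injective
  simp

theorem one_mulEquiv {s : ℕ} (y : ⨂[k]^s V) :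
    TensorPower.mulEquiv ((PiTensorProduct.tprod k Fin.elim0 : ⨂[k]^0 V) ⊗ₜ[k] y) =
      TensorPower.cast k V (zero_add s).symm y := by
  have h := TensorPower.one_mul (R := k) y
  rw [← LinearEquiv.eq_symm_apply, TensorPower.cast_symm] at h
  exact h

theorem mulEquiv_one {s : ℕ} (y : ⨂[k]^s V) :
    TensorPower.mulEquiv (y ⊗ₜ[k] (PiTensorProduct.tprod k Fin.elim0 : ⨂[k]^0 V)) = y := by
  have h := TensorPower.mul_one (R := k) y
  exact (LinearMap.congr_fun (congrArg LinearEquiv.toLinearMap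
    (TensorPower.cast_refl k V (add_zero s))) _).symm.trans h

theorem Cochain1.apply_cast (θ : Cochain1 k V) {m n : ℕ} (h : m = n) (x : ⨂[k]^m V) :
    θ n (TensorPower.cast k V h x) = TensorPower.cast k V h (θ m x) := by
  subst h
  simp

end Casts

/-! ### Counital cocycles as coboundaries, and the operations on them -/

namespace Cochain2

variable {k : Type*} [Field k] {V : Type*} [AddCommMonoid V] [Module k V]

/-- The defining formula without inverses: θ is an isomorphism from concatenation to the product
twisted by ∂θ. In this form coboundaries are computed with and recognized throughout. -/
theorem coboundary_apply (θ : Cochain1 k V) {r s : ℕ} (x : ⨂[k]^r V) (y : ⨂[k]^s V) :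
    TensorPower.mulEquiv (coboundary θ r s (θ r x ⊗ₜ θ s y)) =
      θ (r + s) (TensorPower.mulEquiv (x ⊗ₜ y)) := by
  simp [coboundary]

theorem mulEquiv_coboundary (θ : Cochain1 k V) {r s : ℕ} (t : ⨂[k]^r V ⊗[k] ⨂[k]^s V) :
    TensorPower.mulEquiv (coboundary θ r s (TensorProduct.congr (θ r) (θ s) t)) =
      θ (r + s) (TensorPower.mulEquiv t) := by
  simp [coboundary]

theorem eq_coboundary {θ : Cochain1 k V} {ψ : Cochain2 k V}
    (h : ∀ r s (x : ⨂[k]^r V) (y : ⨂[k]^s V), TensorPower.mulEquiv (ψ r s (θ r x ⊗ₜ θ s y)) =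
      θ (r + s) (TensorPower.mulEquiv (x ⊗ₜ y))) : ψ = coboundary θ := by
  funext r s
  have : (TensorProduct.congr (θ r) (θ s) ≪≫ₗ ψ r s).toLinearMap =
      (TensorProduct.congr (θ r) (θ s) ≪≫ₗ coboundary θ r s).toLinearMap := by
    refine TensorProduct.ext' fun x y => TensorPower.mulEquiv.injective ?_
    change TensorPower.mulEquiv (ψ r s (θ r x ⊗ₜ θ s y)) =
      TensorPower.mulEquiv (coboundary θ r s (θ r x ⊗ₜ θ s y))
    rw [h, coboundary_apply]
  refine LinearEquiv.ext fun t => ?_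
  obtain ⟨t, rfl⟩ := (TensorProduct.congr (θ r) (θ s)).surjective t
  exact LinearMap.congr_fun this t

theorem assoc_mulEquiv_symm {r s t : ℕ} (u : ⨂[k]^(r + s + t) V) :
    TensorProduct.assoc k _ _ _ ((TensorProduct.congr (TensorPower.mulEquiv (n := r) (m := s))
        (LinearEquiv.refl k (⨂[k]^t V))).symm (TensorPower.mulEquiv.symm u)) =
      (TensorProduct.congr (LinearEquiv.refl k (⨂[k]^r V))
        (TensorPower.mulEquiv (n := s) (m := t))).symm
        (TensorPower.mulEquiv.symm (TensorPower.cast k V (add_assoc r s t) u)) := by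
  obtain ⟨w, rfl⟩ := (TensorProduct.congr (TensorPower.mulEquiv (R := k) (M := V) (n := r) (m := s))
        (LinearEquiv.refl k (⨂[k]^t V)) ≪≫ₗ TensorPower.mulEquiv).surjective u
  simp only [LinearEquiv.trans_apply, LinearEquiv.symm_apply_apply]
  rw [LinearEquiv.eq_symm_apply, LinearEquiv.eq_symm_apply]
  induction w with
  | zero => simp
  | add x y hx hy => simp only [map_add, hx, hy]
  | tmul w z =>
    induction w with
    | zero => simp
    | add x y hx hy => simp only [map_add, TensorProduct.add_tmul, hx, hy]
    | tmul x y =>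
      simp only [TensorProduct.assoc_tmul, TensorProduct.congr_tmul, LinearEquiv.refl_apply,
        mulEquiv_assoc]

/-- After concatenating everything into a single tensor power, the cocycle identity becomes
associativity of the twisted product; the cast accounts for r + s + t against r + (s + t). -/
theorem isCocycle_iff (ψ : Cochain2 k V) : ψ.IsCocycle ↔
    ∀ r s t (x : ⨂[k]^r V) (y : ⨂[k]^s V) (z : ⨂[k]^t V),
      TensorPower.cast k V (add_assoc r s t) (TensorPower.mulEquiv (ψ (r + s) t
        (TensorPower.mulEquiv (ψ r s (x ⊗ₜ y)) ⊗ₜ z))) =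
      TensorPower.mulEquiv (ψ r (s + t) (x ⊗ₜ TensorPower.mulEquiv (ψ s t (y ⊗ₜ z)))) := by
  have key : ∀ r s t (x : ⨂[k]^r V) (y : ⨂[k]^s V) (z : ⨂[k]^t V),
      (tensorRightId ψ r s t ≪≫ₗ mergeLeft ψ r s t ≪≫ₗ TensorProduct.assoc k _ _ _)
        ((x ⊗ₜ y) ⊗ₜ z) = (TensorProduct.assoc k _ _ _ ≪≫ₗ tensorLeftId ψ r s t ≪≫ₗ
          mergeRight ψ r s t) ((x ⊗ₜ y) ⊗ₜ z) ↔
      TensorPower.cast k V (add_assoc r s t) (TensorPower.mulEquiv (ψ (r + s) t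
        (TensorPower.mulEquiv (ψ r s (x ⊗ₜ y)) ⊗ₜ z))) =
      TensorPower.mulEquiv (ψ r (s + t) (x ⊗ₜ TensorPower.mulEquiv (ψ s t (y ⊗ₜ z)))) := by
    intro r s t x y z
    have h := assoc_mulEquiv_symm (TensorPower.mulEquiv (ψ (r + s) t
        (TensorPower.mulEquiv (ψ r s (x ⊗ₜ y)) ⊗ₜ z)))
    rw [LinearEquiv.symm_apply_apply] at h
    have h1 : (tensorRightId ψ r s t ≪≫ₗ mergeLeft ψ r s t ≪≫ₗ TensorProduct.assoc k _ _ _)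
        ((x ⊗ₜ y) ⊗ₜ z) = TensorProduct.assoc k _ _ _ ((TensorProduct.congr (TensorPower.mulEquiv (n := r) (m := s))
        (LinearEquiv.refl k (⨂[k]^t V))).symm (ψ (r + s) t
        (TensorPower.mulEquiv (ψ r s (x ⊗ₜ y)) ⊗ₜ z))) := rfl
    have h2 : (TensorProduct.assoc k _ _ _ ≪≫ₗ tensorLeftId ψ r s t ≪≫ₗ
          mergeRight ψ r s t) ((x ⊗ₜ y) ⊗ₜ z) = (TensorProduct.congr (LinearEquiv.refl k (⨂[k]^r V))
        (TensorPower.mulEquiv (n := s) (m := t))).symm (ψ r (s + t) (x ⊗ₜ TensorPower.mulEquiv (ψ s t (y ⊗ₜ z)))) := rfl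
    rw [h1, h2, h, EmbeddingLike.apply_eq_iff_eq, LinearEquiv.symm_apply_eq]
  constructor
  · intro h r s t x y z
    rw [← key, h]
  · intro h r s t
    refine LinearEquiv.toLinearMap_injective (TensorProduct.ext_threefold fun x y z => ?_)
    exact (key r s t x y z).2 (h r s t x y z)

/-- Transport of structure: the twisted product is the image of concatenation under θ, hence
associative, and its unit is still the empty word because θ₀ = id. -/
theorem coboundary_isZ2 (θ : Cochain1 k V) (h0 : θ 0 = LinearEquiv.refl k _) :
    (coboundary θ).IsZ2 := by
  refine ⟨⟨fun s => ?_, fun r => ?_⟩, ?_⟩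
  · refine LinearEquiv.toLinearMap_injective (TensorProduct.ext' fun x y => ?_)
    obtain ⟨y, rfl⟩ := (θ s).surjective y
    apply TensorPower.mulEquiv.injective
    have h : x = θ 0 x := by rw [h0]; rfl
    conv_lhs => rw [h]
    refine (coboundary_apply θ x y).trans ?_
    rw [tensorPower_zero_eq_smul x]
    simp only [← TensorProduct.smul_tmul', map_smul, one_mulEquiv, LinearEquiv.coe_coe,
      LinearEquiv.refl_apply, Cochain1.apply_cast]
  · refine LinearEquiv.toLinearMap_injective (TensorProduct.ext' fun y x => ?_)
    obtain ⟨y, rfl⟩ := (θ r).surjective y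
    apply TensorPower.mulEquiv.injective
    have h : x = θ 0 x := by rw [h0]; rfl
    conv_lhs => rw [h]
    refine (coboundary_apply θ y x).trans ?_
    rw [tensorPower_zero_eq_smul x]
    simp only [TensorProduct.tmul_smul, map_smul, mulEquiv_one, LinearEquiv.coe_coe,
      LinearEquiv.refl_apply]
    rfl
  · rw [isCocycle_iff]
    intro r s t x y z
    obtain ⟨x, rfl⟩ := (θ r).surjective x
    obtain ⟨y, rfl⟩ := (θ s).surjective y
    obtain ⟨z, rfl⟩ := (θ t).surjective z
    rw [coboundary_apply, coboundary_apply, coboundary_apply, coboundary_apply,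
      ← Cochain1.apply_cast, mulEquiv_assoc]

theorem primitive_succ (ψ : Cochain2 k V) (n : ℕ) (x : ⨂[k]^n V) (v : ⨂[k]^1 V) :
    primitive ψ (n + 1) (TensorPower.mulEquiv (x ⊗ₜ v)) =
      TensorPower.mulEquiv (ψ n 1 (primitive ψ n x ⊗ₜ v)) := by
  rw [primitive]
  simp

theorem primitive_zero (ψ : Cochain2 k V) : primitive ψ 0 = LinearEquiv.refl k _ := by
  rw [primitive]

/-- Induction on the second degree. The components ψ_{n,1} define the primitive, and the cocycle
identity at (r, s, 1) computes ψ_{r,s+1} from ψ_{r,s}, ψ_{s,1} and ψ_{r+s,1}. -/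
theorem eq_coboundary_primitive {ψ : Cochain2 k V} (hψ : ψ.IsZ2) :
    ψ = coboundary (primitive ψ) := by
  apply eq_coboundary
  intro r s x
  induction s with
  | zero =>
    intro y
    rw [hψ.1.2, primitive_zero, tensorPower_zero_eq_smul y]
    simp only [TensorProduct.tmul_smul, map_smul, LinearEquiv.refl_apply, mulEquiv_one]
    rfl
  | succ s ih =>
    intro y
    obtain ⟨y, rfl⟩ := TensorPower.mulEquiv.surjective y
    induction y with
    | zero => simp
    | add y₁ y₂ h₁ h₂ => simp only [map_add, TensorProduct.tmul_add, h₁, h₂]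
    | tmul y v =>
      rw [primitive_succ]
      have h := (isCocycle_iff ψ).1 hψ.2 r s 1 (primitive ψ r x) (primitive ψ s y) v
      rw [ih, ← primitive_succ] at h
      rw [← h, ← mulEquiv_assoc]
      exact (Cochain1.apply_cast (primitive ψ) (add_assoc r s 1) _).symm

theorem primitive_one {ψ : Cochain2 k V} (hψ : ψ.IsZ2) :
    primitive ψ 1 = LinearEquiv.refl k _ := by
  refine LinearEquiv.ext fun v => ?_
  have h := primitive_succ ψ 0 (PiTensorProduct.tprod k Fin.elim0) v
  rw [hψ.1.1, primitive_zero] at h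
  simp only [LinearEquiv.refl_apply, one_mulEquiv] at h
  have h' := (Cochain1.apply_cast (primitive ψ) (zero_add 1).symm v).symm.trans h
  exact (TensorPower.cast k V (zero_add 1).symm).injective h'

theorem coboundary_naturality {W : Type*} [AddCommMonoid W] [Module k W] (f : V →ₗ[k] W)
    (θ : Cochain1 k V) (η : Cochain1 k W)
    (h : ∀ n x, PiTensorProduct.map (fun _ => f) (θ n x) = η n (PiTensorProduct.map (fun _ => f) x))
    (r s : ℕ) (t : ⨂[k]^r V ⊗[k] ⨂[k]^s V) :
    coboundary η r s (TensorProduct.map (PiTensorProduct.map fun _ => f)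
        (PiTensorProduct.map fun _ => f) t) =
      TensorProduct.map (PiTensorProduct.map fun _ => f) (PiTensorProduct.map fun _ => f)
        (coboundary θ r s t) := by
  obtain ⟨t, rfl⟩ := (TensorProduct.congr (θ r) (θ s)).surjective t
  apply TensorPower.mulEquiv.injective
  rw [← map_mulEquiv, mulEquiv_coboundary, h, map_mulEquiv, ← mulEquiv_coboundary]
  congr 2
  induction t with
  | zero => simp
  | add x y hx hy => simp only [map_add, hx, hy]
  | tmul x y => simp [h]

theorem one_eq_coboundary :
    (one : Cochain2 k V) = coboundary fun _ => LinearEquiv.refl k _ :=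
  eq_coboundary fun _ _ _ _ => rfl

variable {W : Type*} [AddCommMonoid W] [Module k W]

/-- The tensor product of two 1-cochains. -/
noncomputable def _root_.Cochain1.prod (θ : Cochain1 k V) (η : Cochain1 k W) :
    Cochain1 k (V ⊗[k] W) := fun n =>
  (tensorPowerShuffle n).symm ≪≫ₗ TensorProduct.congr (θ n) (η n) ≪≫ₗ tensorPowerShuffle n

theorem _root_.Cochain1.prod_shuffle (θ : Cochain1 k V) (η : Cochain1 k W) (n : ℕ)
    (t : ⨂[k]^n V ⊗[k] ⨂[k]^n W) :
    Cochain1.prod θ η n (tensorPowerZip n t) =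
      tensorPowerZip n (TensorProduct.map (θ n).toLinearMap (η n).toLinearMap t) := by
  have : tensorPowerZip n t = tensorPowerShuffle n t := rfl
  rw [this, Cochain1.prod, LinearEquiv.trans_apply, LinearEquiv.trans_apply, LinearEquiv.symm_apply_apply]
  rfl

theorem mulEquiv_shuffle {r s : ℕ} (t : ⨂[k]^r V ⊗[k] ⨂[k]^s V) (t' : ⨂[k]^r W ⊗[k] ⨂[k]^s W) :
    TensorPower.mulEquiv (TensorProduct.map (tensorPowerZip r) (tensorPowerZip s)
        (TensorProduct.tensorTensorTensorComm k _ _ _ _ (t ⊗ₜ t'))) =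
      tensorPowerZip (r + s) (TensorPower.mulEquiv t ⊗ₜ TensorPower.mulEquiv t') := by
  induction t with
  | zero => simp
  | add x y hx hy => simp only [map_add, TensorProduct.add_tmul, hx, hy]
  | tmul x y =>
    induction t' with
    | zero => simp
    | add x y hx hy => simp only [map_add, TensorProduct.tmul_add, hx, hy]
    | tmul x' y' =>
      rw [TensorProduct.tensorTensorTensorComm_tmul, TensorProduct.map_tmul,
        tensorPowerZip_mulEquiv]

theorem prod_shuffle (ψ : Cochain2 k V) (χ : Cochain2 k W) {r s : ℕ}
    (t : ⨂[k]^r V ⊗[k] ⨂[k]^s V) (t' : ⨂[k]^r W ⊗[k] ⨂[k]^s W) :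
    ψ.prod χ r s (TensorProduct.map (tensorPowerZip r) (tensorPowerZip s)
        (TensorProduct.tensorTensorTensorComm k _ _ _ _ (t ⊗ₜ t'))) =
      TensorProduct.map (tensorPowerZip r) (tensorPowerZip s)
        (TensorProduct.tensorTensorTensorComm k _ _ _ _ (ψ r s t ⊗ₜ χ r s t')) := by
  let sh := TensorProduct.tensorTensorTensorComm k (⨂[k]^r V) (⨂[k]^s V) (⨂[k]^r W) (⨂[k]^s W) ≪≫ₗ
    TensorProduct.congr (tensorPowerShuffle r) (tensorPowerShuffle s)
  change sh (TensorProduct.congr (ψ r s) (χ r s) (sh.symm (sh (t ⊗ₜ t')))) =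
    sh (ψ r s t ⊗ₜ χ r s t')
  rw [LinearEquiv.symm_apply_apply]
  rfl

/-- Together with `coboundary_dual` this makes the composite cocycle ω an explicit coboundary, so
that questions about ω reduce to its primitive. -/
theorem coboundary_prod (θ : Cochain1 k V) (η : Cochain1 k W) :
    (coboundary θ).prod (coboundary η) = coboundary (Cochain1.prod θ η) := by
  apply eq_coboundary
  intro r s x y
  obtain ⟨x, rfl⟩ := (tensorPowerShuffle r).surjective x
  obtain ⟨y, rfl⟩ := (tensorPowerShuffle s).surjective y
  change TensorPower.mulEquiv ((coboundary θ).prod (coboundary η) r s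
    (Cochain1.prod θ η r (tensorPowerZip r x) ⊗ₜ Cochain1.prod θ η s (tensorPowerZip s y))) =
    Cochain1.prod θ η (r + s) (TensorPower.mulEquiv (tensorPowerZip r x ⊗ₜ tensorPowerZip s y))
  induction x with
  | zero => simp
  | add x y hx hy => simp only [map_add, TensorProduct.add_tmul, hx, hy]
  | tmul x x' =>
    induction y with
    | zero => simp
    | add x y hx hy => simp only [map_add, TensorProduct.tmul_add, hx, hy]
    | tmul y y' =>
      rw [Cochain1.prod_shuffle, Cochain1.prod_shuffle, ← tensorPowerZip_mulEquiv,
        Cochain1.prod_shuffle]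
      have h := prod_shuffle (coboundary θ) (coboundary η) (θ r x ⊗ₜ θ s y) (η r x' ⊗ₜ η s y')
      rw [TensorProduct.tensorTensorTensorComm_tmul, TensorProduct.map_tmul] at h
      simp only [TensorProduct.map_tmul, LinearEquiv.coe_coe]
      rw [h, mulEquiv_shuffle, coboundary_apply, coboundary_apply]

section Dual

variable {U : Type*} [AddCommGroup U] [Module k U] [Module.Finite k U]

/-- The contragredient of a 1-cochain. -/
noncomputable def _root_.Cochain1.dual (θ : Cochain1 k U) : Cochain1 k (Module.Dual k U) := fun n =>
  dualPower n ≪≫ₗ (θ n).symm.dualMap ≪≫ₗ (dualPower n).symm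

theorem dualPower_dual (θ : Cochain1 k U) {n : ℕ} (f : ⨂[k]^n (Module.Dual k U)) (x : ⨂[k]^n U) :
    dualPower n (Cochain1.dual θ n f) x = dualPower n f ((θ n).symm x) := by
  simp [Cochain1.dual]

theorem dualPairing_apply {r s : ℕ} (F : ⨂[k]^r (Module.Dual k U) ⊗[k] ⨂[k]^s (Module.Dual k U))
    (t : ⨂[k]^r U ⊗[k] ⨂[k]^s U) :
    dualPairing r s F t = dualPower (r + s) (TensorPower.mulEquiv F) (TensorPower.mulEquiv t) := by
  induction F with
  | zero => simp
  | add x y hx hy => simp only [map_add, LinearMap.add_apply, hx, hy]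
  | tmul f g =>
    rw [dualPower_mulEquiv]
    simp [dualMul, dualPairing, TensorProduct.dualDistribEquiv]
    rfl

theorem dualPairing_dual (ψ : Cochain2 k U) {r s : ℕ}
    (F : ⨂[k]^r (Module.Dual k U) ⊗[k] ⨂[k]^s (Module.Dual k U)) (t : ⨂[k]^r U ⊗[k] ⨂[k]^s U) :
    dualPairing r s (ψ.dual r s F) t = dualPairing r s F ((ψ r s).symm t) := by
  simp [dual]

/-- Both duals are contragredients. Evaluating on ∂θ(θ_r x ⊗ θ_s y) = θ_{r+s}(xy) cancels the
inverses on either side and leaves the multiplicativity of `dualPower`. -/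
theorem coboundary_dual (θ : Cochain1 k U) :
    (coboundary θ).dual = coboundary (Cochain1.dual θ) := by
  apply eq_coboundary
  intro r s f g
  rw [← LinearEquiv.eq_symm_apply]
  apply (dualPairing r s).injective
  refine LinearMap.ext fun t => ?_
  obtain ⟨t, rfl⟩ := (coboundary θ r s).surjective t
  obtain ⟨t, rfl⟩ := (TensorProduct.congr (θ r) (θ s)).surjective t
  rw [dualPairing_dual, LinearEquiv.symm_apply_apply, dualPairing_apply, dualPairing_apply,
    LinearEquiv.apply_symm_apply, mulEquiv_coboundary, dualPower_dual, LinearEquiv.symm_apply_apply,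
    dualPower_mulEquiv, dualPower_mulEquiv]
  induction t with
  | zero => simp
  | add x y hx hy => simp only [map_add, hx, hy]
  | tmul x y =>
    rw [TensorProduct.congr_tmul, dualMul_apply, dualMul_apply, dualPower_dual, dualPower_dual,
      LinearEquiv.symm_apply_apply, LinearEquiv.symm_apply_apply]

end Dual

end Cochain2

/-! ### From admissibility of the inverse twist to stability of the twisted relations -/

namespace Cochain2

variable {k : Type*} [Field k] {V : Type*} [AddCommMonoid V] [Module k V]

open ConicQS (concat)

theorem mem_concat {m n : ℕ} {P : Submodule k (⨂[k]^m V)} {Q : Submodule k (⨂[k]^n V)}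
    {x : ⨂[k]^m V} {y : ⨂[k]^n V} (hx : x ∈ P) (hy : y ∈ Q) :
    TensorPower.mulEquiv (x ⊗ₜ[k] y) ∈ concat P Q :=
  Submodule.mem_map_of_mem (Submodule.apply_mem_map₂ (TensorProduct.mk k _ _) hx hy)

theorem concat_le {m n : ℕ} {P : Submodule k (⨂[k]^m V)} {Q : Submodule k (⨂[k]^n V)}
    {S : Submodule k (⨂[k]^(m + n) V)}
    (h : ∀ x ∈ P, ∀ y ∈ Q, TensorPower.mulEquiv (x ⊗ₜ[k] y) ∈ S) : concat P Q ≤ S := by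
  rw [concat, Submodule.map_le_iff_le_comap, Submodule.map₂_le]
  exact h

theorem concat_top_zero {m : ℕ} (P : Submodule k (⨂[k]^m V)) :
    concat P (⊤ : Submodule k (⨂[k]^0 V)) = P := by
  apply le_antisymm
  · refine concat_le fun x hx y _ => ?_
    rw [tensorPower_zero_eq_smul y, TensorProduct.tmul_smul, map_smul, mulEquiv_one]
    exact P.smul_mem _ hx
  · intro x hx
    rw [← mulEquiv_one x]
    exact mem_concat hx trivial

theorem concat_zero_top {n : ℕ} (P : Submodule k (⨂[k]^n V)) :
    concat (⊤ : Submodule k (⨂[k]^0 V)) P =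
      P.map (TensorPower.cast k V (zero_add n).symm).toLinearMap := by
  apply le_antisymm
  · refine concat_le fun x _ y hy => ?_
    rw [tensorPower_zero_eq_smul x, ← TensorProduct.smul_tmul', map_smul, one_mulEquiv]
    exact Submodule.smul_mem _ _ (Submodule.mem_map_of_mem hy)
  · rintro _ ⟨x, hx, rfl⟩
    rw [LinearEquiv.coe_coe, ← one_mulEquiv]
    exact mem_concat trivial hx

/-- `θ` is compatible with multiplying `P` by the tensor powers of `V` on either side. -/
def Spreads (θ : Cochain1 k V) {m : ℕ} (P : Submodule k (⨂[k]^m V)) : Prop :=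
  ∀ n, (concat P (⊤ : Submodule k (⨂[k]^n V))).map (θ (m + n)).toLinearMap =
      concat (P.map (θ m).toLinearMap) ⊤ ∧
    (concat (⊤ : Submodule k (⨂[k]^n V)) P).map (θ (n + m)).toLinearMap =
      concat ⊤ (P.map (θ m).toLinearMap)

theorem spreads_map_cast {θ : Cochain1 k V} {m n : ℕ} (h : m = n) {P : Submodule k (⨂[k]^m V)} :
    Spreads θ (P.map (TensorPower.cast k V h).toLinearMap) ↔ Spreads θ P := by
  subst h
  rw [TensorPower.cast_refl]
  exact iff_of_eq (congrArg (Spreads θ) (Submodule.map_id P))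

theorem map_congr_map₂ {m n : ℕ} (e : ⨂[k]^m V ≃ₗ[k] ⨂[k]^m V) (e' : ⨂[k]^n V ≃ₗ[k] ⨂[k]^n V)
    (P : Submodule k (⨂[k]^m V)) (Q : Submodule k (⨂[k]^n V)) :
    (Submodule.map₂ (TensorProduct.mk k _ _) P Q).map (TensorProduct.congr e e').toLinearMap =
      Submodule.map₂ (TensorProduct.mk k _ _) (P.map e.toLinearMap) (Q.map e'.toLinearMap) := by
  rw [Submodule.map_map₂, Submodule.map₂_map_map]
  rfl

theorem map_top_equiv {M N : Type*} [AddCommMonoid M] [Module k M] [AddCommMonoid N] [Module k N]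
    (e : M ≃ₗ[k] N) : (⊤ : Submodule k M).map e.toLinearMap = ⊤ := by
  rw [Submodule.map_top]
  exact LinearEquiv.range e

/-- With m concatenation, the inverse twist is m⁻¹ θ⁻¹ m (θ ⊗ θ). So it fixes P ⊗ Q precisely when
θ(PQ) = θ(P)θ(Q), although θ is not multiplicative in general. -/
theorem map_inv_iff (θ : Cochain1 k V) {r s : ℕ} (P : Submodule k (⨂[k]^r V))
    (Q : Submodule k (⨂[k]^s V)) :
    (Submodule.map₂ (TensorProduct.mk k _ _) P Q).map
        (coboundary (fun n => (θ n).symm) r s).toLinearMap =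
          Submodule.map₂ (TensorProduct.mk k _ _) P Q ↔
      (concat P Q).map (θ (r + s)).toLinearMap =
        concat (P.map (θ r).toLinearMap) (Q.map (θ s).toLinearMap) := by
  have h1 : (concat P Q).map (θ (r + s)).toLinearMap =
      (((Submodule.map₂ (TensorProduct.mk k _ _) P Q).map
        (TensorPower.mulEquiv (R := k)).toLinearMap).map (θ (r + s)).toLinearMap) := rfl
  have h2 : (coboundary (fun n => (θ n).symm) r s).toLinearMap =
    (TensorPower.mulEquiv.symm.toLinearMap ∘ₗ (θ (r + s)).symm.toLinearMap ∘ₗ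
      (TensorPower.mulEquiv (R := k)).toLinearMap) ∘ₗ
        (TensorProduct.congr (θ r) (θ s)).toLinearMap := rfl
  rw [h1, h2, Submodule.map_comp, map_congr_map₂, concat, Submodule.map_comp, Submodule.map_comp]
  set Q' := (Submodule.map₂ (TensorProduct.mk k _ _) (P.map (θ r).toLinearMap) (Q.map (θ s).toLinearMap)).map
    (TensorPower.mulEquiv (R := k)).toLinearMap with hQ
  set Q'' := Submodule.map₂ (TensorProduct.mk k _ _) P Q
  have h3 : ∀ {M N : Type _} [AddCommMonoid M] [Module k M] [AddCommMonoid N] [Module k N]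
    (e : M ≃ₗ[k] N) (S : Submodule k N) (S' : Submodule k M), S.map e.symm.toLinearMap = S' ↔
      S = S'.map e.toLinearMap := by
    intro M N _ _ _ _ e S S'
    constructor
    · rintro rfl
      rw [← Submodule.map_comp]; simp
    · rintro rfl
      rw [← Submodule.map_comp]; simp
  rw [h3, h3]
  exact eq_comm

theorem spreads_of_inv (θ : Cochain1 k V) {m : ℕ} {P : Submodule k (⨂[k]^m V)}
    (h : ∀ n, (Submodule.map₂ (TensorProduct.mk k _ (⨂[k]^n V)) P ⊤).map
        (coboundary (fun n => (θ n).symm) m n).toLinearMap =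
          Submodule.map₂ (TensorProduct.mk k _ _) P ⊤ ∧
      (Submodule.map₂ (TensorProduct.mk k (⨂[k]^n V) _) ⊤ P).map
        (coboundary (fun n => (θ n).symm) n m).toLinearMap =
          Submodule.map₂ (TensorProduct.mk k _ _) ⊤ P) : Spreads θ P := by
  intro n
  refine ⟨?_, ?_⟩
  · rw [(map_inv_iff θ P ⊤).1 (h n).1, map_top_equiv]
  · rw [(map_inv_iff θ ⊤ P).1 (h n).2, map_top_equiv]

/-- Since ∂θ (θ ⊗ θ) = m⁻¹ θ m, multiplicativity of θ on P and Q is stability of θ(P) ⊗ θ(Q) under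
∂θ. Combined with `map_inv_iff`, it exchanges stability of the relations under 𝔦ψ for stability of
the twisted relations under ψ. -/
theorem coboundary_map_eq {θ : Cochain1 k V} {r s : ℕ} {P : Submodule k (⨂[k]^r V)}
    {Q : Submodule k (⨂[k]^s V)} (h : (concat P Q).map (θ (r + s)).toLinearMap =
        concat (P.map (θ r).toLinearMap) (Q.map (θ s).toLinearMap)) :
    (Submodule.map₂ (TensorProduct.mk k _ _) (P.map (θ r).toLinearMap)
      (Q.map (θ s).toLinearMap)).map (coboundary θ r s).toLinearMap =
      Submodule.map₂ (TensorProduct.mk k _ _) (P.map (θ r).toLinearMap) (Q.map (θ s).toLinearMap) := by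
  rw [← map_congr_map₂]
  have h2 : (coboundary θ r s).toLinearMap ∘ₗ (TensorProduct.congr (θ r) (θ s)).toLinearMap =
      TensorPower.mulEquiv.symm.toLinearMap ∘ₗ (θ (r + s)).toLinearMap ∘ₗ
        (TensorPower.mulEquiv (R := k)).toLinearMap := by
    ext t
    simp [coboundary]
  rw [← Submodule.map_comp, h2, Submodule.map_comp, Submodule.map_comp]
  change ((concat P Q).map (θ (r + s)).toLinearMap).map _ = _
  rw [h, map_congr_map₂, concat, ← Submodule.map_comp]
  simp

end Cochain2

namespace ConicQS

variable {k : Type u} [Field k]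

/-- The relations of degree `n` of the inverse twist of `A`. -/
noncomputable def twistedRel (A : ConicQS k) (ψ : Cochain2 k A.gen) (n : ℕ) :
    Submodule k (⨂[k]^n A.gen) :=
  (A.rel n).map (ψ.primitive n).toLinearMap

/-- The subspaces `A₁^{⊗a} ⊗ θ(I_b) ⊗ A₁^{⊗c}`. -/
noncomputable def twistedIdeal (A : ConicQS k) (ψ : Cochain2 k A.gen) (a b c : ℕ) :
    Submodule k (⨂[k]^(a + b + c) A.gen) :=
  concat (concat ⊤ (A.twistedRel ψ b)) ⊤

/-- Admissibility lets θ be pulled past a full tensor power on one side of a subspace. Doing this on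
the right of A₁^{⊗a} ⊗ I_b and then on the left of I_b gives the claim. -/
theorem twistedIdeal_eq {A : ConicQS k} {ψ : Cochain2 k A.gen} (h : A.SecondAdmissible ψ.inv)
    (a b c : ℕ) : A.twistedIdeal ψ a b c =
      (concat (concat ⊤ (A.rel b)) ⊤ : Submodule k (⨂[k]^(a + b + c) A.gen)).map
        (ψ.primitive (a + b + c)).toLinearMap := by
  have h0 : ∀ a b c : ℕ, Cochain2.Spreads ψ.primitive
      (concat (concat ⊤ (A.rel b)) ⊤ : Submodule k (⨂[k]^(a + b + c) A.gen)) :=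
    fun a b c => Cochain2.spreads_of_inv _ fun n => h a b c n
  -- For a = c = 0 the outer factors are the scalars; only the transport along 0 + b = b remains.
  have h1 : Cochain2.Spreads ψ.primitive (A.rel b) := by
    have := h0 0 b 0
    rw [Cochain2.concat_top_zero, Cochain2.concat_zero_top] at this
    exact (Cochain2.spreads_map_cast _).1 this
  have h2 : Cochain2.Spreads ψ.primitive (concat ⊤ (A.rel b) : Submodule k (⨂[k]^(a + b) A.gen)) := by
    have := h0 a b 0
    rwa [Cochain2.concat_top_zero] at this
  rw [(h2 c).1, (h1 a).2]
  rfl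

theorem twistedIdeal_stable {A : ConicQS k} {ψ : Cochain2 k A.gen} (hψ : ψ.IsZ2)
    (h : A.SecondAdmissible ψ.inv) (a b c n : ℕ) :
    (Submodule.map₂ (TensorProduct.mk k _ (⨂[k]^n A.gen)) (A.twistedIdeal ψ a b c) ⊤).map
        (ψ (a + b + c) n).toLinearMap =
          Submodule.map₂ (TensorProduct.mk k _ _) (A.twistedIdeal ψ a b c) ⊤ ∧
    (Submodule.map₂ (TensorProduct.mk k (⨂[k]^n A.gen) _) ⊤ (A.twistedIdeal ψ a b c)).map
        (ψ n (a + b + c)).toLinearMap =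
          Submodule.map₂ (TensorProduct.mk k _ _) ⊤ (A.twistedIdeal ψ a b c) := by
  rw [twistedIdeal_eq h]
  have h0 := Cochain2.spreads_of_inv ψ.primitive fun n => h a b c n
  have h1 := Cochain2.coboundary_map_eq (θ := ψ.primitive)
    (P := concat (concat ⊤ (A.rel b)) ⊤) (Q := (⊤ : Submodule k (⨂[k]^n A.gen)))
    ((h0 n).1.trans (by rw [Cochain2.map_top_equiv]))
  have h2 := Cochain2.coboundary_map_eq (θ := ψ.primitive)
    (Q := concat (concat ⊤ (A.rel b)) ⊤) (P := (⊤ : Submodule k (⨂[k]^n A.gen)))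
    ((h0 n).2.trans (by rw [Cochain2.map_top_equiv]))
  rw [Cochain2.map_top_equiv, ← Cochain2.eq_coboundary_primitive hψ] at h1 h2
  exact ⟨h1, h2⟩

end ConicQS

section Symm

/-- In finite dimension a bijection mapping a subspace into itself maps it onto itself, so its
inverse preserves it as well. This upgrades an induced endomorphism Ψ to an automorphism. -/
theorem ker_symm_of_ker {k E F : Type*} [Field k] [AddCommMonoid E] [Module k E]
    [Module.Finite k E] [AddCommGroup F] [Module k F] (χ : E ≃ₗ[k] E) (p : E →ₗ[k] F)
    (h : ∀ x, p x = 0 → p (χ x) = 0) (x : E) (hx : p x = 0) : p (χ.symm x) = 0 := by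
  let := Module.addCommMonoidToAddCommGroup k (M := E)
  have hle : (LinearMap.ker p).map χ.toLinearMap ≤ LinearMap.ker p := by
    rintro _ ⟨y, hy, rfl⟩
    exact h y hy
  have heq := Submodule.eq_of_le_of_finrank_eq hle
    (LinearEquiv.finrank_map_eq χ (LinearMap.ker p))
  have hx' : x ∈ (LinearMap.ker p).map χ.toLinearMap := by rw [heq]; exact hx
  obtain ⟨y, hy, rfl⟩ := hx'
  simpa using hy

end Symm

/-! ### Coefficient maps whose powers vanish on Q^⊥ ⊗ P -/

section Pairing

variable {k : Type*} [Field k] {V W : Type*} [AddCommGroup V] [Module k V] [AddCommGroup W]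
  [Module k W] [FiniteDimensional k W] {R : Type*} [Ring R] [Algebra k R]

open ConicQS (concat)

theorem concat_induction {M : Type*} [AddCommGroup M] [Module k M] {m n : ℕ}
    {P : Submodule k (⨂[k]^m V)} {Q : Submodule k (⨂[k]^n V)} (q : ⨂[k]^(m + n) V →ₗ[k] M)
    (h : ∀ x ∈ P, ∀ y ∈ Q, q (TensorPower.mulEquiv (x ⊗ₜ[k] y)) = 0) {x : ⨂[k]^(m + n) V}
    (hx : x ∈ concat P Q) : q x = 0 :=
  Cochain2.concat_le (S := LinearMap.ker q) h hx

theorem mem_span_dualMul_left {r s : ℕ} (P : Submodule k (⨂[k]^r W))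
    (F : Module.Dual k (⨂[k]^(r + s) W)) (hF : ∀ x ∈ concat P ⊤, F x = 0) :
    F ∈ Submodule.span k {G | ∃ (f : Module.Dual k (⨂[k]^r W)) (g : Module.Dual k (⨂[k]^s W)),
      (∀ x ∈ P, f x = 0) ∧ G = dualMul f g} := by
  have h := mem_span_dualDistrib_left P (F ∘ₗ (TensorPower.mulEquiv (n := r) (m := s)).toLinearMap)
    fun x hx y => hF _ (Cochain2.mem_concat hx trivial)
  have h2 := Submodule.mem_map_of_mem
    (f := (TensorPower.mulEquiv (R := k) (M := W) (n := r) (m := s)).symm.toLinearMap.dualMap) h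
  have h3 : (TensorPower.mulEquiv (R := k) (M := W) (n := r) (m := s)).symm.toLinearMap.dualMap
      (F ∘ₗ (TensorPower.mulEquiv (n := r) (m := s)).toLinearMap) = F := by
    ext x
    simp
  rw [h3, Submodule.map_span] at h2
  refine Submodule.span_mono ?_ h2
  rintro _ ⟨_, ⟨f, g, hf, rfl⟩, rfl⟩
  exact ⟨f, g, hf, rfl⟩

theorem mem_span_dualMul_right {r s : ℕ} (P : Submodule k (⨂[k]^s W))
    (F : Module.Dual k (⨂[k]^(r + s) W)) (hF : ∀ x ∈ concat ⊤ P, F x = 0) :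
    F ∈ Submodule.span k {G | ∃ (f : Module.Dual k (⨂[k]^r W)) (g : Module.Dual k (⨂[k]^s W)),
      (∀ x ∈ P, g x = 0) ∧ G = dualMul f g} := by
  have h := mem_span_dualDistrib_right P (F ∘ₗ (TensorPower.mulEquiv (n := r) (m := s)).toLinearMap)
    fun x y hy => hF _ (Cochain2.mem_concat trivial hy)
  have h2 := Submodule.mem_map_of_mem
    (f := (TensorPower.mulEquiv (R := k) (M := W) (n := r) (m := s)).symm.toLinearMap.dualMap) h
  have h3 : (TensorPower.mulEquiv (R := k) (M := W) (n := r) (m := s)).symm.toLinearMap.dualMap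
      (F ∘ₗ (TensorPower.mulEquiv (n := r) (m := s)).toLinearMap) = F := by
    ext x
    simp
  rw [h3, Submodule.map_span] at h2
  refine Submodule.span_mono ?_ h2
  rintro _ ⟨_, ⟨f, g, hf, rfl⟩, rfl⟩
  exact ⟨f, g, hf, rfl⟩

/-- The `n`-th power of `h` vanishes on `Q^⊥ ⊗ P`. -/
def PairKills (h : Module.Dual k W ⊗[k] V →ₗ[k] R) {n : ℕ} (P : Submodule k (⨂[k]^n V))
    (Q : Submodule k (⨂[k]^n W)) : Prop :=
  ∀ f : Module.Dual k (⨂[k]^n W), (∀ y ∈ Q, f y = 0) → ∀ x ∈ P, pairPow h n f x = 0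

/-- The annihilator of Q ⊗ W^{⊗n} is Q^⊥ ⊗ (W^{⊗n})*, and on such products of functionals the power
of h factors, with a vanishing first factor. -/
theorem PairKills.concat_right {h : Module.Dual k W ⊗[k] V →ₗ[k] R} {m : ℕ}
    {P : Submodule k (⨂[k]^m V)} {Q : Submodule k (⨂[k]^m W)} (hk : PairKills h P Q) (n : ℕ) :
    PairKills h (n := m + n) (concat P ⊤) (concat Q ⊤) := by
  intro F hF x hx
  refine concat_induction (pairPow h (m + n) F) (fun x hx y _ => ?_) hx
  have := mem_span_dualMul_left Q F hF
  refine Submodule.span_induction (p := fun F _ => pairPow h (m + n) F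
    (TensorPower.mulEquiv (x ⊗ₜ y)) = 0) ?_ (by simp) ?_ ?_ this
  · rintro _ ⟨f, g, hf, rfl⟩
    rw [pairPow_dualMul, hk f hf x hx, zero_mul]
  · intro F G _ _ hF hG
    rw [map_add, LinearMap.add_apply, hF, hG, add_zero]
  · intro c F _ hF
    rw [map_smul, LinearMap.smul_apply, hF, smul_zero]

theorem PairKills.concat_left {h : Module.Dual k W ⊗[k] V →ₗ[k] R} {m : ℕ}
    {P : Submodule k (⨂[k]^m V)} {Q : Submodule k (⨂[k]^m W)} (hk : PairKills h P Q) (n : ℕ) :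
    PairKills h (n := n + m) (concat ⊤ P) (concat ⊤ Q) := by
  intro F hF x hx
  refine concat_induction (pairPow h (n + m) F) (fun y _ x hx => ?_) hx
  have := mem_span_dualMul_right Q F hF
  refine Submodule.span_induction (p := fun F _ => pairPow h (n + m) F
    (TensorPower.mulEquiv (y ⊗ₜ x)) = 0) ?_ (by simp) ?_ ?_ this
  · rintro _ ⟨f, g, hf, rfl⟩
    rw [pairPow_dualMul, hk g hf x hx, mul_zero]
  · intro F G _ _ hF hG
    rw [map_add, LinearMap.add_apply, hF, hG, add_zero]
  · intro c F _ hF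
    rw [map_smul, LinearMap.smul_apply, hF, smul_zero]

/-- `h^{⊗r} ⊗ h^{⊗s}` as a bilinear map on `(W^{⊗r} ⊗ W^{⊗s})* × (V^{⊗r} ⊗ V^{⊗s})`. -/
noncomputable def pairPow₂ (h : Module.Dual k W ⊗[k] V →ₗ[k] R) (r s : ℕ) :
    Module.Dual k (⨂[k]^r W ⊗[k] ⨂[k]^s W) →ₗ[k] (⨂[k]^r V ⊗[k] ⨂[k]^s V) →ₗ[k] R ⊗[k] R :=
  TensorProduct.curry (TensorProduct.map (powMap h r) (powMap h s) ∘ₗ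
    TensorProduct.map (tensorPowerZip r) (tensorPowerZip s) ∘ₗ
      (TensorProduct.tensorTensorTensorComm k _ _ _ _).toLinearMap) ∘ₗ
        (Cochain2.dualPairing r s).symm.toLinearMap

theorem pairPow₂_apply (h : Module.Dual k W ⊗[k] V →ₗ[k] R) {r s : ℕ}
    (F : ⨂[k]^r (Module.Dual k W) ⊗[k] ⨂[k]^s (Module.Dual k W)) (x : ⨂[k]^r V ⊗[k] ⨂[k]^s V) :
    pairPow₂ h r s (Cochain2.dualPairing r s F) x =
      TensorProduct.map (powMap h r) (powMap h s)
        (TensorProduct.map (tensorPowerZip r) (tensorPowerZip s)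
          (TensorProduct.tensorTensorTensorComm k _ _ _ _ (F ⊗ₜ x))) := by
  simp [pairPow₂]

theorem pairPow₂_tmul (h : Module.Dual k W ⊗[k] V →ₗ[k] R) {r s : ℕ}
    (f : Module.Dual k (⨂[k]^r W)) (g : Module.Dual k (⨂[k]^s W)) (x : ⨂[k]^r V) (y : ⨂[k]^s V) :
    pairPow₂ h r s (TensorProduct.dualDistrib k _ _ (f ⊗ₜ g)) (x ⊗ₜ y) =
      pairPow h r f x ⊗ₜ pairPow h s g y := by
  have : TensorProduct.dualDistrib k _ _ (f ⊗ₜ g) = Cochain2.dualPairing r s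
      ((Cochain2.dualPower r).symm f ⊗ₜ (Cochain2.dualPower s).symm g) := by
    simp [Cochain2.dualPairing]
    rfl
  rw [this, pairPow₂_apply]
  rfl

theorem pairPow₂_eq_zero_left {h : Module.Dual k W ⊗[k] V →ₗ[k] R} {r s : ℕ}
    {P : Submodule k (⨂[k]^r V)} {Q : Submodule k (⨂[k]^r W)} (hk : PairKills h P Q)
    {G : Module.Dual k (⨂[k]^r W ⊗[k] ⨂[k]^s W)}
    (hG : ∀ t ∈ Submodule.map₂ (TensorProduct.mk k _ _) Q ⊤, G t = 0) {Z : ⨂[k]^r V ⊗[k] ⨂[k]^s V}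
    (hZ : Z ∈ Submodule.map₂ (TensorProduct.mk k _ _) P ⊤) : pairPow₂ h r s G Z = 0 := by
  have hG' := mem_span_dualDistrib_left Q G
    fun x hx y => hG _ (Submodule.apply_mem_map₂ (TensorProduct.mk k _ _) hx trivial)
  have hle : Submodule.map₂ (TensorProduct.mk k _ _) P ⊤ ≤ LinearMap.ker (pairPow₂ h r s G) := by
    rw [Submodule.map₂_le]
    intro x hx y _
    have hle' : Submodule.span k {G | ∃ (f : Module.Dual k (⨂[k]^r W))
        (f' : Module.Dual k (⨂[k]^s W)), (∀ x ∈ Q, f x = 0) ∧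
        G = TensorProduct.dualDistrib k _ _ (f ⊗ₜ f')} ≤
        LinearMap.ker ((pairPow₂ h r s).flip (x ⊗ₜ y)) := by
      rw [Submodule.span_le]
      rintro _ ⟨f, g, hf, rfl⟩
      change pairPow₂ h r s _ _ = 0
      rw [pairPow₂_tmul, hk f hf x hx, TensorProduct.zero_tmul]
    exact hle' hG'
  exact hle hZ

theorem pairPow₂_eq_zero_right {h : Module.Dual k W ⊗[k] V →ₗ[k] R} {r s : ℕ}
    {P : Submodule k (⨂[k]^s V)} {Q : Submodule k (⨂[k]^s W)} (hk : PairKills h P Q)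
    {G : Module.Dual k (⨂[k]^r W ⊗[k] ⨂[k]^s W)}
    (hG : ∀ t ∈ Submodule.map₂ (TensorProduct.mk k _ _) ⊤ Q, G t = 0) {Z : ⨂[k]^r V ⊗[k] ⨂[k]^s V}
    (hZ : Z ∈ Submodule.map₂ (TensorProduct.mk k _ _) ⊤ P) : pairPow₂ h r s G Z = 0 := by
  have hG' := mem_span_dualDistrib_right Q G
    fun x y hy => hG _ (Submodule.apply_mem_map₂ (TensorProduct.mk k _ _) trivial hy)
  have hle : Submodule.map₂ (TensorProduct.mk k _ _) ⊤ P ≤ LinearMap.ker (pairPow₂ h r s G) := by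
    rw [Submodule.map₂_le]
    intro x _ y hy
    have hle' : Submodule.span k {G | ∃ (f : Module.Dual k (⨂[k]^r W))
        (f' : Module.Dual k (⨂[k]^s W)), (∀ x ∈ Q, f' x = 0) ∧
        G = TensorProduct.dualDistrib k _ _ (f ⊗ₜ f')} ≤
        LinearMap.ker ((pairPow₂ h r s).flip (x ⊗ₜ y)) := by
      rw [Submodule.span_le]
      rintro _ ⟨f, g, hf, rfl⟩
      change pairPow₂ h r s _ _ = 0
      rw [pairPow₂_tmul, hk g hf y hy, TensorProduct.tmul_zero]
    exact hle' hG'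
  exact hle hZ

/-- The dual cocycle acts on a functional by composition with ψ⁻¹, while χ acts on the tensor. Hence
annihilators on the W side and subspaces on the V side can be followed separately. -/
theorem map_prod_dual (h : Module.Dual k W ⊗[k] V →ₗ[k] R) (ψ : Cochain2 k W) (χ : Cochain2 k V)
    {r s : ℕ} (F : ⨂[k]^r (Module.Dual k W) ⊗[k] ⨂[k]^s (Module.Dual k W))
    (x : ⨂[k]^r V ⊗[k] ⨂[k]^s V) :
    TensorProduct.map (powMap h r) (powMap h s) (ψ.dual.prod χ r s
      (TensorProduct.map (tensorPowerZip r) (tensorPowerZip s)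
        (TensorProduct.tensorTensorTensorComm k _ _ _ _ (F ⊗ₜ x)))) =
      pairPow₂ h r s (Cochain2.dualPairing r s F ∘ₗ (ψ r s).symm.toLinearMap) (χ r s x) := by
  rw [Cochain2.prod_shuffle, ← pairPow₂_apply]
  exact congrArg (fun G => pairPow₂ h r s G (χ r s x))
    (LinearMap.ext fun t => Cochain2.dualPairing_dual ψ F t)

end Pairing

/-! ### Quantum spaces presented by generators and homogeneous relations -/

section FreeQuotient

variable {k : Type u} [Field k]

namespace ConicQS

/-- The quotient of a conic quantum space by a homogeneous proper ideal. -/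
noncomputable def quotient (T : ConicQS k) (I : Ideal T.carrier) [I.IsTwoSided]
    (hI : ∀ n, ∀ x ∈ I, T.proj n x ∈ I) (h1 : I ≠ ⊤) : ConicQS k where
  carrier := T.carrier ⧸ I
  gen := T.gen.map (Ideal.Quotient.mkₐ k I).toLinearMap
  finite_gen := inferInstance
  adjoin_gen := by
    have := AlgHom.map_adjoin (Ideal.Quotient.mkₐ k I) (T.gen : Set T.carrier)
    rw [T.adjoin_gen, Algebra.map_top,
      (AlgHom.range_eq_top _).2 (Ideal.Quotient.mkₐ_surjective k I)] at this
    rw [this]; rfl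
  nontrivial := Ideal.Quotient.nontrivial_iff.2 h1
  indep := by
    -- A homogeneous ideal is stable under the degree projections, so these descend; the descended
    -- projections separate the powers of the generator space.
    have h : ∀ n, ∃ Φ : T.carrier ⧸ I →ₗ[k] T.carrier ⧸ I,
        Φ ∘ₗ (Ideal.Quotient.mkₐ k I).toLinearMap =
          (Ideal.Quotient.mkₐ k I).toLinearMap ∘ₗ T.proj n := fun n =>
      exists_factor _ _ fun x hx => Ideal.Quotient.eq_zero_iff_mem.2
        (hI n x (Ideal.Quotient.eq_zero_iff_mem.1 hx))
    choose Φ hΦ using h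
    have hpow : ∀ n, T.gen.map (Ideal.Quotient.mkₐ k I).toLinearMap ^ n =
        (T.deg n).map (Ideal.Quotient.mkₐ k I).toLinearMap := fun n =>
      (Submodule.map_pow T.gen (Ideal.Quotient.mkₐ k I) n).symm
    simp only [hpow]
    refine indep_of_proj Φ ?_ ?_
    · rintro n _ ⟨x, hx, rfl⟩
      refine (LinearMap.congr_fun (hΦ n) x).trans ?_
      rw [LinearMap.comp_apply, proj_same T hx]
    · rintro m n hmn _ ⟨x, hx, rfl⟩
      refine (LinearMap.congr_fun (hΦ n) x).trans ?_
      rw [LinearMap.comp_apply, proj_ne T hmn hx, map_zero]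

section RelSpan

variable {U : Type*} [AddCommMonoid U] [Module k U] (S : ∀ n, Submodule k (⨂[k]^n U))

/-- The component of degree `n` of the ideal of the tensor algebra generated by `S`. -/
noncomputable def relSpan (n : ℕ) : Submodule k (⨂[k]^n U) :=
  Submodule.span k {y | ∃ (a b c : ℕ) (h : a + b + c = n) (x : ⨂[k]^a U) (s : ⨂[k]^b U)
    (z : ⨂[k]^c U), s ∈ S b ∧ y = TensorPower.cast k U h
      (TensorPower.mulEquiv (TensorPower.mulEquiv (x ⊗ₜ s) ⊗ₜ z))}

theorem relSpan_zero (h0 : S 0 = ⊥) : relSpan S 0 = ⊥ := by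
  rw [eq_bot_iff, relSpan, Submodule.span_le]
  rintro _ ⟨a, b, c, h, x, s, z, hs, rfl⟩
  obtain rfl : b = 0 := by omega
  rw [h0, Submodule.mem_bot] at hs
  subst hs
  simp

theorem relSpan_one (h0 : S 0 = ⊥) (h1 : S 1 = ⊥) : relSpan S 1 = ⊥ := by
  rw [eq_bot_iff, relSpan, Submodule.span_le]
  rintro _ ⟨a, b, c, h, x, s, z, hs, rfl⟩
  obtain rfl | rfl : b = 0 ∨ b = 1 := by omega
  · rw [h0, Submodule.mem_bot] at hs
    subst hs
    simp
  · rw [h1, Submodule.mem_bot] at hs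
    subst hs
    simp

end RelSpan

variable (U : Type u) [AddCommGroup U] [Module k U] [FiniteDimensional k U]

variable (k) in
/-- The tensor algebra as a conic quantum space. -/
noncomputable def free : ConicQS k where
  carrier := TensorAlgebra k U
  gen := LinearMap.range (TensorAlgebra.ι k)
  finite_gen := inferInstance
  adjoin_gen := TensorAlgebra.adjoin_range_ι
  nontrivial := inferInstance
  indep := (DirectSum.Decomposition.isInternal
    (LinearMap.range (TensorAlgebra.ι k : U →ₗ[k] TensorAlgebra k U) ^ · : ℕ → Submodule k _)).submodule_iSupIndep

variable {U}

/-- The inclusion of the generators of the tensor algebra. -/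
noncomputable def freeι : U →ₗ[k] (free k U).carrier := TensorAlgebra.ι k

theorem free_deg (n : ℕ) : (free k U).deg n = LinearMap.range (powMap (freeι : U →ₗ[k] _) n) :=
  (range_powMap (TensorAlgebra.ι k : U →ₗ[k] _) n).symm

theorem powMap_freeι_injective (n : ℕ) : Function.Injective (powMap (freeι : U →ₗ[k] _) n) :=
  powMap_ι_injective n

theorem exists_free_lift {R : Type*} [Ring R] [Algebra k R] (f : U →ₗ[k] R) :
    ∃ F : (free k U).carrier →ₐ[k] R, F.toLinearMap ∘ₗ freeι = f :=
  ⟨TensorAlgebra.lift k f, LinearMap.ext fun u => TensorAlgebra.lift_ι_apply f u⟩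

variable (S : ∀ n, Submodule k (⨂[k]^n U))

/-- The ideal of the tensor algebra generated by `S`, as a subspace. -/
noncomputable def relSub : Submodule k (free k U).carrier :=
  (⊤ * ⨆ n, (S n).map (powMap (freeι : U →ₗ[k] _) n)) * ⊤

theorem mul_mem_relSub (x y : (free k U).carrier) (hy : y ∈ relSub S) : x * y ∈ relSub S := by
  have h := Submodule.mul_mem_mul (show x ∈ (⊤ : Submodule k (free k U).carrier) from trivial) hy
  rw [relSub, ← mul_assoc, ← mul_assoc] at h
  exact SetLike.le_def.1 (mul_le_mul' (mul_le_mul' le_top le_rfl) le_rfl) h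

theorem relSub_mul_mem (x y : (free k U).carrier) (hx : x ∈ relSub S) : x * y ∈ relSub S := by
  have h := Submodule.mul_mem_mul hx (show y ∈ (⊤ : Submodule k (free k U).carrier) from trivial)
  rw [relSub, mul_assoc] at h
  exact SetLike.le_def.1 (mul_le_mul' le_rfl le_top) h

/-- The ideal of the tensor algebra generated by `S`. -/
noncomputable def relIdeal : Ideal (free k U).carrier where
  carrier := relSub S
  add_mem' := fun hx hy => (relSub S).add_mem hx hy
  zero_mem' := (relSub S).zero_mem
  smul_mem' := fun x y hy => mul_mem_relSub S x y hy

instance : (relIdeal S).IsTwoSided := ⟨fun y hx => relSub_mul_mem S _ y hx⟩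

theorem relSub_induction {N : Submodule k (free k U).carrier}
    (h : ∀ a b c (x : ⨂[k]^a U), ∀ s ∈ S b, ∀ z : ⨂[k]^c U,
      powMap (freeι) (a + b + c)
        (TensorPower.mulEquiv (TensorPower.mulEquiv (x ⊗ₜ s) ⊗ₜ z)) ∈ N) : relSub S ≤ N := by
  rw [relSub, Submodule.mul_le]
  intro p hp z _
  have htop : (⊤ : Submodule k (free k U).carrier) =
      ⨆ n, LinearMap.range (powMap (freeι : U →ₗ[k] _) n) := by
    rw [← iSup_deg]; simp only [free_deg]
  have : (⊤ * ⨆ n, (S n).map (powMap (freeι : U →ₗ[k] _) n)) ≤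
      N.comap (LinearMap.mulRight k z) := by
    rw [Submodule.mul_le]
    intro x _ s hs
    have hs' : (⨆ n, (S n).map (powMap (freeι : U →ₗ[k] _) n)) ≤
        N.comap (LinearMap.mulRight k z ∘ₗ LinearMap.mulLeft k x) := by
      refine iSup_le fun b => ?_
      rintro _ ⟨s, hs, rfl⟩
      have hx : (⊤ : Submodule k (free k U).carrier) ≤ N.comap (LinearMap.mulRight k z ∘ₗ LinearMap.mulRight k
        (powMap (freeι : U →ₗ[k] _) b s)) := by
        rw [htop]
        refine iSup_le fun a => ?_
        rintro _ ⟨x, rfl⟩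
        have hz : (⊤ : Submodule k (free k U).carrier) ≤ N.comap (LinearMap.mulLeft k (powMap (freeι : U →ₗ[k] _) a x *
          (powMap (freeι : U →ₗ[k] _) b s))) := by
          rw [htop]
          refine iSup_le fun c => ?_
          rintro _ ⟨z, rfl⟩
          have := h a b c x s hs z
          rw [powMap_mulEquiv_tmul, powMap_mulEquiv_tmul] at this
          exact this
        exact hz trivial
      exact hx trivial
    exact hs' hs
  exact this hp

/-- The ideal is spanned by the homogeneous products x s z with s in S, each of which a degree
projection keeps or kills. This shows homogeneity of the ideal and at the same time identifies its
degree n part with `relSpan`. -/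
theorem proj_relSub {x : (free k U).carrier} (hx : x ∈ relSub S) (n : ℕ) :
    (free k U).proj n x ∈ (relSpan S n).map (powMap (freeι : U →ₗ[k] _) n) := by
  have : relSub S ≤ ((relSpan S n).map (powMap (freeι : U →ₗ[k] _) n)).comap
      ((free k U).proj n) := by
    refine relSub_induction S fun a b c x s hs z => ?_
    have hdeg : powMap (freeι) (a + b + c)
        (TensorPower.mulEquiv (TensorPower.mulEquiv (x ⊗ₜ s) ⊗ₜ z)) ∈ (free k U).deg (a + b + c) := by
      rw [free_deg]; exact LinearMap.mem_range_self _ _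
    rw [Submodule.mem_comap]
    by_cases hn : a + b + c = n
    · subst hn
      rw [proj_same _ hdeg]
      exact Submodule.mem_map_of_mem (Submodule.subset_span ⟨a, b, c, rfl, x, s, z, hs, by simp⟩)
    · rw [proj_ne _ hn hdeg]
      exact zero_mem _
  exact this hx

theorem map_relSpan_le (n : ℕ) :
    (relSpan S n).map (powMap (freeι : U →ₗ[k] _) n) ≤ relSub S := by
  rw [Submodule.map_le_iff_le_comap, relSpan, Submodule.span_le]
  rintro _ ⟨a, b, c, rfl, x, s, z, hs, rfl⟩
  change powMap _ _ _ ∈ relSub S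
  rw [TensorPower.cast_refl, LinearEquiv.refl_apply, powMap_mulEquiv_tmul, powMap_mulEquiv_tmul]
  exact Submodule.mul_mem_mul (Submodule.mul_mem_mul trivial
    (Submodule.mem_iSup_of_mem b (Submodule.mem_map_of_mem hs))) trivial

theorem mem_relSpan_of_mem {n : ℕ} {x : ⨂[k]^n U}
    (hx : powMap (freeι) n x ∈ relSub S) : x ∈ relSpan S n := by
  have h := proj_relSub S hx n
  rw [proj_same _ (by rw [free_deg]; exact LinearMap.mem_range_self _ _)] at h
  obtain ⟨y, hy, hxy⟩ := h
  rwa [← powMap_freeι_injective n hxy]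

/-- The unit is the empty word, of degree 0, where the ideal has no nonzero element. -/
theorem relIdeal_ne_top (h0 : S 0 = ⊥) : relIdeal S ≠ ⊤ := by
  intro h
  have h1 : (1 : (free k U).carrier) ∈ relIdeal S := by rw [h]; trivial
  have h2 : (1 : (free k U).carrier) = powMap (freeι : U →ₗ[k] _) 0
    (PiTensorProduct.tprod k Fin.elim0) := by rw [powMap_tprod]; rfl
  rw [h2] at h1
  have h3 := mem_relSpan_of_mem S h1
  rw [relSpan_zero S h0, Submodule.mem_bot] at h3
  have h4 := congrArg (PiTensorProduct.isEmptyEquiv (Fin 0)) h3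
  simp at h4

/-- The conic quantum space generated by `U` with relations `S`. -/
noncomputable def presented (h0 : S 0 = ⊥) : ConicQS k :=
  (free k U).quotient (relIdeal S) (fun n _ hx => map_relSpan_le S n (proj_relSub S hx n))
    (relIdeal_ne_top S h0)

/-- The universal map from `U` to the presented quantum space. -/
noncomputable def presentedι (h0 : S 0 = ⊥) : U →ₗ[k] (presented S h0).carrier :=
  (Ideal.Quotient.mkₐ k (relIdeal S)).toLinearMap ∘ₗ freeι

theorem range_presentedι (h0 : S 0 = ⊥) :
    LinearMap.range (presentedι S h0) = (presented S h0).gen :=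
  LinearMap.range_comp _ _

theorem powMap_presentedι (h0 : S 0 = ⊥) {n : ℕ} (x : ⨂[k]^n U) :
    powMap (presentedι S h0) n x =
      Ideal.Quotient.mkₐ k (relIdeal S) (powMap (freeι) n x) :=
  (algHom_powMap (Ideal.Quotient.mkₐ k (relIdeal S)) (freeι) n x).symm

theorem powMap_presentedι_eq_zero_iff (h0 : S 0 = ⊥) {n : ℕ} {x : ⨂[k]^n U} :
    powMap (presentedι S h0) n x = 0 ↔ x ∈ relSpan S n := by
  rw [powMap_presentedι]
  refine Ideal.Quotient.eq_zero_iff_mem.trans ⟨fun h => mem_relSpan_of_mem S h, fun h => ?_⟩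
  exact map_relSpan_le S n (Submodule.mem_map_of_mem h)

theorem presentedι_injective (h0 : S 0 = ⊥) (h1 : S 1 = ⊥) :
    Function.Injective (presentedι S h0) := by
  rw [injective_iff_map_eq_zero]
  intro v hv
  rw [← powMap_oneLetter (presentedι S h0) v, powMap_presentedι_eq_zero_iff, relSpan_one S h0 h1,
    Submodule.mem_bot] at hv
  have := congrArg (PiTensorProduct.subsingletonEquiv (0 : Fin 1)) hv
  simpa [oneLetter] using this

theorem exists_presented_lift (h0 : S 0 = ⊥) {R : Type*} [Ring R] [Algebra k R] (f : U →ₗ[k] R)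
    (hf : ∀ n, ∀ x ∈ S n, powMap f n x = 0) :
    ∃ φ : (presented S h0).carrier →ₐ[k] R, ∀ u, φ (presentedι S h0 u) = f u := by
  obtain ⟨F, hF⟩ := exists_free_lift f
  have hI : ∀ x, x ∈ relIdeal S → F x = 0 := by
    intro x hx
    have : relSub S ≤ LinearMap.ker F.toLinearMap := by
      refine relSub_induction S fun a b c x s hs z => ?_
      rw [LinearMap.mem_ker, AlgHom.toLinearMap_apply, algHom_powMap, hF, powMap_mulEquiv_tmul, powMap_mulEquiv_tmul,
        hf b s hs, mul_zero, zero_mul]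
    exact this hx
  exact ⟨Ideal.Quotient.liftₐ (relIdeal S) F hI, fun u => LinearMap.congr_fun hF u⟩

end ConicQS

end FreeQuotient

/-! ### The ideal generated by Q^⊥ ⊗ P and the descent of cocycles to its quotient -/

section PairRel

variable {k : Type*} [Field k] {V W : Type*} [AddCommGroup V] [Module k V] [AddCommGroup W]
  [Module k W] [FiniteDimensional k W]

open ConicQS (concat relSpan)

/-- The image of `Q^⊥ ⊗ P` in the tensor powers of `W* ⊗ V`. -/
noncomputable def pairRel (P : ∀ n, Submodule k (⨂[k]^n V)) (Q : ∀ n, Submodule k (⨂[k]^n W))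
    (n : ℕ) : Submodule k (⨂[k]^n (Module.Dual k W ⊗[k] V)) :=
  Submodule.span k {y | ∃ (f : Module.Dual k (⨂[k]^n W)) (x : ⨂[k]^n V), (∀ w ∈ Q n, f w = 0) ∧
    x ∈ P n ∧ y = tensorPowerZip n ((Cochain2.dualPower n).symm f ⊗ₜ x)}

theorem pairRel_eq_bot {P : ∀ n, Submodule k (⨂[k]^n V)} (Q : ∀ n, Submodule k (⨂[k]^n W))
    {n : ℕ} (h : P n = ⊥) : pairRel P Q n = ⊥ := by
  rw [eq_bot_iff, pairRel, Submodule.span_le]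
  rintro _ ⟨f, x, _, hx, rfl⟩
  rw [h, Submodule.mem_bot] at hx
  simp [hx]

variable {R : Type*} [Ring R] [Algebra k R]

theorem pairKills_iff {P : ∀ n, Submodule k (⨂[k]^n V)} {Q : ∀ n, Submodule k (⨂[k]^n W)}
    (h : Module.Dual k W ⊗[k] V →ₗ[k] R) (n : ℕ) :
    PairKills h (P n) (Q n) ↔ ∀ x ∈ pairRel P Q n, powMap h n x = 0 := by
  constructor
  · intro hk
    have : pairRel P Q n ≤ LinearMap.ker (powMap h n) := by
      rw [pairRel, Submodule.span_le]
      rintro _ ⟨f, x, hf, hx, rfl⟩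
      exact hk f hf x hx
    exact this
  · intro hk f hf x hx
    exact hk _ (Submodule.subset_span ⟨f, x, hf, hx, rfl⟩)

/-- Decompose the outer words u and v into functional and tensor parts. The product functional kills
W^{⊗a} ⊗ Q ⊗ W^{⊗c} and the product tensor lies in V^{⊗a} ⊗ P ⊗ V^{⊗c}, which are the subspaces that
the cocycles are known to preserve. -/
theorem mem_span_triple {P : ∀ n, Submodule k (⨂[k]^n V)} {Q : ∀ n, Submodule k (⨂[k]^n W)}
    {a b c : ℕ} (u : ⨂[k]^a (Module.Dual k W ⊗[k] V)) {s : ⨂[k]^b (Module.Dual k W ⊗[k] V)}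
    (hs : s ∈ pairRel P Q b) (v : ⨂[k]^c (Module.Dual k W ⊗[k] V)) :
    TensorPower.mulEquiv (TensorPower.mulEquiv (u ⊗ₜ[k] s) ⊗ₜ[k] v) ∈ Submodule.span k
      {y | ∃ (F : Module.Dual k (⨂[k]^(a + b + c) W)) (X : ⨂[k]^(a + b + c) V),
        (∀ w ∈ (concat (concat ⊤ (Q b)) ⊤ : Submodule k (⨂[k]^(a + b + c) W)), F w = 0) ∧
        X ∈ (concat (concat ⊤ (P b)) ⊤ : Submodule k (⨂[k]^(a + b + c) V)) ∧
        y = tensorPowerZip (a + b + c) ((Cochain2.dualPower (a + b + c)).symm F ⊗ₜ X)} := by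
  set N := Submodule.span k
      {y | ∃ (F : Module.Dual k (⨂[k]^(a + b + c) W)) (X : ⨂[k]^(a + b + c) V),
        (∀ w ∈ (concat (concat ⊤ (Q b)) ⊤ : Submodule k (⨂[k]^(a + b + c) W)), F w = 0) ∧
        X ∈ (concat (concat ⊤ (P b)) ⊤ : Submodule k (⨂[k]^(a + b + c) V)) ∧
        y = tensorPowerZip (a + b + c) ((Cochain2.dualPower (a + b + c)).symm F ⊗ₜ X)} with hN
  obtain ⟨u, rfl⟩ := (tensorPowerZip_bijective a).2 u
  obtain ⟨v, rfl⟩ := (tensorPowerZip_bijective c).2 v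
  induction u with
  | zero => simp
  | add x y hx hy => simp only [map_add, TensorProduct.add_tmul]; exact add_mem hx hy
  | tmul f₁ t₁ =>
  induction v with
  | zero => simp
  | add x y hx hy => simp only [map_add, TensorProduct.tmul_add]; exact add_mem hx hy
  | tmul f₃ t₃ =>
  have hle : pairRel P Q b ≤ N.comap ((TensorPower.mulEquiv (R := k)).toLinearMap ∘ₗ
      (TensorProduct.mk k _ _).flip (tensorPowerZip c (f₃ ⊗ₜ t₃)) ∘ₗ
      (TensorPower.mulEquiv (R := k)).toLinearMap ∘ₗ
      TensorProduct.mk k _ _ (tensorPowerZip a (f₁ ⊗ₜ t₁))) := by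
    rw [pairRel, Submodule.span_le]
    rintro _ ⟨f, x, hf, hx, rfl⟩
    obtain ⟨f₁, rfl⟩ := (Cochain2.dualPower a).symm.surjective f₁
    obtain ⟨f₃, rfl⟩ := (Cochain2.dualPower c).symm.surjective f₃
    refine Submodule.subset_span ⟨dualMul (dualMul f₁ f) f₃,
      TensorPower.mulEquiv (TensorPower.mulEquiv (t₁ ⊗ₜ x) ⊗ₜ t₃), ?_,
      Cochain2.mem_concat (Cochain2.mem_concat trivial hx) trivial, ?_⟩
    · intro w hw
      refine concat_induction _ (fun w hw w' _ => ?_) hw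
      rw [dualMul_apply]
      refine mul_eq_zero_of_left (concat_induction (dualMul f₁ f) (fun w _ w' hw => ?_) hw) _
      rw [dualMul_apply, hf _ hw, mul_zero]
    · rw [dualPower_symm_dualMul, dualPower_symm_dualMul, tensorPowerZip_mulEquiv,
        tensorPowerZip_mulEquiv]
      rfl
  exact hle hs

/-- `ψ` preserves the subspaces `V^{⊗a} ⊗ P_b ⊗ V^{⊗c}` in each of its arguments. -/
def Cochain2.Preserves {V : Type*} [AddCommMonoid V] [Module k V] (ψ : Cochain2 k V)
    (P : ∀ n, Submodule k (⨂[k]^n V)) : Prop :=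
  ∀ a b c n : ℕ,
    (Submodule.map₂ (TensorProduct.mk k _ (⨂[k]^n V))
        (concat (concat ⊤ (P b)) ⊤ : Submodule k (⨂[k]^(a + b + c) V)) ⊤).map
        (ψ (a + b + c) n).toLinearMap = Submodule.map₂ (TensorProduct.mk k _ _)
          (concat (concat ⊤ (P b)) ⊤ : Submodule k (⨂[k]^(a + b + c) V)) ⊤ ∧
    (Submodule.map₂ (TensorProduct.mk k (⨂[k]^n V) _) ⊤
        (concat (concat ⊤ (P b)) ⊤ : Submodule k (⨂[k]^(a + b + c) V))).map
        (ψ n (a + b + c)).toLinearMap = Submodule.map₂ (TensorProduct.mk k _ _) ⊤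
          (concat (concat ⊤ (P b)) ⊤ : Submodule k (⨂[k]^(a + b + c) V))

theorem symm_mem_of_map_eq {M : Type*} [AddCommMonoid M] [Module k M] {e : M ≃ₗ[k] M}
    {S : Submodule k M} (h : S.map e.toLinearMap = S) {x : M} (hx : x ∈ S) : e.symm x ∈ S := by
  rw [← h] at hx
  obtain ⟨y, hy, rfl⟩ := hx
  simpa using hy

/-- As ψ⁻¹ preserves the Q-subspace, the functional transported by ψ still annihilates it; as χ
preserves the P-subspace, the tensor stays inside. The power of h therefore still vanishes on the
transported pair. -/
theorem prod_dual_eq_zero_left {P : ∀ n, Submodule k (⨂[k]^n V)} {Q : ∀ n, Submodule k (⨂[k]^n W)}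
    {h : Module.Dual k W ⊗[k] V →ₗ[k] R} (hk : ∀ n, PairKills h (P n) (Q n))
    {ψ : Cochain2 k W} {χ : Cochain2 k V} (hψ : ψ.Preserves Q) (hχ : χ.Preserves P) {a b c s : ℕ}
    {F : Module.Dual k (⨂[k]^(a + b + c) W)} {X : ⨂[k]^(a + b + c) V}
    (hF : ∀ w ∈ (concat (concat ⊤ (Q b)) ⊤ : Submodule k (⨂[k]^(a + b + c) W)), F w = 0)
    (hX : X ∈ (concat (concat ⊤ (P b)) ⊤ : Submodule k (⨂[k]^(a + b + c) V)))
    (f : ⨂[k]^s (Module.Dual k W)) (x : ⨂[k]^s V) :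
    TensorProduct.map (powMap h (a + b + c)) (powMap h s) (ψ.dual.prod χ (a + b + c) s
      (tensorPowerZip (a + b + c) ((Cochain2.dualPower (a + b + c)).symm F ⊗ₜ X) ⊗ₜ
        tensorPowerZip s (f ⊗ₜ x))) = 0 := by
  have hk3 : PairKills h (n := a + b + c) (concat (concat ⊤ (P b)) ⊤)
      (concat (concat ⊤ (Q b)) ⊤) := ((hk b).concat_left a).concat_right c
  have := map_prod_dual h ψ χ ((Cochain2.dualPower (a + b + c)).symm F ⊗ₜ[k] f) (X ⊗ₜ[k] x)
  rw [TensorProduct.tensorTensorTensorComm_tmul, TensorProduct.map_tmul] at this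
  refine this.trans (pairPow₂_eq_zero_left hk3 (fun t ht => ?_) ?_)
  · have hle : Submodule.map₂ (TensorProduct.mk k _ (⨂[k]^s W))
        (concat (concat ⊤ (Q b)) ⊤ : Submodule k (⨂[k]^(a + b + c) W)) ⊤ ≤
        LinearMap.ker (Cochain2.dualPairing (a + b + c) s
          ((Cochain2.dualPower (a + b + c)).symm F ⊗ₜ[k] f)) := by
      rw [Submodule.map₂_le]
      intro w hw w' _
      rw [LinearMap.mem_ker, TensorProduct.mk_apply, Cochain2.dualPairing_apply,
        dualPower_mulEquiv, dualMul_apply, LinearEquiv.apply_symm_apply, hF w hw, zero_mul]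
    exact hle (symm_mem_of_map_eq (hψ a b c s).1 ht)
  · rw [← (hχ a b c s).1]
    exact Submodule.mem_map_of_mem (Submodule.apply_mem_map₂ (TensorProduct.mk k _ _) hX trivial)

theorem prod_dual_eq_zero_right {P : ∀ n, Submodule k (⨂[k]^n V)} {Q : ∀ n, Submodule k (⨂[k]^n W)}
    {h : Module.Dual k W ⊗[k] V →ₗ[k] R} (hk : ∀ n, PairKills h (P n) (Q n))
    {ψ : Cochain2 k W} {χ : Cochain2 k V} (hψ : ψ.Preserves Q) (hχ : χ.Preserves P) {a b c r : ℕ}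
    {F : Module.Dual k (⨂[k]^(a + b + c) W)} {X : ⨂[k]^(a + b + c) V}
    (hF : ∀ w ∈ (concat (concat ⊤ (Q b)) ⊤ : Submodule k (⨂[k]^(a + b + c) W)), F w = 0)
    (hX : X ∈ (concat (concat ⊤ (P b)) ⊤ : Submodule k (⨂[k]^(a + b + c) V)))
    (f : ⨂[k]^r (Module.Dual k W)) (x : ⨂[k]^r V) :
    TensorProduct.map (powMap h r) (powMap h (a + b + c)) (ψ.dual.prod χ r (a + b + c)
      (tensorPowerZip r (f ⊗ₜ x) ⊗ₜ
        tensorPowerZip (a + b + c) ((Cochain2.dualPower (a + b + c)).symm F ⊗ₜ X))) = 0 := by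
  have hk3 : PairKills h (n := a + b + c) (concat (concat ⊤ (P b)) ⊤)
      (concat (concat ⊤ (Q b)) ⊤) := ((hk b).concat_left a).concat_right c
  have := map_prod_dual h ψ χ (f ⊗ₜ[k] (Cochain2.dualPower (a + b + c)).symm F) (x ⊗ₜ[k] X)
  rw [TensorProduct.tensorTensorTensorComm_tmul, TensorProduct.map_tmul] at this
  refine this.trans (pairPow₂_eq_zero_right hk3 (fun t ht => ?_) ?_)
  · have hle : Submodule.map₂ (TensorProduct.mk k (⨂[k]^r W) _) ⊤
        (concat (concat ⊤ (Q b)) ⊤ : Submodule k (⨂[k]^(a + b + c) W)) ≤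
        LinearMap.ker (Cochain2.dualPairing r (a + b + c)
          (f ⊗ₜ[k] (Cochain2.dualPower (a + b + c)).symm F)) := by
      rw [Submodule.map₂_le]
      intro w _ w' hw
      rw [LinearMap.mem_ker, TensorProduct.mk_apply, Cochain2.dualPairing_apply,
        dualPower_mulEquiv, dualMul_apply, LinearEquiv.apply_symm_apply, hF w' hw, mul_zero]
    exact hle (symm_mem_of_map_eq (hψ a b c r).2 ht)
  · rw [← (hχ a b c r).2]
    exact Submodule.mem_map_of_mem (Submodule.apply_mem_map₂ (TensorProduct.mk k _ _) trivial hX)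

theorem relSpan_pairRel_le {P : ∀ n, Submodule k (⨂[k]^n V)} {Q : ∀ n, Submodule k (⨂[k]^n W)}
    {N : ∀ r, Submodule k (⨂[k]^r (Module.Dual k W ⊗[k] V))}
    (h : ∀ (a b c : ℕ) (F : Module.Dual k (⨂[k]^(a + b + c) W)) (X : ⨂[k]^(a + b + c) V),
      (∀ w ∈ (concat (concat ⊤ (Q b)) ⊤ : Submodule k (⨂[k]^(a + b + c) W)), F w = 0) →
      X ∈ (concat (concat ⊤ (P b)) ⊤ : Submodule k (⨂[k]^(a + b + c) V)) →
      tensorPowerZip (a + b + c) ((Cochain2.dualPower (a + b + c)).symm F ⊗ₜ X) ∈ N (a + b + c))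
    (r : ℕ) : relSpan (pairRel P Q) r ≤ N r := by
  rw [relSpan, Submodule.span_le]
  rintro _ ⟨a, b, c, rfl, u, σ, v, hσ, rfl⟩
  rw [TensorPower.cast_refl, LinearEquiv.refl_apply]
  refine (Submodule.span_le.2 ?_) (mem_span_triple u hσ v)
  rintro _ ⟨F, X, hF, hX, rfl⟩
  exact h a b c F X hF hX

/-- `ψ^! ⊗ χ` descends to the algebra generated by `W* ⊗ V` with relations `Q^⊥ ⊗ P`. -/
theorem exists_descent {P : ∀ n, Submodule k (⨂[k]^n V)} {Q : ∀ n, Submodule k (⨂[k]^n W)}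
    {h : Module.Dual k W ⊗[k] V →ₗ[k] R} (hk : ∀ n, PairKills h (P n) (Q n))
    (hker : ∀ n x, powMap h n x = 0 → x ∈ relSpan (pairRel P Q) n)
    {ψ : Cochain2 k W} {χ : Cochain2 k V} (hψ : ψ.Preserves Q) (hχ : χ.Preserves P) (r s : ℕ) :
    ∃ Φ : R ⊗[k] R →ₗ[k] R ⊗[k] R, Φ ∘ₗ TensorProduct.map (powMap h r) (powMap h s) =
      TensorProduct.map (powMap h r) (powMap h s) ∘ₗ (ψ.dual.prod χ r s).toLinearMap := by
  -- The map is named for all degrees at once because the reduction to generators of the ideal below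
  -- replaces one degree by a + b + c.
  obtain ⟨q, hq⟩ : ∃ q : ∀ r s, _, q = fun r s => TensorProduct.map (powMap h r) (powMap h s) ∘ₗ
    (ψ.dual.prod χ r s).toLinearMap := ⟨_, rfl⟩
  have hqr : q r s = TensorProduct.map (powMap h r) (powMap h s) ∘ₗ
    (ψ.dual.prod χ r s).toLinearMap := by rw [hq]
  rw [← hqr]
  apply exists_factor_map
  · intro x y hx
    obtain ⟨y, rfl⟩ := (tensorPowerZip_bijective s).2 y
    induction y with
    | zero => simp
    | add y y' hy hy' => rw [map_add, TensorProduct.tmul_add, map_add, hy, hy', add_zero]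
    | tmul f' x' =>
    refine relSpan_pairRel_le (N := fun r => LinearMap.ker (q r s ∘ₗ
      (TensorProduct.mk k _ _).flip (tensorPowerZip s (f' ⊗ₜ x')))) ?_ r (hker r x hx)
    intro a b c F X hF hX
    subst hq
    exact prod_dual_eq_zero_left hk hψ hχ hF hX f' x'
  · intro y x hx
    obtain ⟨y, rfl⟩ := (tensorPowerZip_bijective r).2 y
    induction y with
    | zero => simp
    | add y y' hy hy' => rw [map_add, TensorProduct.add_tmul, map_add, hy, hy', add_zero]
    | tmul f' x' =>
    refine relSpan_pairRel_le (N := fun s => LinearMap.ker (q r s ∘ₗ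
      (TensorProduct.mk k _ _) (tensorPowerZip r (f' ⊗ₜ x')))) ?_ s (hker s x hx)
    intro a b c F X hF hX
    subst hq
    exact prod_dual_eq_zero_right hk hψ hχ hF hX f' x'

end PairRel

/-! ### Homogeneous maps and induced automorphisms, defined on words -/

namespace ConicQS

variable {k : Type u} [Field k]

theorem prodMap_eq_powMap (A : ConicQS k) (n : ℕ) : A.prodMap n = powMap A.gen.subtype n := rfl

theorem range_prodMap (A : ConicQS k) (n : ℕ) : LinearMap.range (A.prodMap n) = A.deg n := by
  rw [prodMap_eq_powMap, range_powMap, Submodule.range_subtype]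
  rfl

theorem prodMap_mem (A : ConicQS k) {n : ℕ} (t : ⨂[k]^n A.gen) : A.prodMap n t ∈ A.deg n := by
  rw [← range_prodMap]
  exact LinearMap.mem_range_self _ t

theorem prodMap_mulEquiv (A : ConicQS k) {r s : ℕ} (x : ⨂[k]^r A.gen) (y : ⨂[k]^s A.gen) :
    A.prodMap (r + s) (TensorPower.mulEquiv (x ⊗ₜ y)) = A.prodMap r x * A.prodMap s y :=
  powMap_mulEquiv_tmul _ x y

theorem prodMap_one (A : ConicQS k) : A.prodMap 0 (PiTensorProduct.tprod k Fin.elim0) = 1 := by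
  rw [prodMap_eq_powMap, powMap_tprod]
  rfl

theorem prodMap_oneLetter (A : ConicQS k) (a : A.gen) : A.prodMap 1 (oneLetter a) = a :=
  powMap_oneLetter _ a

/-- Multiplication in degree 0 is the structure map k → A, injective because A ≠ 0. -/
theorem rel_zero (A : ConicQS k) : A.rel 0 = ⊥ := by
  rw [rel, LinearMap.ker_eq_bot']
  intro x hx
  rw [prodMap_eq_powMap, powMap_zero, map_eq_zero_iff _ (algebraMap k A.carrier).injective] at hx
  simpa using hx

theorem rel_one (A : ConicQS k) : A.rel 1 = ⊥ := by
  rw [rel, LinearMap.ker_eq_bot']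
  intro x hx
  obtain ⟨v, rfl⟩ := exists_oneLetter x
  rw [prodMap_oneLetter] at hx
  obtain rfl : v = 0 := Subtype.ext hx
  exact (PiTensorProduct.tprod k).map_coord_zero (0 : Fin 1) rfl

theorem linearMap_ext_prodMap {A : ConicQS k} {M : Type*} [AddCommGroup M] [Module k M]
    {f g : A.carrier →ₗ[k] M} (h : ∀ n t, f (A.prodMap n t) = g (A.prodMap n t)) : f = g := by
  refine LinearMap.ext fun x => ?_
  refine deg_induction A (P := fun x => f x = g x) (by simp)
    (fun x y hx hy => by simp only [map_add, hx, hy]) (fun n x hx => ?_) x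
  rw [← range_prodMap] at hx
  obtain ⟨t, rfl⟩ := hx
  exact h n t

/-- A homogeneous linear map given by maps on tensor powers that respect the relations. -/
theorem exists_grHom {A D : ConicQS k} (c : ∀ n, ⨂[k]^n A.gen →ₗ[k] ⨂[k]^n D.gen)
    (hc : ∀ n t, A.prodMap n t = 0 → D.prodMap n (c n t) = 0) :
    ∃ φ : (forgetGr k).obj A ⟶ (forgetGr k).obj D,
      ∀ n t, grLin φ (A.prodMap n t) = D.prodMap n (c n t) := by
  have h : ∀ n, ∃ Φ : A.carrier →ₗ[k] D.carrier, Φ ∘ₗ A.prodMap n = D.prodMap n ∘ₗ c n :=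
    fun n => exists_factor _ _ (hc n)
  choose Φ hΦ using h
  let F : A.carrier →ₗ[k] D.carrier := A.glue fun n => Φ n ∘ₗ (A.deg n).subtype
  have hF : ∀ n t, F (A.prodMap n t) = D.prodMap n (c n t) := fun n t =>
    (A.glue_apply _ n ⟨_, A.prodMap_mem t⟩).trans (LinearMap.congr_fun (hΦ n) t)
  refine ⟨GrVct.Hom.mk F fun n x hx => ?_, hF⟩
  have hx' : x ∈ A.deg n := hx
  rw [← range_prodMap] at hx'
  obtain ⟨t, rfl⟩ := hx'
  exact (hF n t).symm ▸ D.prodMap_mem _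

theorem grHom_ext {A D : ConicQS k} {φ φ' : (forgetGr k).obj A ⟶ (forgetGr k).obj D}
    (h : ∀ n t, grLin φ (A.prodMap n t) = grLin φ' (A.prodMap n t)) : φ = φ' :=
  GrVct.Hom.ext (linearMap_ext_prodMap (A := A) h)

theorem tensor_ext_prodMap {A D : ConicQS k} {M : Type*} [AddCommGroup M] [Module k M]
    {f g : A.carrier ⊗[k] D.carrier →ₗ[k] M}
    (h : ∀ r s t, f (TensorProduct.map (A.prodMap r) (D.prodMap s) t) =
      g (TensorProduct.map (A.prodMap r) (D.prodMap s) t)) : f = g := by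
  refine TensorProduct.ext (linearMap_ext_prodMap fun r t => linearMap_ext_prodMap fun s t' => ?_)
  exact h r s (t ⊗ₜ t')

theorem exists_bigraded_map (D : ConicQS k)
    (χ : ∀ r s : ℕ, (⨂[k]^r D.gen ⊗[k] ⨂[k]^s D.gen) →ₗ[k] (⨂[k]^r D.gen ⊗[k] ⨂[k]^s D.gen))
    (h : ∀ r s t, TensorProduct.map (D.prodMap r) (D.prodMap s) t = 0 →
      TensorProduct.map (D.prodMap r) (D.prodMap s) (χ r s t) = 0) :
    ∃ Φ : D.carrier ⊗[k] D.carrier →ₗ[k] D.carrier ⊗[k] D.carrier,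
      ∀ r s t, Φ (TensorProduct.map (D.prodMap r) (D.prodMap s) t) =
        TensorProduct.map (D.prodMap r) (D.prodMap s) (χ r s t) := by
  have h' : ∀ r s, ∃ Φ : D.carrier ⊗[k] D.carrier →ₗ[k] D.carrier ⊗[k] D.carrier,
      Φ ∘ₗ TensorProduct.map (D.prodMap r) (D.prodMap s) =
        TensorProduct.map (D.prodMap r) (D.prodMap s) ∘ₗ χ r s :=
    fun r s => exists_factor _ _ (h r s)
  choose Φ hΦ using h'
  -- The map Φ r s has the prescribed values only on D_r ⊗ D_s. The pieces are glued over the second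
  -- degree for fixed r, and then over the first.
  let B : ∀ _ : ℕ, D.carrier →ₗ[k] D.carrier →ₗ[k] D.carrier ⊗[k] D.carrier := fun r =>
    D.glue fun s => (TensorProduct.curry (Φ r s)).flip ∘ₗ (D.deg s).subtype
  let F : D.carrier →ₗ[k] D.carrier →ₗ[k] D.carrier ⊗[k] D.carrier :=
    D.glue fun r => (B r).flip ∘ₗ (D.deg r).subtype
  refine ⟨TensorProduct.lift F, fun r s t => ?_⟩
  have key : TensorProduct.lift F ∘ₗ TensorProduct.map (D.prodMap r) (D.prodMap s) =
      TensorProduct.map (D.prodMap r) (D.prodMap s) ∘ₗ χ r s := by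
    rw [← hΦ]
    refine TensorProduct.ext' fun x y => ?_
    have h1 : F (D.prodMap r x) = (B r).flip (D.prodMap r x) :=
      D.glue_apply _ r ⟨_, D.prodMap_mem x⟩
    have h2 : B r (D.prodMap s y) = (TensorProduct.curry (Φ r s)).flip (D.prodMap s y) :=
      D.glue_apply _ s ⟨_, D.prodMap_mem y⟩
    simp [h1, h2]
  exact LinearMap.congr_fun key t

/-- A cochain whose components preserve the kernels of multiplication induces an automorphism. -/
theorem exists_induces (D : ConicQS k) (χ : Cochain2 k D.gen)
    (h : ∀ r s t, TensorProduct.map (D.prodMap r) (D.prodMap s) t = 0 →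
      TensorProduct.map (D.prodMap r) (D.prodMap s) (χ r s t) = 0) :
    ∃ Ψ, D.Induces χ Ψ := by
  obtain ⟨Φ, hΦ⟩ := exists_bigraded_map D (fun r s => (χ r s).toLinearMap) h
  obtain ⟨Φ', hΦ'⟩ := exists_bigraded_map D (fun r s => (χ r s).symm.toLinearMap)
    fun r s t ht => ker_symm_of_ker (χ r s) _ (h r s) t ht
  refine ⟨LinearEquiv.ofLinearMap Φ Φ' ?_ ?_, hΦ⟩
  · exact tensor_ext_prodMap fun r s t => by
      rw [LinearMap.comp_apply, hΦ', hΦ]; simp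
  · exact tensor_ext_prodMap fun r s t => by
      rw [LinearMap.comp_apply, hΦ, hΦ']; simp

end ConicQS

/-! ### Coevaluating words and twisting the result -/

section CoevMap

variable {k : Type*} [Field k] {V W : Type*} [AddCommGroup V] [Module k V] [AddCommGroup W]
  [Module k W] [FiniteDimensional k W]

variable (k V W) in
/-- The map `V → W* ⊗ V ⊗ W` dual to evaluation. -/
noncomputable def coevMap : V →ₗ[k] (Module.Dual k W ⊗[k] V) ⊗[k] W :=
  (LinearMap.rTensorHom W ∘ₗ (TensorProduct.mk k (Module.Dual k W) V).flip).flip (coevTensor k W)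

theorem coevMap_apply (a : V) : coevMap k V W a =
    TensorProduct.map ((TensorProduct.mk k (Module.Dual k W) V).flip a) LinearMap.id
      (coevTensor k W) := rfl

variable (W) in
/-- The map `f ↦ f ⊗ t` from `(W^{⊗n})*` to `(W* ⊗ V)^{⊗n}`. -/
noncomputable def zipDual {n : ℕ} (t : ⨂[k]^n V) :
    Module.Dual k (⨂[k]^n W) →ₗ[k] ⨂[k]^n (Module.Dual k W ⊗[k] V) :=
  tensorPowerZip n ∘ₗ (TensorProduct.mk k _ _).flip t ∘ₗ (Cochain2.dualPower n).symm.toLinearMap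

theorem zipDual_apply {n : ℕ} (t : ⨂[k]^n V) (f : Module.Dual k (⨂[k]^n W)) :
    zipDual W t f = tensorPowerZip n ((Cochain2.dualPower n).symm f ⊗ₜ t) := rfl

theorem zipDual_add {n : ℕ} (t t' : ⨂[k]^n V) : zipDual W (t + t') = zipDual W t + zipDual W t' :=
  LinearMap.ext fun f => by simp [zipDual_apply, TensorProduct.tmul_add]

theorem zipDual_smul {n : ℕ} (c : k) (t : ⨂[k]^n V) : zipDual W (c • t) = c • zipDual W t :=
  LinearMap.ext fun f => by simp [zipDual_apply]

/-- Coevaluating each letter of a word and expanding the product of sums yields one sum over words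
in a basis of W, which by `coevTensor_power` is a single coevaluation with W^{⊗n}. -/
theorem map_coevMap {n : ℕ} (t : ⨂[k]^n V) :
    PiTensorProduct.map (fun _ => coevMap k V W) t =
      tensorPowerZip n (TensorProduct.map (zipDual W t) LinearMap.id (coevTensor k (⨂[k]^n W))) := by
  classical
  induction t using PiTensorProduct.induction_on with
  | smul_tprod c v =>
    rw [map_smul, zipDual_smul, TensorProduct.map_smul_left, LinearMap.smul_apply, map_smul]
    congr 1
    let b := Module.finBasis k W
    rw [PiTensorProduct.map_tprod, coevTensor_power b, map_sum, map_sum]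
    simp only [coevMap_apply, coevTensor_eq_sum b, map_sum, TensorProduct.map_tmul,
      zipDual_apply, LinearEquiv.symm_apply_apply, tensorPowerZip_tprod, LinearMap.id_apply,
      LinearMap.flip_apply, TensorProduct.mk_apply]
    rw [MultilinearMap.map_sum]
  | add x y hx hy =>
    rw [map_add, hx, hy, zipDual_add, TensorProduct.map_add_left, LinearMap.add_apply, map_add]

/-- The action of `(θ^! ⊗ η) ⊗ id` on `(W* ⊗ V ⊗ W)^{⊗n}`. -/
noncomputable def Cochain1.coevProd (θ : Cochain1 k W) (η : Cochain1 k V) :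
    Cochain1 k ((Module.Dual k W ⊗[k] V) ⊗[k] W) :=
  Cochain1.prod (Cochain1.prod (Cochain1.dual θ) η) fun _ => LinearEquiv.refl k _

theorem coevProd_map_coevMap (θ : Cochain1 k W) (η : Cochain1 k V) {n : ℕ} (t : ⨂[k]^n V) :
    Cochain1.coevProd θ η n (PiTensorProduct.map (fun _ => coevMap k V W) t) =
      tensorPowerZip n (TensorProduct.map (zipDual W (η n t) ∘ₗ (θ n).symm.toLinearMap.dualMap)
        LinearMap.id (coevTensor k (⨂[k]^n W))) := by
  rw [map_coevMap, Cochain1.coevProd, Cochain1.prod_shuffle, TensorProduct.map_map]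
  congr 3
  refine LinearMap.ext fun f => ?_
  have hf : Cochain1.dual θ n ((Cochain2.dualPower n).symm f) =
      (Cochain2.dualPower n).symm ((θ n).symm.toLinearMap.dualMap f) := by
    rw [LinearEquiv.eq_symm_apply]
    refine LinearMap.ext fun x => ?_
    rw [Cochain2.dualPower_dual, LinearEquiv.apply_symm_apply]
    rfl
  rw [LinearMap.comp_apply, LinearEquiv.coe_coe, zipDual_apply, Cochain1.prod_shuffle,
    TensorProduct.map_tmul, LinearMap.comp_apply, zipDual_apply, ← hf]
  rfl

variable {R S : Type*} [Ring R] [Algebra k R] [Ring S] [Algebra k S]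

/-- The crucial untwisting: the contragredient of θ on the dual leg is moved across the canonical
element and reappears as θ⁻¹ before multiplication in S. The result contains only plain powers of h.
-/
theorem powMap_coevProd (h : Module.Dual k W ⊗[k] V →ₗ[k] R) (g : W →ₗ[k] S) (θ : Cochain1 k W)
    (η : Cochain1 k V) {n : ℕ} (t : ⨂[k]^n V) :
    powMap (TensorProduct.map h g) n
        (Cochain1.coevProd θ η n (PiTensorProduct.map (fun _ => coevMap k V W) t)) =
      TensorProduct.map ((pairPow h n).flip (η n t)) (powMap g n ∘ₗ (θ n).symm.toLinearMap)
        (coevTensor k (⨂[k]^n W)) := by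
  rw [coevProd_map_coevMap, powMap_map_zip, map_comp_coevTensor, TensorProduct.map_map]
  rfl

end CoevMap

/-! ### Untwisting the morphisms into the twisted product -/

namespace ConicQS

variable {k : Type u} [Field k]

/-- The multiplication of `A` untwisted by the cocycle `ψ`. -/
noncomputable def twProd (A : ConicQS k) (ψ : Cochain2 k A.gen) (n : ℕ) :
    ⨂[k]^n A.gen →ₗ[k] A.carrier := A.prodMap n ∘ₗ (ψ.primitive n).symm.toLinearMap

theorem twProd_primitive (A : ConicQS k) (ψ : Cochain2 k A.gen) (n : ℕ) (t : ⨂[k]^n A.gen) :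
    A.twProd ψ n (ψ.primitive n t) = A.prodMap n t := by
  simp [twProd]

theorem mem_twistedRel (A : ConicQS k) (ψ : Cochain2 k A.gen) {n : ℕ} {x : ⨂[k]^n A.gen} :
    x ∈ A.twistedRel ψ n ↔ A.twProd ψ n x = 0 := by
  constructor
  · rintro ⟨y, hy, rfl⟩
    exact (A.twProd_primitive ψ n y).trans hy
  · intro h
    exact ⟨(ψ.primitive n).symm x, h, LinearEquiv.apply_symm_apply _ _⟩

theorem linearMap_ext_twProd {A : ConicQS k} (ψ : Cochain2 k A.gen) {M : Type*} [AddCommGroup M]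
    [Module k M] {f g : A.carrier →ₗ[k] M} (h : ∀ n t, f (A.twProd ψ n t) = g (A.twProd ψ n t)) :
    f = g :=
  linearMap_ext_prodMap fun n t => by
    rw [← A.twProd_primitive ψ n t]
    exact h n _

/-- Each of the three factors of ω is a coboundary, and coboundaries commute with duals and tensor
products. -/
theorem dual_prod_prod_one_eq {V W : Type*} [AddCommGroup V] [Module k V] [AddCommGroup W]
    [Module k W] [FiniteDimensional k W] {ψ : Cochain2 k W} {χ : Cochain2 k V} (hψ : ψ.IsZ2)
    (hχ : χ.IsZ2) : (ψ.dual.prod χ).prod Cochain2.one =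
      Cochain2.coboundary (Cochain1.coevProd ψ.primitive χ.primitive) := by
  conv_lhs => rw [Cochain2.eq_coboundary_primitive hψ, Cochain2.eq_coboundary_primitive hχ,
    Cochain2.coboundary_dual, Cochain2.coboundary_prod, Cochain2.one_eq_coboundary,
    Cochain2.coboundary_prod]
  rfl

theorem prod_eq_refl {V W : Type*} [AddCommMonoid V] [Module k V] [AddCommMonoid W]
    [Module k W] {θ : Cochain1 k V} {η : Cochain1 k W} {n : ℕ} (hθ : θ n = LinearEquiv.refl k _)
    (hη : η n = LinearEquiv.refl k _) : Cochain1.prod θ η n = LinearEquiv.refl k _ := by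
  ext x
  obtain ⟨x, rfl⟩ := (tensorPowerZip_bijective n).2 x
  rw [Cochain1.prod_shuffle, hθ, hη]
  exact congrArg _ (LinearMap.congr_fun TensorProduct.map_id x)

theorem dual_eq_refl {W : Type*} [AddCommGroup W] [Module k W] [FiniteDimensional k W]
    {θ : Cochain1 k W} {n : ℕ} (hθ : θ n = LinearEquiv.refl k _) :
    Cochain1.dual θ n = LinearEquiv.refl k _ := by
  ext f
  apply (Cochain2.dualPower n).injective
  refine LinearMap.ext fun x => ?_
  rw [Cochain2.dualPower_dual, hθ]
  rfl

theorem coevProd_eq_refl {V W : Type*} [AddCommGroup V] [Module k V] [AddCommGroup W]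
    [Module k W] [FiniteDimensional k W] {θ : Cochain1 k W} {η : Cochain1 k V} {n : ℕ}
    (hθ : θ n = LinearEquiv.refl k _) (hη : η n = LinearEquiv.refl k _) :
    Cochain1.coevProd θ η n = LinearEquiv.refl k _ :=
  prod_eq_refl (prod_eq_refl (dual_eq_refl hθ) hη) rfl

/-- Evaluating θ-twisted words in D turns concatenation into the product m ∘ Ψ. The map p need not
be injective; it suffices that ω lies under ∂θ along it. -/
theorem mul_induces {D : ConicQS k} {ω : Cochain2 k D.gen}
    {Ψ : (D.carrier ⊗[k] D.carrier) ≃ₗ[k] (D.carrier ⊗[k] D.carrier)} (hΨ : D.Induces ω Ψ)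
    {U : Type*} [AddCommMonoid U] [Module k U] (p : U →ₗ[k] D.gen) {θ : Cochain1 k U}
    (hω : ∀ r s t, ω r s (TensorProduct.map (PiTensorProduct.map fun _ => p)
        (PiTensorProduct.map fun _ => p) t) =
      TensorProduct.map (PiTensorProduct.map fun _ => p) (PiTensorProduct.map fun _ => p)
        (Cochain2.coboundary θ r s t)) {r s : ℕ} (x : ⨂[k]^r U) (y : ⨂[k]^s U) :
    LinearMap.mul' k D.carrier (Ψ (powMap (D.gen.subtype ∘ₗ p) r (θ r x) ⊗ₜ
        powMap (D.gen.subtype ∘ₗ p) s (θ s y))) =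
      powMap (D.gen.subtype ∘ₗ p) (r + s) (θ (r + s) (TensorPower.mulEquiv (x ⊗ₜ y))) := by
  have h := hΨ r s (TensorProduct.map (PiTensorProduct.map fun _ => p)
    (PiTensorProduct.map fun _ => p) (θ r x ⊗ₜ θ s y))
  rw [hω, TensorProduct.map_map, TensorProduct.map_map, prodMap_eq_powMap, prodMap_eq_powMap,
    ← powMap_comp, ← powMap_comp, TensorProduct.map_tmul] at h
  rw [h, ← Cochain2.coboundary_apply]
  exact (powMap_mulEquiv (D.gen.subtype ∘ₗ p) _).symm

/-- Induction on the length of the word, splitting off the last letter. Since θ₀ = θ₁ = id, the unit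
and the single letters are untwisted, and `mul_induces` performs the inductive step. -/
theorem twisted_hom_prodMap {A D : ConicQS k} {ω : Cochain2 k D.gen}
    {Ψ : (D.carrier ⊗[k] D.carrier) ≃ₗ[k] (D.carrier ⊗[k] D.carrier)} (hΨ : D.Induces ω Ψ)
    {U : Type*} [AddCommMonoid U] [Module k U] (p : U →ₗ[k] D.gen) {θ : Cochain1 k U}
    (hω : ∀ r s t, ω r s (TensorProduct.map (PiTensorProduct.map fun _ => p)
        (PiTensorProduct.map fun _ => p) t) =
      TensorProduct.map (PiTensorProduct.map fun _ => p) (PiTensorProduct.map fun _ => p)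
        (Cochain2.coboundary θ r s t)) (hθ0 : θ 0 = LinearEquiv.refl k _)
    (hθ1 : θ 1 = LinearEquiv.refl k _) (i : A.gen →ₗ[k] U) {g : A.carrier →ₗ[k] D.carrier}
    (hg : ∀ a : A.gen, g a = p (i a)) (hg1 : g 1 = 1)
    (hgm : ∀ x y, g (x * y) = LinearMap.mul' k D.carrier (Ψ (g x ⊗ₜ[k] g y))) (n : ℕ)
    (t : ⨂[k]^n A.gen) :
    g (A.prodMap n t) =
      powMap (D.gen.subtype ∘ₗ p) n (θ n (PiTensorProduct.map (fun _ => i) t)) := by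
  induction n with
  | zero =>
    rw [tensorPower_zero_eq_smul t]
    simp only [map_smul, prodMap_one, hg1, hθ0, LinearEquiv.refl_apply, PiTensorProduct.map_tprod,
      powMap_tprod]
    rfl
  | succ n ih =>
    obtain ⟨t, rfl⟩ := TensorPower.mulEquiv.surjective t
    induction t with
    | zero => simp
    | add x y hx hy => simp only [map_add, hx, hy]
    | tmul x y =>
    have hy : g (A.prodMap 1 y) =
        powMap (D.gen.subtype ∘ₗ p) 1 (θ 1 (PiTensorProduct.map (fun _ => i) y)) := by
      obtain ⟨a, rfl⟩ := exists_oneLetter y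
      rw [prodMap_oneLetter, hg, hθ1, LinearEquiv.refl_apply, oneLetter,
        PiTensorProduct.map_tprod]
      exact (powMap_oneLetter (D.gen.subtype ∘ₗ p) _).symm
    rw [prodMap_mulEquiv, hgm, ih x, hy, map_mulEquiv, TensorProduct.map_tmul]
    exact mul_induces hΨ p hω _ _

namespace Diag

variable {A B : ConicQS k}

/-- The map `b^j ⊗ a_i ↦ h_i^j` into the algebra `H`. -/
noncomputable def coeffMap (X : Diag A B) : Module.Dual k B.gen ⊗[k] A.gen →ₗ[k] X.right.carrier :=
  X.right.gen.subtype ∘ₗ X.coeff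

theorem coeff_tmul (X : Diag A B) (f : Module.Dual k B.gen) (a : A.gen) :
    X.coeff (f ⊗ₜ a) = TensorProduct.rid k X.right.gen
      (TensorProduct.map LinearMap.id f ((genEquiv X.right B).symm (grLinGen X.map a))) := rfl

/-- The basis-free form of φ(a_i) = Σ_j h_i^j ⊗ b_j; the expansion of b in a basis of B₁ recovers
φ(a) from its coefficients. -/
theorem map_coeff_coevMap (X : Diag A B) (a : A.gen) :
    TensorProduct.map X.coeff LinearMap.id (coevMap k A.gen B.gen a) =
      (genEquiv X.right B).symm (grLinGen X.map a) := by
  generalize hx : (genEquiv X.right B).symm (grLinGen X.map a) = x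
  rw [coevMap_apply, TensorProduct.map_map, coevTensor_eq_sum (Module.finBasis k B.gen)]
  simp only [map_sum, TensorProduct.map_tmul, LinearMap.comp_apply, LinearMap.flip_apply,
    TensorProduct.mk_apply, coeff_tmul, hx, LinearMap.id_apply]
  clear hx
  induction x with
  | zero => simp
  | add x y hx hy =>
    simp only [map_add, TensorProduct.add_tmul, Finset.sum_add_distrib, hx, hy]
  | tmul h b =>
    simp only [TensorProduct.map_tmul, TensorProduct.rid_tmul, TensorProduct.smul_tmul,
      LinearMap.id_apply, ← TensorProduct.tmul_sum]
    congr 1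
    exact (Module.finBasis k B.gen).sum_repr b

theorem circVal_map_gen (X : Diag A B) (a : A.gen) :
    circVal X.right B (grLin X.map a) =
      TensorProduct.map X.coeffMap B.gen.subtype (coevMap k A.gen B.gen a) := by
  have h : grLin X.map a = genEquiv X.right B ((genEquiv X.right B).symm (grLinGen X.map a)) := by
    rw [LinearEquiv.apply_symm_apply]
    rfl
  rw [h, circVal_genEquiv, ← map_coeff_coevMap, TensorProduct.mapIncl, TensorProduct.map_map]
  rfl

theorem coeff_eq_of_circVal {X : Diag A B} {c : Module.Dual k B.gen ⊗[k] A.gen →ₗ[k] X.right.gen}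
    (h : ∀ a : A.gen, circVal X.right B (grLin X.map a) =
      TensorProduct.map (X.right.gen.subtype ∘ₗ c) B.gen.subtype (coevMap k A.gen B.gen a)) :
    X.coeff = c := by
  refine TensorProduct.ext' fun f a => ?_
  have h1 : grLinGen X.map a =
      genEquiv X.right B (TensorProduct.map c LinearMap.id (coevMap k A.gen B.gen a)) := by
    refine gen_ext ?_
    rw [circVal_genEquiv, TensorProduct.mapIncl, TensorProduct.map_map]
    exact h a
  rw [coeff_tmul, h1, LinearEquiv.symm_apply_apply, coevMap_apply, TensorProduct.map_map,
    TensorProduct.map_map]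
  exact map_dual_coevTensor _ _

/-- `φ : A → H ∘ B` becomes multiplicative once the cocycles on `A` and `B` are removed. -/
def IsTwisted (ψ : Cochain2 k A.gen) (χ : Cochain2 k B.gen) (X : Diag A B) : Prop :=
  ∀ (n : ℕ) (s : ⨂[k]^n A.gen), circVal X.right B (grLin X.map (A.twProd ψ n s)) =
    TensorProduct.map ((pairPow X.coeffMap n).flip s) (B.twProd χ n)
      (coevTensor k (⨂[k]^n B.gen))

/-- On a twisted relation of A the left side of the defining equation vanishes. Vanishing of the
right side means that the power of h kills the functionals annihilating the kernel of the untwisted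
product of B, and that kernel is the space of twisted relations. -/
theorem IsTwisted.pairKills {ψ : Cochain2 k A.gen} {χ : Cochain2 k B.gen} {X : Diag A B}
    (h : X.IsTwisted ψ χ) (n : ℕ) :
    PairKills X.coeffMap (A.twistedRel ψ n) (B.twistedRel χ n) := by
  intro f hf s hs
  have := h n s
  rw [(A.mem_twistedRel ψ).1 hs, map_zero, map_zero] at this
  exact (map_coevTensor_eq_zero_iff _ _).1 this.symm f fun x hx => hf x ((B.mem_twistedRel χ).2 hx)

theorem circVal_coreProj (X : Diag A B)
    (x : (Module.Dual k B.gen ⊗[k] A.gen) ⊗[k] B.gen) :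
    circVal X.right B (alg (X.coreIncl ▷ B) (X.coreProj x)) =
      TensorProduct.map X.coeffMap B.gen.subtype x := by
  induction x with
  | zero => simp
  | add x y hx hy => simp only [map_add, Submodule.coe_add, hx, hy]
  | tmul u b => exact circVal_circMap X.coreIncl (𝟙 B) _

theorem circVal_core_comp (X : Diag A B) :
    ((circVal X.right B).comp (alg (X.coreIncl ▷ B))).toLinearMap ∘ₗ
      (X.core ⊗ B : ConicQS k).gen.subtype ∘ₗ X.coreProj =
      TensorProduct.map X.coeffMap B.gen.subtype :=
  LinearMap.ext fun x => X.circVal_coreProj x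

theorem coreWhisker_injective (X : Diag A B) : Function.Injective
    ((circVal X.right B).comp (alg (X.coreIncl ▷ B))) := by
  have h : Function.Injective (TensorProduct.map (alg X.coreIncl).toLinearMap
      (AlgHom.id k B.carrier).toLinearMap) :=
    TensorProduct.map_injective_of_flat_flat _ _ Subtype.val_injective Function.injective_id
  intro x y hxy
  refine circVal_injective X.core B (h ?_)
  exact (circVal_circMap X.coreIncl (𝟙 B) x).symm.trans
    (hxy.trans (circVal_circMap X.coreIncl (𝟙 B) y))

/-- The values of φ on words are forced by its values on generators through `twisted_hom_prodMap`,
and `powMap_coevProd` puts them into untwisted form. The computation happens in H ⊗ B, into which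
the core embeds. -/
theorem isTwisted_of_inOmega {ψ : Cochain2 k A.gen} {χ : Cochain2 k B.gen} (hψ : ψ.IsZ2)
    (hχ : χ.IsZ2) {X : Diag A B} (h : X.InOmega ((χ.dual.prod ψ).prod Cochain2.one)) :
    X.IsTwisted ψ χ := by
  obtain ⟨θ, hθ⟩ : ∃ θ, θ = Cochain1.coevProd χ.primitive ψ.primitive := ⟨_, rfl⟩
  have hθ0 : θ 0 = LinearEquiv.refl k _ := by
    rw [hθ]
    exact coevProd_eq_refl (Cochain2.primitive_zero χ) (Cochain2.primitive_zero ψ)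
  have hθ1 : θ 1 = LinearEquiv.refl k _ := by
    rw [hθ]
    exact coevProd_eq_refl (Cochain2.primitive_one hχ) (Cochain2.primitive_one hψ)
  rw [dual_prod_prod_one_eq hχ hψ, ← hθ] at h
  obtain ⟨ω', _, hω', Ψ, hΨ, g, hg, hg1, hgm⟩ := h
  have hgX : ∀ x, circVal X.right B (grLin X.map x) =
      circVal X.right B (alg (X.coreIncl ▷ B) (grLin g x)) := fun x => by
    rw [← hg]
    rfl
  have hg_gen : ∀ a : A.gen, grLin g a =
      (X.coreProj (coevMap k A.gen B.gen a) : (X.core ⊗ B : ConicQS k).carrier) := by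
    intro a
    refine X.coreWhisker_injective ?_
    exact (hgX a).symm.trans ((X.circVal_map_gen a).trans (X.circVal_coreProj _).symm)
  have key := twisted_hom_prodMap (A := A) (D := X.core ⊗ B) hΨ X.coreProj hω' hθ0
    hθ1 (coevMap k A.gen B.gen) hg_gen hg1 hgm
  intro n s
  obtain ⟨t, rfl⟩ := (ψ.primitive n).surjective s
  rw [A.twProd_primitive, hgX, key]
  have := algHom_powMap ((circVal X.right B).comp (alg (X.coreIncl ▷ B)))
    ((X.core ⊗ B : ConicQS k).gen.subtype ∘ₗ X.coreProj) n
    (θ n (PiTensorProduct.map (fun _ => coevMap k A.gen B.gen) t))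
  refine this.trans ?_
  rw [circVal_core_comp, hθ, powMap_coevProd]
  rfl

end Diag

end ConicQS

/-! ### Constructing twisted maps from coefficients and proving membership in Ω -/

namespace ConicQS

variable {k : Type u} [Field k] {A B : ConicQS k}

/-- The converse use of `map_coevTensor_eq_zero_iff`: the relations imposed on H make the
prescription for φ well defined on A. -/
theorem pairPow_flip_coev_eq_zero {R : Type*} [Ring R] [Algebra k R] {ψ : Cochain2 k A.gen}
    {χ : Cochain2 k B.gen} {h : Module.Dual k B.gen ⊗[k] A.gen →ₗ[k] R} {n : ℕ}
    (hk : PairKills h (A.twistedRel ψ n) (B.twistedRel χ n)) {t : ⨂[k]^n A.gen}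
    (ht : A.prodMap n t = 0) :
    TensorProduct.map ((pairPow h n).flip (ψ.primitive n t)) (B.twProd χ n)
      (coevTensor k (⨂[k]^n B.gen)) = 0 :=
  (map_coevTensor_eq_zero_iff _ _).2 fun f hf => hk f
    (fun x hx => hf x ((B.mem_twistedRel χ).1 hx)) _
    ((A.mem_twistedRel ψ).2 (by rw [twProd_primitive, ht]))

theorem circVal_prodMap (H B : ConicQS k) {U : Type*} [AddCommMonoid U] [Module k U]
    (c : U →ₗ[k] H.gen) (n : ℕ) (x : ⨂[k]^n (U ⊗[k] B.gen)) :
    circVal H B ((circ H B).prodMap n (PiTensorProduct.map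
      (fun _ => (genEquiv H B).toLinearMap ∘ₗ TensorProduct.map c LinearMap.id) x)) =
      powMap (TensorProduct.map (H.gen.subtype ∘ₗ c) B.gen.subtype) n x := by
  rw [prodMap_eq_powMap, algHom_powMap, ← LinearMap.comp_apply, ← powMap_comp]
  congr 1
  congr 1
  refine TensorProduct.ext' fun u b => ?_
  exact circVal_genEquiv_tmul H B (c u) b

/-- A linear map `B₁* ⊗ A₁ → H₁` respecting the untwisted relations gives a twisted morphism
`A → H ∘ B`. -/
theorem exists_isTwisted {ψ : Cochain2 k A.gen} {χ : Cochain2 k B.gen} (hψ : ψ.IsZ2)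
    (hχ : χ.IsZ2) (H : ConicQS k) (c : Module.Dual k B.gen ⊗[k] A.gen →ₗ[k] H.gen)
    (hk : ∀ n, PairKills (H.gen.subtype ∘ₗ c) (A.twistedRel ψ n) (B.twistedRel χ n)) :
    ∃ φ : (forgetGr k).obj A ⟶ (tensorRight B ⋙ forgetGr k).obj H,
      Diag.coeff (StructuredArrow.mk φ : Diag A B) = c ∧
      Diag.IsTwisted ψ χ (StructuredArrow.mk φ : Diag A B) := by
  -- The only possible formula: coevaluate each letter, twist the word, replace the coefficients by
  -- their images under c, and multiply in H ∘ B.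
  obtain ⟨φ, hφ⟩ := exists_grHom (A := A) (D := circ H B)
    (fun n => PiTensorProduct.map
      (fun _ => (genEquiv H B).toLinearMap ∘ₗ TensorProduct.map c LinearMap.id) ∘ₗ
        (Cochain1.coevProd χ.primitive ψ.primitive n).toLinearMap ∘ₗ
          PiTensorProduct.map fun _ => coevMap k A.gen B.gen) (by
      intro n t ht
      refine circVal_injective H B ?_
      rw [LinearMap.comp_apply, circVal_prodMap, map_zero]
      exact (powMap_coevProd _ _ _ _ t).trans (pairPow_flip_coev_eq_zero (hk n) ht))
  have hφ' : ∀ n t, circVal H B (grLin φ (A.prodMap n t)) =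
      TensorProduct.map ((pairPow (H.gen.subtype ∘ₗ c) n).flip (ψ.primitive n t)) (B.twProd χ n)
        (coevTensor k (⨂[k]^n B.gen)) := fun n t => by
    rw [hφ, LinearMap.comp_apply, circVal_prodMap]
    exact powMap_coevProd _ _ _ _ t
  have hc : Diag.coeff (StructuredArrow.mk φ : Diag A B) = c := by
    refine Diag.coeff_eq_of_circVal fun a => ?_
    change circVal H B (grLin φ a) = _
    -- In degree one both primitives are the identity, so the coefficients of φ are c itself,
    -- without any twist.
    have h1 := hφ 1 (oneLetter a)
    rw [prodMap_oneLetter, LinearMap.comp_apply] at h1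
    rw [h1, circVal_prodMap, LinearMap.comp_apply, coevProd_eq_refl (Cochain2.primitive_one hχ)
      (Cochain2.primitive_one hψ), oneLetter, PiTensorProduct.map_tprod]
    exact powMap_oneLetter _ _
  refine ⟨φ, hc, fun n s => ?_⟩
  obtain ⟨t, rfl⟩ := (ψ.primitive n).surjective s
  rw [twProd_primitive, Diag.coeffMap, hc]
  exact hφ' n t

end ConicQS

/-- Grouping the U-letters and the W-letters separately, the evaluation becomes (h^r ⊗ h^s) ⊗ (g^r ⊗
g^s). There the cocycle acts on the first factor only, and it is intertwined with Φ ⊗ id. -/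
theorem map_prod_one_eq_zero {k : Type*} [Field k] {U W : Type*} [AddCommMonoid U] [Module k U]
    [AddCommMonoid W] [Module k W] {R S : Type*} [Ring R] [Algebra k R] [Ring S] [Algebra k S]
    {h : U →ₗ[k] R} {g : W →ₗ[k] S} {χ : Cochain2 k U} {r s : ℕ}
    (hχ : ∃ Φ : R ⊗[k] R →ₗ[k] R ⊗[k] R, Φ ∘ₗ TensorProduct.map (powMap h r) (powMap h s) =
      TensorProduct.map (powMap h r) (powMap h s) ∘ₗ (χ r s).toLinearMap)
    (t : ⨂[k]^r (U ⊗[k] W) ⊗[k] ⨂[k]^s (U ⊗[k] W))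
    (ht : TensorProduct.map (powMap (TensorProduct.map h g) r) (powMap (TensorProduct.map h g) s) t
      = 0) :
    TensorProduct.map (powMap (TensorProduct.map h g) r) (powMap (TensorProduct.map h g) s)
      (χ.prod Cochain2.one r s t) = 0 := by
  obtain ⟨Φ, hΦ⟩ := hχ
  let T := TensorProduct.tensorTensorTensorComm k (⨂[k]^r U) (⨂[k]^s U) (⨂[k]^r W) (⨂[k]^s W)
  let T' := TensorProduct.tensorTensorTensorComm k R R S S
  obtain ⟨z, rfl⟩ : ∃ z, t = TensorProduct.map (tensorPowerZip r) (tensorPowerZip s) (T z) := by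
    obtain ⟨z, hz⟩ := (TensorProduct.congr (tensorPowerShuffle r) (tensorPowerShuffle s)).surjective t
    exact ⟨T.symm z, by rw [LinearEquiv.apply_symm_apply, ← hz]; rfl⟩
  have h1 : ∀ z, TensorProduct.map (powMap (TensorProduct.map h g) r)
      (powMap (TensorProduct.map h g) s)
      (TensorProduct.map (tensorPowerZip r) (tensorPowerZip s) (T z)) =
      T' (TensorProduct.map (TensorProduct.map (powMap h r) (powMap h s))
        (TensorProduct.map (powMap g r) (powMap g s)) z) := by
    intro z
    induction z with
    | zero => simp
    | add x y hx hy => simp only [map_add, hx, hy]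
    | tmul u w =>
    induction u with
    | zero => simp
    | add x y hx hy => simp only [TensorProduct.add_tmul, map_add, hx, hy]
    | tmul u u' =>
    induction w with
    | zero => simp
    | add x y hx hy => simp only [TensorProduct.tmul_add, map_add, hx, hy]
    | tmul w w' =>
      simp only [T, T', TensorProduct.tensorTensorTensorComm_tmul, TensorProduct.map_tmul,
        powMap_map_zip]
  have h2 : ∀ z, χ.prod Cochain2.one r s
      (TensorProduct.map (tensorPowerZip r) (tensorPowerZip s) (T z)) =
      TensorProduct.map (tensorPowerZip r) (tensorPowerZip s)
        (T (TensorProduct.map (χ r s).toLinearMap LinearMap.id z)) := by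
    intro z
    induction z with
    | zero => simp
    | add x y hx hy => simp only [map_add, hx, hy]
    | tmul u w => exact Cochain2.prod_shuffle _ _ _ _
  have h3 : TensorProduct.map (TensorProduct.map (powMap h r) (powMap h s))
      (TensorProduct.map (powMap g r) (powMap g s)) z = 0 := by
    rw [h1] at ht
    exact (map_eq_zero_iff _ T'.injective).1 ht
  rw [h2, h1, TensorProduct.map_map, ← hΦ, LinearMap.comp_id,
    ← LinearMap.id_comp (TensorProduct.map (powMap g r) (powMap g s)), ← TensorProduct.map_map,
    h3, map_zero, map_zero]

namespace ConicQS

variable {k : Type u} [Field k]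

/-- All identities are verified after the injection κ, in coordinates Y ≃ D₁. The cocycle ω' exists
for free as the coboundary of a conjugate of θ; `hdesc` yields Ψ and `hwd` yields the map g. -/
theorem exists_twist_data {A D : ConicQS k} {Y : Type*} [AddCommMonoid Y] [Module k Y]
    (p : Y ≃ₗ[k] D.gen) {θ : Cochain1 k Y} (hθ : θ 0 = LinearEquiv.refl k _) (i : A.gen →ₗ[k] Y)
    {T : Type*} [Ring T] [Algebra k T] {κ : D.carrier →ₐ[k] T} (hκ : Function.Injective κ)
    {q : Y →ₗ[k] T} (hq : κ.toLinearMap ∘ₗ D.gen.subtype ∘ₗ p.toLinearMap = q)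
    (hdesc : ∀ r s t, TensorProduct.map (powMap q r) (powMap q s) t = 0 →
      TensorProduct.map (powMap q r) (powMap q s) (Cochain2.coboundary θ r s t) = 0)
    (hwd : ∀ n t, A.prodMap n t = 0 →
      powMap q n (θ n (PiTensorProduct.map (fun _ => i) t)) = 0) :
    ∃ ω : Cochain2 k D.gen, ω.IsZ2 ∧
      (∀ r s t, ω r s (TensorProduct.map (PiTensorProduct.map fun _ => p.toLinearMap)
          (PiTensorProduct.map fun _ => p.toLinearMap) t) =
        TensorProduct.map (PiTensorProduct.map fun _ => p.toLinearMap)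
          (PiTensorProduct.map fun _ => p.toLinearMap) (Cochain2.coboundary θ r s t)) ∧
      ∃ Ψ, D.Induces ω Ψ ∧ ∃ g : (forgetGr k).obj A ⟶ (forgetGr k).obj D,
        (∀ n t, κ (grLin g (A.prodMap n t)) =
          powMap q n (θ n (PiTensorProduct.map (fun _ => i) t))) ∧
        grLin g 1 = 1 ∧
        ∀ x y : A.carrier, grLin g (x * y) =
          LinearMap.mul' k D.carrier (Ψ (grLin g x ⊗ₜ[k] grLin g y)) := by
  let P : ∀ n, ⨂[k]^n Y ≃ₗ[k] ⨂[k]^n D.gen := fun n => PiTensorProduct.congr fun _ => p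
  have hP : ∀ n y, P n y = PiTensorProduct.map (fun _ => p.toLinearMap) y := fun n y => rfl
  -- Transporting the primitive rather than the cocycle keeps the result a visible coboundary, hence
  -- a counital cocycle.
  let η : Cochain1 k D.gen := fun n => (P n).symm ≪≫ₗ θ n ≪≫ₗ P n
  have hη : ∀ n x, PiTensorProduct.map (fun _ => p.toLinearMap) (θ n x) =
      η n (PiTensorProduct.map (fun _ => p.toLinearMap) x) := fun n x => by
    simp [η, ← hP]
  have hη0 : η 0 = LinearEquiv.refl k _ := by
    ext x
    simp [η, hθ]
  have hpow : ∀ n y, κ (D.prodMap n (PiTensorProduct.map (fun _ => p.toLinearMap) y)) =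
      powMap q n y := fun n y => by
    rw [prodMap_eq_powMap, algHom_powMap, ← LinearMap.comp_apply, ← powMap_comp, ← hq]
    rfl
  have hnat := Cochain2.coboundary_naturality p.toLinearMap θ η hη
  have hκκ : Function.Injective (TensorProduct.map κ.toLinearMap κ.toLinearMap) :=
    TensorProduct.map_injective_of_flat_flat _ _ hκ hκ
  have hpow2 : ∀ r s t, TensorProduct.map κ.toLinearMap κ.toLinearMap
      (TensorProduct.map (D.prodMap r) (D.prodMap s)
        (TensorProduct.map (PiTensorProduct.map fun _ => p.toLinearMap)
          (PiTensorProduct.map fun _ => p.toLinearMap) t)) =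
      TensorProduct.map (powMap q r) (powMap q s) t := fun r s t => by
    rw [TensorProduct.map_map, TensorProduct.map_map]
    congr 2
    · exact LinearMap.ext (hpow r)
    · exact LinearMap.ext (hpow s)
  obtain ⟨Ψ, hΨ⟩ := exists_induces D (Cochain2.coboundary η) fun r s t ht => by
    obtain ⟨t, rfl⟩ := (TensorProduct.congr (P r) (P s)).surjective t
    change TensorProduct.map _ _ (Cochain2.coboundary η r s
      (TensorProduct.map (PiTensorProduct.map fun _ => p.toLinearMap)
        (PiTensorProduct.map fun _ => p.toLinearMap) t)) = 0
    refine hκκ ?_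
    rw [hnat, hpow2, map_zero]
    refine hdesc r s t ?_
    rw [← hpow2]
    exact (congrArg _ ht).trans (map_zero _)
  obtain ⟨g, hg⟩ := exists_grHom (A := A) (D := D) (fun n =>
    PiTensorProduct.map (fun _ => p.toLinearMap) ∘ₗ (θ n).toLinearMap ∘ₗ
      PiTensorProduct.map fun _ => i) fun n t ht => hκ (by
        rw [LinearMap.comp_apply, hpow, map_zero]
        exact hwd n t ht)
  have hgp : ∀ n t, grLin g (A.prodMap n t) = powMap (D.gen.subtype ∘ₗ p.toLinearMap) n
      (θ n (PiTensorProduct.map (fun _ => i) t)) := fun n t => by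
    rw [hg, powMap_comp]
    rfl
  refine ⟨Cochain2.coboundary η, Cochain2.coboundary_isZ2 η hη0, hnat, Ψ, hΨ, g, ?_, ?_, ?_⟩
  · intro n t
    rw [hg, LinearMap.comp_apply, hpow]
    rfl
  · rw [← A.prodMap_one, hgp, hθ, LinearEquiv.refl_apply, PiTensorProduct.map_tprod, powMap_tprod]
    rfl
  -- Both sides are linear on A ⊗ A, so it suffices to compare them on pairs of words, where
  -- `mul_induces` applies.
  · have : grLin g ∘ₗ LinearMap.mul' k A.carrier = LinearMap.mul' k D.carrier ∘ₗ Ψ.toLinearMap ∘ₗ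
        TensorProduct.map (grLin g) (grLin g) := by
      refine tensor_ext_prodMap fun r s t => ?_
      induction t with
      | zero => simp
      | add x y hx hy => simp only [map_add, hx, hy]
      | tmul x y =>
      rw [LinearMap.comp_apply, TensorProduct.map_tmul, LinearMap.mul'_apply, ← prodMap_mulEquiv,
        hgp, map_mulEquiv, TensorProduct.map_tmul, ← mul_induces hΨ p.toLinearMap hnat, ← hgp,
        ← hgp]
      rfl
    intro x y
    exact LinearMap.congr_fun this (x ⊗ₜ y)

theorem exists_twist_data_tensor {A D : ConicQS k} {U W R S : Type*} [AddCommMonoid U] [Module k U]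
    [AddCommMonoid W] [Module k W] [Ring R] [Algebra k R] [Ring S] [Algebra k S]
    {h : U →ₗ[k] R} {f : W →ₗ[k] S} {χ : Cochain2 k U}
    (hχ : ∀ r s, ∃ Φ : R ⊗[k] R →ₗ[k] R ⊗[k] R, Φ ∘ₗ TensorProduct.map (powMap h r) (powMap h s) =
      TensorProduct.map (powMap h r) (powMap h s) ∘ₗ (χ r s).toLinearMap)
    (p : U ⊗[k] W ≃ₗ[k] D.gen) {θ : Cochain1 k (U ⊗[k] W)} (hθ : θ 0 = LinearEquiv.refl k _)
    (hθχ : χ.prod Cochain2.one = Cochain2.coboundary θ) (i : A.gen →ₗ[k] U ⊗[k] W)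
    {κ : D.carrier →ₐ[k] R ⊗[k] S} (hκ : Function.Injective κ)
    (hq : κ.toLinearMap ∘ₗ D.gen.subtype ∘ₗ p.toLinearMap = TensorProduct.map h f)
    (hwd : ∀ n t, A.prodMap n t = 0 →
      powMap (TensorProduct.map h f) n (θ n (PiTensorProduct.map (fun _ => i) t)) = 0) :
    ∃ ω : Cochain2 k D.gen, ω.IsZ2 ∧
      (∀ r s t, ω r s (TensorProduct.map (PiTensorProduct.map fun _ => p.toLinearMap)
          (PiTensorProduct.map fun _ => p.toLinearMap) t) =
        TensorProduct.map (PiTensorProduct.map fun _ => p.toLinearMap)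
          (PiTensorProduct.map fun _ => p.toLinearMap) (χ.prod Cochain2.one r s t)) ∧
      ∃ Ψ, D.Induces ω Ψ ∧ ∃ g : (forgetGr k).obj A ⟶ (forgetGr k).obj D,
        (∀ n t, κ (grLin g (A.prodMap n t)) =
          powMap (TensorProduct.map h f) n (θ n (PiTensorProduct.map (fun _ => i) t))) ∧
        grLin g 1 = 1 ∧
        ∀ x y : A.carrier, grLin g (x * y) =
          LinearMap.mul' k D.carrier (Ψ (grLin g x ⊗ₜ[k] grLin g y)) :=
by
  have hdesc := fun r s t => map_prod_one_eq_zero (g := f) (hχ r s) t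
  rw [hθχ] at hdesc ⊢
  exact exists_twist_data p hθ i hκ hq hdesc hwd

end ConicQS

namespace ConicQS

variable {k : Type u} [Field k] {A B : ConicQS k}

theorem preserves_twistedRel {ψ : Cochain2 k A.gen} (hψ : ψ.IsZ2)
    (h : A.SecondAdmissible ψ.inv) : ψ.Preserves (A.twistedRel ψ) :=
  twistedIdeal_stable hψ h

theorem twistedRel_zero (A : ConicQS k) (ψ : Cochain2 k A.gen) : A.twistedRel ψ 0 = ⊥ := by
  rw [twistedRel, rel_zero, Submodule.map_bot]

theorem twistedRel_one (A : ConicQS k) (ψ : Cochain2 k A.gen) : A.twistedRel ψ 1 = ⊥ := by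
  rw [twistedRel, rel_one, Submodule.map_bot]

namespace Diag

theorem coreCoeff_surjective (X : Diag A B) : Function.Surjective X.coreCoeff := by
  rintro ⟨⟨x, hx⟩, hx'⟩
  obtain ⟨_, ⟨u, rfl⟩, hu⟩ := (show x ∈ X.coeffSpace from hx')
  exact ⟨u, Subtype.ext (Subtype.ext hu)⟩

theorem coreCoeff_injective {X : Diag A B} (h : Function.Injective X.coeff) :
    Function.Injective X.coreCoeff := fun _ _ hxy =>
  h (Subtype.ext (congrArg (fun z : X.core.gen => alg X.coreIncl z) hxy))

theorem coreProj_bijective {X : Diag A B} (h : Function.Injective X.coeff) :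
    Function.Bijective X.coreProj :=
  (genEquiv X.core B).bijective.comp (LinearEquiv.bijective (TensorProduct.congr
    (LinearEquiv.ofBijective X.coreCoeff ⟨coreCoeff_injective h, X.coreCoeff_surjective⟩)
    (LinearEquiv.refl k B.gen)))

/-- A partial converse of `isTwisted_of_inOmega`. Independence of the coefficients makes π^φ ⊗ 𝕀
bijective, so ω descends to generators by transport. That it also induces an automorphism needs
admissibility together with `hker`, by which H has no relations beyond the forced ones. -/
theorem inOmega_of_isTwisted {ψ : Cochain2 k A.gen} {χ : Cochain2 k B.gen} (hψ : ψ.IsZ2)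
    (hχ : χ.IsZ2) (hψA : A.SecondAdmissible ψ.inv) (hχB : B.SecondAdmissible χ.inv) {X : Diag A B}
    (hX : X.IsTwisted ψ χ) (hinj : Function.Injective X.coeff)
    (hker : ∀ n x, powMap X.coeffMap n x = 0 →
      x ∈ relSpan (pairRel (A.twistedRel ψ) (B.twistedRel χ)) n) :
    X.InOmega ((χ.dual.prod ψ).prod Cochain2.one) := by
  have hpow : ∀ n t, powMap (TensorProduct.map X.coeffMap B.gen.subtype) n
      (Cochain1.coevProd χ.primitive ψ.primitive n
        (PiTensorProduct.map (fun _ => coevMap k A.gen B.gen) t)) =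
      circVal X.right B (grLin X.map (A.prodMap n t)) := fun n t => by
    rw [powMap_coevProd, ← A.twProd_primitive ψ, hX n]
    rfl
  have hdesc := exists_descent hX.pairKills hker (preserves_twistedRel hχ hχB)
    (preserves_twistedRel hψ hψA)
  have hθ0 := coevProd_eq_refl (Cochain2.primitive_zero χ) (Cochain2.primitive_zero ψ)
  have hωθ := dual_prod_prod_one_eq hχ hψ
  have hwd : ∀ n t, A.prodMap n t = 0 → powMap (TensorProduct.map X.coeffMap B.gen.subtype) n
      (Cochain1.coevProd χ.primitive ψ.primitive n
        (PiTensorProduct.map (fun _ => coevMap k A.gen B.gen) t)) = 0 := fun n t ht => by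
    rw [hpow, ht, map_zero, map_zero]
  have := exists_twist_data_tensor
    (A := A) (D := X.core ⊗ B) hdesc
    (LinearEquiv.ofBijective X.coreProj (coreProj_bijective hinj))
    hθ0 hωθ
    (coevMap k A.gen B.gen) X.coreWhisker_injective X.circVal_core_comp hwd
  obtain ⟨ω', hω', hω, Ψ, hΨ, g, hg, hg1, hgm⟩ := this
  refine ⟨ω', hω', hω, Ψ, hΨ, g, ?_, hg1, hgm⟩
  refine grHom_ext (A := A) (D := X.right ⊗ B) fun n t => ?_
  exact circVal_injective X.right B ((hg n t).trans (hpow n t))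

end Diag

end ConicQS

/-! ### Universal pairs and initial objects of Ω -/

namespace ConicQS

theorem le_relSpan {k : Type*} [Field k] {U : Type*} [AddCommMonoid U] [Module k U]
    (S : ∀ n, Submodule k (⨂[k]^n U)) (n : ℕ) : S n ≤ relSpan S n := by
  intro x hx
  refine Submodule.subset_span ⟨0, n, 0, zero_add n, PiTensorProduct.tprod k Fin.elim0, x,
    PiTensorProduct.tprod k Fin.elim0, hx, ?_⟩
  rw [mulEquiv_one, one_mulEquiv, TensorPower.cast_cast, TensorPower.cast_refl]
  rfl

variable {k : Type u} [Field k]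

theorem exists_presentation {U : Type u} [AddCommMonoid U] [Module k U] [Module.Finite k U]
    {S : ∀ n, Submodule k (⨂[k]^n U)} (h0 : S 0 = ⊥) (h1 : S 1 = ⊥) :
    ∃ (H : ConicQS k) (c : U →ₗ[k] H.gen), Function.Bijective c ∧
      (∀ n x, powMap (H.gen.subtype ∘ₗ c) n x = 0 ↔ x ∈ relSpan S n) ∧
      ∀ (R : Type u) [Ring R] [Algebra k R] (f : U →ₗ[k] R),
        (∀ n, ∀ x ∈ S n, powMap f n x = 0) →
          ∃ φ : H.carrier →ₐ[k] R, ∀ u, φ (c u) = f u := by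
  let := Module.addCommMonoidToAddCommGroup k (M := U)
  refine ⟨presented S h0, LinearMap.codRestrict _ (presentedι S h0) fun u =>
    range_presentedι S h0 ▸ LinearMap.mem_range_self _ u, ⟨?_, ?_⟩,
    fun n x => powMap_presentedι_eq_zero_iff S h0, fun R _ _ f => exists_presented_lift S h0 f⟩
  · intro x y hxy
    exact presentedι_injective S h0 h1 (congrArg Subtype.val hxy)
  · rintro ⟨x, hx⟩
    rw [← range_presentedι S h0] at hx
    obtain ⟨u, rfl⟩ := hx
    exact ⟨u, rfl⟩

variable {A B : ConicQS k}

namespace Diag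

theorem circVal_tensorRight {H H' : ConicQS k} (f : H ⟶ H') (x : (H ⊗ B : ConicQS k).carrier) :
    circVal H' B (grLin ((tensorRight B ⋙ forgetGr k).map f) x) =
      TensorProduct.map (alg f).toLinearMap LinearMap.id (circVal H B x) :=
  circVal_circMap f (𝟙 B) x

theorem circVal_hom {X Y : Diag A B} (f : X ⟶ Y) (x : A.carrier) :
    circVal Y.right B (grLin Y.map x) =
      TensorProduct.map (alg f.right).toLinearMap LinearMap.id
        (circVal X.right B (grLin X.map x)) := by
  rw [← circVal_tensorRight]
  have h := StructuredArrow.w f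
  change circVal Y.right B (grLin Y.hom x) = _
  rw [← h]
  rfl

theorem coeff_hom {X Y : Diag A B} (f : X ⟶ Y) (u : Module.Dual k B.gen ⊗[k] A.gen) :
    Y.coeff u = genMap f.right (X.coeff u) := by
  have h : Y.coeff = genMap f.right ∘ₗ X.coeff := coeff_eq_of_circVal fun a => by
    rw [circVal_hom f, circVal_map_gen, TensorProduct.map_map]
    rfl
  rw [h]
  rfl

theorem coeffMap_hom {X Y : Diag A B} (f : X ⟶ Y) (u : Module.Dual k B.gen ⊗[k] A.gen) :
    alg f.right (X.coeffMap u) = Y.coeffMap u :=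
  congrArg Subtype.val (coeff_hom f u).symm

/-- The characterization of the initial objects: `φ` is twisted, the coefficients of `φ` form a basis
of the generators of `H`, and the relations of `H` are those that make `φ` well-defined. -/
structure IsUniversal (ψ : Cochain2 k A.gen) (χ : Cochain2 k B.gen) (X : Diag A B) : Prop where
  isTwisted : X.IsTwisted ψ χ
  bijective : Function.Bijective X.coeff
  lift : ∀ (R : Type u) [Ring R] [Algebra k R] (f : Module.Dual k B.gen ⊗[k] A.gen →ₗ[k] R),
    (∀ n, PairKills f (A.twistedRel ψ n) (B.twistedRel χ n)) →
      ∃ φ : X.right.carrier →ₐ[k] R, ∀ u, φ (X.coeffMap u) = f u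

/-- Take the generators B₁* ⊗ A₁ and the annihilator relations built from the twisted relations of A
and B. These are zero in degrees 0 and 1, so the quotient is nonzero and no generator is lost. -/
theorem exists_isUniversal {ψ : Cochain2 k A.gen} {χ : Cochain2 k B.gen} (hψ : ψ.IsZ2)
    (hχ : χ.IsZ2) (hψA : A.SecondAdmissible ψ.inv) (hχB : B.SecondAdmissible χ.inv) :
    ∃ X : Diag A B, X.IsUniversal ψ χ ∧ X.InOmega ((χ.dual.prod ψ).prod Cochain2.one) := by
  have h0 : pairRel (A.twistedRel ψ) (B.twistedRel χ) 0 = ⊥ :=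
    pairRel_eq_bot _ (A.twistedRel_zero ψ)
  have h1 : pairRel (A.twistedRel ψ) (B.twistedRel χ) 1 = ⊥ :=
    pairRel_eq_bot _ (A.twistedRel_one ψ)
  obtain ⟨H, c, hc, hker, hlift⟩ := exists_presentation h0 h1
  obtain ⟨φ, hφ, hX⟩ := exists_isTwisted hψ hχ H c fun n => by
    rw [pairKills_iff]
    exact fun x hx => (hker n x).2 (le_relSpan _ n hx)
  have hcX : coeffMap (StructuredArrow.mk φ : Diag A B) = H.gen.subtype ∘ₗ c := by
    rw [coeffMap, hφ]
    rfl
  have hbij : Function.Bijective (coeff (StructuredArrow.mk φ : Diag A B)) := by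
    rw [hφ]
    exact hc
  refine ⟨StructuredArrow.mk φ, ⟨hX, hbij, fun R _ _ f hf => ?_⟩,
    inOmega_of_isTwisted hψ hχ hψA hχB hX hbij.1 fun n x hx => ?_⟩
  · rw [hcX]
    exact hlift R f fun n => (pairKills_iff f n).1 (hf n)
  · rw [hcX] at hx
    exact (hker n x).1 hx

theorem IsUniversal.exists_lift {ψ : Cochain2 k A.gen} {χ : Cochain2 k B.gen} {X : Diag A B}
    (hX : X.IsUniversal ψ χ) {H : ConicQS k} (c : Module.Dual k B.gen ⊗[k] A.gen →ₗ[k] H.gen)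
    (hc : ∀ n, PairKills (H.gen.subtype ∘ₗ c) (A.twistedRel ψ n) (B.twistedRel χ n)) :
    ∃ f : X.right ⟶ H, ∀ u, genMap f (X.coeff u) = c u := by
  obtain ⟨φ, hφ⟩ := hX.lift H.carrier (H.gen.subtype ∘ₗ c) hc
  refine ⟨⟨φ, fun x hx => ?_⟩, fun u => Subtype.ext (hφ u)⟩
  obtain ⟨u, hu⟩ := hX.bijective.2 ⟨x, hx⟩
  have : x = X.coeffMap u := congrArg Subtype.val hu.symm
  rw [this, hφ]
  exact (c u).2

theorem IsUniversal.hom_ext {ψ : Cochain2 k A.gen} {χ : Cochain2 k B.gen} {X : Diag A B}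
    (hX : X.IsUniversal ψ χ) {H : ConicQS k} {f g : X.right ⟶ H}
    (h : ∀ u, genMap f (X.coeff u) = genMap g (X.coeff u)) : f = g :=
  ConicQS.hom_ext fun x => by
    obtain ⟨u, rfl⟩ := hX.bijective.2 x
    exact h u

theorem IsUniversal.of_iso {ψ : Cochain2 k A.gen} {χ : Cochain2 k B.gen} {X Y : Diag A B}
    (hX : X.IsUniversal ψ χ) (e : X ≅ Y) (hY : Y.IsTwisted ψ χ) : Y.IsUniversal ψ χ where
  isTwisted := hY
  bijective := by
    constructor
    · intro u v h
      refine hX.bijective.1 ?_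
      rw [coeff_hom e.inv, h, coeff_hom e.inv]
    · intro y
      obtain ⟨u, hu⟩ := hX.bijective.2 (genMap e.inv.right y)
      refine ⟨u, ?_⟩
      rw [coeff_hom e.hom, hu, ← LinearMap.comp_apply, ← genMap_comp, ← StructuredArrow.comp_right,
        e.inv_hom_id]
      rfl
  lift R _ _ f hf := by
    obtain ⟨φ, hφ⟩ := hX.lift R f hf
    refine ⟨φ.comp (alg e.inv.right), fun u => ?_⟩
    rw [AlgHom.comp_apply, coeffMap_hom, hφ]

/-- A twisted map is recovered from its coefficients by the defining equation, because the untwisted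
products of words span A. Agreement of the coefficients is thus enough for the triangle to commute.
-/
theorem IsTwisted.comp {ψ : Cochain2 k A.gen} {χ : Cochain2 k B.gen} {X Y : Diag A B}
    (hX : X.IsTwisted ψ χ) (hY : Y.IsTwisted ψ χ) (f : X.right ⟶ Y.right)
    (hf : ∀ u, genMap f (X.coeff u) = Y.coeff u) :
    X.hom ≫ (tensorRight B ⋙ forgetGr k).map f = Y.hom := by
  have hfu : (alg f).toLinearMap ∘ₗ X.coeffMap = Y.coeffMap :=
    LinearMap.ext fun u => congrArg Subtype.val (hf u)
  refine GrVct.Hom.ext (linearMap_ext_twProd (A := A) ψ fun n s => ?_)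
  refine circVal_injective Y.right B ?_
  refine (circVal_tensorRight f (grLin X.map (A.twProd ψ n s))).trans ?_
  refine Eq.trans ?_ (hY n s).symm
  rw [hX n s, TensorProduct.map_map, LinearMap.id_comp]
  congr 2
  refine LinearMap.ext fun g => ?_
  rw [← hfu]
  exact algHom_pairPow (alg f) X.coeffMap g s

/-- An object of Ω is twisted, so its coefficients satisfy the defining relations and a morphism
exists. It is unique since a morphism carries coefficients to coefficients and these exhaust the
generators of the source. -/
theorem IsUniversal.isInitial {ψ : Cochain2 k A.gen} {χ : Cochain2 k B.gen} (hψ : ψ.IsZ2)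
    (hχ : χ.IsZ2) {X : Omega A B ((χ.dual.prod ψ).prod Cochain2.one)}
    (hX : X.obj.IsUniversal ψ χ) : Nonempty (Limits.IsInitial X) := by
  have hex : ∀ Y : Omega A B ((χ.dual.prod ψ).prod Cochain2.one), Nonempty (X ⟶ Y) := fun Y => by
    have hY := isTwisted_of_inOmega hψ hχ Y.property
    obtain ⟨f, hf⟩ := hX.exists_lift Y.obj.coeff hY.pairKills
    exact ⟨ObjectProperty.homMk (StructuredArrow.homMk f (hX.isTwisted.comp hY f hf))⟩
  refine ⟨Limits.IsInitial.ofUniqueHom (fun Y => (hex Y).some) fun Y m => ?_⟩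
  refine ObjectProperty.hom_ext _ (StructuredArrow.ext _ _ (hX.hom_ext fun u => ?_))
  rw [← coeff_hom, ← coeff_hom]

/-- The constructed pair is initial, and any other initial object is isomorphic to it; the universal
properties pass along the isomorphism. -/
theorem isUniversal_of_isInitial {ψ : Cochain2 k A.gen} {χ : Cochain2 k B.gen} (hψ : ψ.IsZ2)
    (hχ : χ.IsZ2) (hψA : A.SecondAdmissible ψ.inv) (hχB : B.SecondAdmissible χ.inv)
    {Y : Omega A B ((χ.dual.prod ψ).prod Cochain2.one)} (hY : Limits.IsInitial Y) :
    Y.obj.IsUniversal ψ χ := by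
  obtain ⟨X, hX, hXΩ⟩ := exists_isUniversal hψ hχ hψA hχB
  obtain ⟨hi⟩ := IsUniversal.isInitial hψ hχ
    (X := (⟨X, hXΩ⟩ : Omega A B ((χ.dual.prod ψ).prod Cochain2.one))) hX
  exact hX.of_iso ((ObjectProperty.ι _).mapIso (hi.uniqueUpToIso hY))
    (isTwisted_of_inOmega hψ hχ Y.property)

end Diag

end ConicQS

/-! ### Matrix products of coefficients and the identity matrix -/

section Convolution

variable {k : Type*} [Field k] {U V W : Type*} [AddCommGroup U] [Module k U] [AddCommGroup V]
  [Module k V] [AddCommGroup W] [Module k W] [FiniteDimensional k W]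

variable (k U V W) in
/-- The map `c ⊗ a ↦ Σ (b^i ⊗ a) ⊗ (c ⊗ b_i)` dual to composition. -/
noncomputable def coevConv :
    Module.Dual k U ⊗[k] V →ₗ[k] (Module.Dual k W ⊗[k] V) ⊗[k] (Module.Dual k U ⊗[k] W) :=
  TensorProduct.lift (LinearMap.mk₂ k (fun c a => TensorProduct.map
    ((TensorProduct.mk k (Module.Dual k W) V).flip a) (TensorProduct.mk k (Module.Dual k U) W c)
      (coevTensor k W))
    (fun c c' a => by rw [map_add, TensorProduct.map_add_right, LinearMap.add_apply])
    (fun r c a => by rw [map_smul, TensorProduct.map_smul_right, LinearMap.smul_apply])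
    (fun c a a' => by rw [map_add, TensorProduct.map_add_left, LinearMap.add_apply])
    (fun r c a => by rw [map_smul, TensorProduct.map_smul_left, LinearMap.smul_apply]))

theorem coevConv_tmul (c : Module.Dual k U) (a : V) : coevConv k U V W (c ⊗ₜ a) =
    TensorProduct.map ((TensorProduct.mk k (Module.Dual k W) V).flip a)
      (TensorProduct.mk k (Module.Dual k U) W c) (coevTensor k W) := rfl

theorem coevConv_eq_sum {ι : Type*} [Fintype ι] (b : Module.Basis ι k W) (c : Module.Dual k U)
    (a : V) : coevConv k U V W (c ⊗ₜ a) = ∑ i, (b.coord i ⊗ₜ a) ⊗ₜ (c ⊗ₜ b i) := by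
  rw [coevConv_tmul, coevTensor_eq_sum b]
  simp

variable [FiniteDimensional k U] {R S : Type*} [Ring R] [Algebra k R] [Ring S] [Algebra k S]

theorem linearMap_ext_dual_tprod {M : Type*} [AddCommGroup M] [Module k M] {n : ℕ}
    {p q : Module.Dual k (⨂[k]^n U) →ₗ[k] ⨂[k]^n V →ₗ[k] M}
    (h : ∀ (f : Fin n → Module.Dual k U) (v : Fin n → V),
      p (Cochain2.dualPower n (PiTensorProduct.tprod k f)) (PiTensorProduct.tprod k v) =
        q (Cochain2.dualPower n (PiTensorProduct.tprod k f)) (PiTensorProduct.tprod k v)) :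
    p = q := by
  have h' : p ∘ₗ (Cochain2.dualPower n).toLinearMap = q ∘ₗ (Cochain2.dualPower n).toLinearMap := by
    apply PiTensorProduct.ext
    ext f
    exact h f _
  refine LinearMap.ext fun f => ?_
  obtain ⟨f, rfl⟩ := (Cochain2.dualPower n).surjective f
  exact LinearMap.congr_fun h' f

/-- The n-th power of a matrix product is the matrix product of the n-th powers, with summation over
words J in a basis of W. On pure tensors this is the expansion of a product of sums. -/
theorem pairPow_coevConv (h : Module.Dual k W ⊗[k] V →ₗ[k] R) (g : Module.Dual k U ⊗[k] W →ₗ[k] S)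
    {n : ℕ} (f : Module.Dual k (⨂[k]^n U)) (t : ⨂[k]^n V) :
    pairPow (TensorProduct.map h g ∘ₗ coevConv k U V W) n f t =
      TensorProduct.map ((pairPow h n).flip t) (pairPow g n f) (coevTensor k (⨂[k]^n W)) := by
  classical
  let b := Module.finBasis k W
  rw [coevTensor_power b]
  simp only [map_sum, TensorProduct.map_tmul, LinearMap.flip_apply]
  -- Writing the sum over words as a bilinear map allows the comparison to be made on products of
  -- functionals and pure tensors only.
  have : pairPow (TensorProduct.map h g ∘ₗ coevConv k U V W) n =
      ∑ J : Fin n → _, ((TensorProduct.mk k R S).compl₁₂ ((pairPow h n)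
        (Cochain2.dualPower n (PiTensorProduct.tprod k fun i => b.coord (J i))))
        ((pairPow g n).flip (PiTensorProduct.tprod k fun i => b (J i)))).flip := by
    refine linearMap_ext_dual_tprod fun f v => ?_
    have hs : (PiTensorProduct.tprod k fun i => coevConv k U V W (f i ⊗ₜ v i)) =
        ∑ J : Fin n → _, tensorPowerZip n
          ((PiTensorProduct.tprod k fun i => b.coord (J i) ⊗ₜ[k] v i) ⊗ₜ[k]
            (PiTensorProduct.tprod k fun i => f i ⊗ₜ[k] b (J i))) := by
      simp only [coevConv_eq_sum b, tensorPowerZip_tprod]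
      rw [MultilinearMap.map_sum]
    have hl : pairPow (TensorProduct.map h g ∘ₗ coevConv k U V W) n
        (Cochain2.dualPower n (PiTensorProduct.tprod k f)) (PiTensorProduct.tprod k v) =
        powMap (TensorProduct.map h g) n
          (PiTensorProduct.tprod k fun i => coevConv k U V W (f i ⊗ₜ v i)) := by
      rw [pairPow_tprod, powMap_tprod]
      rfl
    rw [hl, hs]
    simp only [map_sum, powMap_map_zip, TensorProduct.map_tmul, LinearMap.sum_apply,
      LinearMap.flip_apply, LinearMap.compl₁₂_apply, TensorProduct.mk_apply, pairPow_tprod,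
      powMap_tprod]
  rw [this]
  simp only [LinearMap.sum_apply, LinearMap.flip_apply, LinearMap.compl₁₂_apply,
    TensorProduct.mk_apply]

theorem prod_ofFn_smul {n : ℕ} (c : Fin n → k) (e : R) :
    (List.ofFn fun i => c i • e).prod = (∏ i, c i) • e ^ n := by
  induction n with
  | zero => simp
  | succ n ih =>
    rw [List.ofFn_succ, List.prod_cons, ih, Fin.prod_univ_succ, pow_succ', smul_mul_smul_comm]

theorem pairPow_contract {e : R} {n : ℕ} (f : Module.Dual k (⨂[k]^n U)) (t : ⨂[k]^n U) :
    pairPow (LinearMap.toSpanSingleton k R e ∘ₗ contractLeft k U) n f t = f t • e ^ n := by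
  have : pairPow (LinearMap.toSpanSingleton k R e ∘ₗ contractLeft k U) n =
      (LinearMap.toSpanSingleton k R (e ^ n)).compRight k := by
    refine linearMap_ext_dual_tprod fun f v => ?_
    have hr : (LinearMap.toSpanSingleton k R (e ^ n)).compRight k
        (Cochain2.dualPower n (PiTensorProduct.tprod k f)) (PiTensorProduct.tprod k v) =
        (∏ i, f i (v i)) • e ^ n := by
      rw [← dualPower_tprod]
      rfl
    rw [hr, pairPow_tprod]
    exact prod_ofFn_smul _ e
  rw [this]
  rfl

end Convolution

/-- In bases e_i of E and f_j of F both sides are the double sum of p(e^i) ⊗ m(f^j, e_i) ⊗ q(f_j),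
taken in the two possible orders. -/
theorem assoc_map_coevTensor {k : Type*} [Field k] {E F L M N : Type*} [AddCommGroup E]
    [Module k E] [FiniteDimensional k E] [AddCommGroup F] [Module k F] [FiniteDimensional k F]
    [AddCommGroup L] [Module k L] [AddCommGroup M] [Module k M] [AddCommGroup N] [Module k N]
    (p : Module.Dual k E →ₗ[k] M) (m : Module.Dual k F →ₗ[k] E →ₗ[k] N) (q : F →ₗ[k] L)
    {P : Module.Dual k F →ₗ[k] M ⊗[k] N} {Q : E →ₗ[k] N ⊗[k] L}
    (hP : ∀ g, P g = TensorProduct.map p (m g) (coevTensor k E))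
    (hQ : ∀ x, Q x = TensorProduct.map (m.flip x) q (coevTensor k F)) :
    TensorProduct.assoc k M N L (TensorProduct.map P q (coevTensor k F)) =
      TensorProduct.map p Q (coevTensor k E) := by
  simp only [coevTensor_eq_sum (Module.finBasis k E), coevTensor_eq_sum (Module.finBasis k F),
    map_sum, TensorProduct.map_tmul, hP, hQ, LinearMap.flip_apply, TensorProduct.sum_tmul,
    TensorProduct.tmul_sum, TensorProduct.assoc_tmul]
  rw [Finset.sum_comm]

/-! ### Cocomposition, counit and their compatibility with coevaluation -/

namespace ConicQS

variable {k : Type u} [Field k]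

namespace Diag

variable {A B C : ConicQS k}

theorem pairKills_iff_of_injective {R S : Type*} [Ring R] [Algebra k R] [Ring S] [Algebra k S]
    {V W : Type*} [AddCommGroup V] [Module k V] [AddCommGroup W] [Module k W]
    [FiniteDimensional k W] {φ : R →ₐ[k] S} (hφ : Function.Injective φ)
    {h : Module.Dual k W ⊗[k] V →ₗ[k] R} {n : ℕ} {P : Submodule k (⨂[k]^n V)}
    {Q : Submodule k (⨂[k]^n W)} (hk : PairKills (φ.toLinearMap ∘ₗ h) P Q) : PairKills h P Q := by
  intro f hf x hx
  refine hφ ?_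
  rw [algHom_pairPow, map_zero]
  exact hk f hf x hx

/-- The map `b^j ⊗ a_i ↦ Σ_k h_i^k ⊗ g_k^j`. -/
noncomputable def convGen (X : Diag A B) (Y : Diag B C) :
    Module.Dual k C.gen ⊗[k] A.gen →ₗ[k] (X.right ⊗ Y.right : ConicQS k).gen :=
  (genEquiv X.right Y.right).toLinearMap ∘ₗ TensorProduct.map X.coeff Y.coeff ∘ₗ
    coevConv k C.gen A.gen B.gen

theorem circVal_convGen (X : Diag A B) (Y : Diag B C) :
    (circVal X.right Y.right).toLinearMap ∘ₗ (X.right ⊗ Y.right : ConicQS k).gen.subtype ∘ₗ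
      X.convGen Y = TensorProduct.map X.coeffMap Y.coeffMap ∘ₗ coevConv k C.gen A.gen B.gen := by
  have h : ∀ x, circVal X.right Y.right (genEquiv X.right Y.right (TensorProduct.map X.coeff
      Y.coeff x)) = TensorProduct.map X.coeffMap Y.coeffMap x := fun x => by
    rw [circVal_genEquiv, TensorProduct.mapIncl, TensorProduct.map_map]
    rfl
  exact LinearMap.ext fun x => h _

/-- For f killing N, the power of the coefficients of Y paired with f vanishes on Q. A functional
killing the kernel of that map hence kills Q, and the hypothesis on X applies to it;
`map_coevTensor_eq_zero_iff` reassembles the sum. -/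
theorem pairKills_convGen {X : Diag A B} {Y : Diag B C} {n : ℕ} {P : Submodule k (⨂[k]^n A.gen)}
    {Q : Submodule k (⨂[k]^n B.gen)} {N : Submodule k (⨂[k]^n C.gen)}
    (hX : PairKills X.coeffMap P Q) (hY : PairKills Y.coeffMap Q N) :
    PairKills ((X.right ⊗ Y.right : ConicQS k).gen.subtype ∘ₗ X.convGen Y) P N := by
  refine pairKills_iff_of_injective (circVal_injective X.right Y.right) ?_
  rw [circVal_convGen]
  intro f hf x hx
  rw [pairPow_coevConv]
  exact (map_coevTensor_eq_zero_iff _ _).2 fun g hg => hX g (fun y hy => hg y (hY f hf y hy)) x hx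

variable (A) in
/-- The map `b^j ⊗ b_i ↦ δ_i^j e`. -/
noncomputable def counitGen : Module.Dual k A.gen ⊗[k] A.gen →ₗ[k] (K k).gen :=
  LinearMap.toSpanSingleton k (K k).gen (e k) ∘ₗ contractLeft k A.gen

theorem pairPow_counitGen {n : ℕ} (f : Module.Dual k (⨂[k]^n A.gen)) (t : ⨂[k]^n A.gen) :
    pairPow ((K k).gen.subtype ∘ₗ counitGen A) n f t = f t • (e k : (K k).carrier) ^ n :=
  pairPow_contract f t

theorem pairKills_counitGen {n : ℕ} (P : Submodule k (⨂[k]^n A.gen)) :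
    PairKills ((K k).gen.subtype ∘ₗ counitGen A) P P := fun f hf x hx => by
  rw [pairPow_counitGen, hf x hx, zero_smul]

/-- The compatibility of cocomposition with the coevaluations. -/
theorem coev_cocomp {ψ : Cochain2 k A.gen} {χ : Cochain2 k B.gen} {ρ : Cochain2 k C.gen}
    {X : Diag A B} {Y : Diag B C} {Z : Diag A C} (hX : X.IsTwisted ψ χ) (hY : Y.IsTwisted χ ρ)
    (hZ : Z.IsTwisted ψ ρ) {f : Z.right ⟶ X.right ⊗ Y.right}
    (hf : ∀ u, genMap f (Z.coeff u) = X.convGen Y u) (a : A.carrier) :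
    TensorProduct.assoc k _ _ _ (TensorProduct.map
        ((circVal X.right Y.right).comp (alg f)).toLinearMap LinearMap.id
        (circVal Z.right C (grLin Z.map a))) =
      TensorProduct.map LinearMap.id ((circVal Y.right C).toLinearMap ∘ₗ grLin Y.map)
        (circVal X.right B (grLin X.map a)) := by
  have hfc : ((circVal X.right Y.right).comp (alg f)).toLinearMap ∘ₗ Z.coeffMap =
      TensorProduct.map X.coeffMap Y.coeffMap ∘ₗ coevConv k C.gen A.gen B.gen := by
    rw [← circVal_convGen]
    exact LinearMap.ext fun u => congrArg (fun x : (X.right ⊗ Y.right : ConicQS k).gen =>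
      circVal X.right Y.right x) (hf u)
  have key : (TensorProduct.assoc k _ _ _).toLinearMap ∘ₗ (TensorProduct.map
        ((circVal X.right Y.right).comp (alg f)).toLinearMap LinearMap.id) ∘ₗ
        (circVal Z.right C).toLinearMap ∘ₗ grLin Z.map =
      TensorProduct.map LinearMap.id ((circVal Y.right C).toLinearMap ∘ₗ grLin Y.map) ∘ₗ
        (circVal X.right B).toLinearMap ∘ₗ grLin X.map := by
    -- On untwisted words the formulas for X, Y and Z contain no cocycles, and the untwisted product
    -- of B appearing in X is the one on which Y is evaluated.
    refine linearMap_ext_twProd ψ fun n s => ?_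
    simp only [LinearMap.comp_apply, LinearEquiv.coe_coe, AlgHom.toLinearMap_apply]
    rw [hZ n s, hX n s, TensorProduct.map_map, TensorProduct.map_map, LinearMap.id_comp,
      LinearMap.id_comp]
    have h1 : ((circVal X.right Y.right).comp (alg f)).toLinearMap ∘ₗ
        (pairPow Z.coeffMap n).flip s =
        (pairPow (TensorProduct.map X.coeffMap Y.coeffMap ∘ₗ coevConv k C.gen A.gen B.gen) n).flip
          s := by
      rw [← hfc]
      exact LinearMap.ext fun g =>
        algHom_pairPow ((circVal X.right Y.right).comp (alg f)) Z.coeffMap g s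
    rw [h1]
    have hP := fun g => pairPow_coevConv X.coeffMap Y.coeffMap (n := n) g s
    have hQ : ∀ x, ((circVal Y.right C).toLinearMap ∘ₗ grLin Y.map ∘ₗ B.twProd χ n) x = _ := hY n
    have := assoc_map_coevTensor (E := ⨂[k]^n B.gen) (F := ⨂[k]^n C.gen)
      (L := C.carrier) (M := X.right.carrier) (N := Y.right.carrier)
      ((pairPow X.coeffMap n).flip s) (pairPow Y.coeffMap n) (C.twProd ρ n)
      (P := (pairPow (TensorProduct.map X.coeffMap Y.coeffMap ∘ₗ
        coevConv k C.gen A.gen B.gen) n).flip s) (Q := (circVal Y.right C).toLinearMap ∘ₗ grLin Y.map ∘ₗ B.twProd χ n)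
    exact (this hP hQ).trans rfl
  exact LinearMap.congr_fun key a

/-- The compatibility of the counit with the coevaluations. -/
theorem coev_counit {ψ : Cochain2 k A.gen} {X : Diag A A} (hX : X.IsTwisted ψ ψ)
    {f : X.right ⟶ K k} (hf : ∀ u, genMap f (X.coeff u) = counitGen A u) :
    X.map ≫ (forgetGr k).map (f ▷ A) = (forgetGr k).map (λ_ A).inv := by
  have hfc : (alg f).toLinearMap ∘ₗ X.coeffMap = (K k).gen.subtype ∘ₗ counitGen A :=
    LinearMap.ext fun u => congrArg Subtype.val (hf u)
  refine GrVct.Hom.ext (linearMap_ext_twProd (A := A) ψ fun n s => ?_)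
  -- Setting e = 1 is injective on 𝒦 ∘ A, since the degree of the A-component determines the power
  -- of e.
  refine lunitVal_injective A ?_
  have hr : lunitVal A (alg (lunitIso A).inv (A.twProd ψ n s)) = A.twProd ψ n s := by
    rw [← alg_lunitIso, ← AlgHom.comp_apply, ← alg_comp, Iso.inv_hom_id]
    rfl
  refine Eq.trans ?_ hr.symm
  have hl : circVal (K k) A (alg (circMap f (𝟙 A)) (grLin X.map (A.twProd ψ n s))) =
      TensorProduct.map ((alg f).toLinearMap ∘ₗ (pairPow X.coeffMap n).flip s) (A.twProd ψ n)
        (coevTensor k (⨂[k]^n A.gen)) := by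
    rw [circVal_circMap, hX n s]
    exact TensorProduct.map_map _ _ _ _ _
  have hl' : TensorProduct.lid k A.carrier (TensorProduct.map (evalOne k).toLinearMap LinearMap.id
      (circVal (K k) A (alg (circMap f (𝟙 A)) (grLin X.map (A.twProd ψ n s))))) =
      A.twProd ψ n s := by
    rw [hl, TensorProduct.map_map, LinearMap.id_comp]
    refine map_dual_coevTensor_left _ _ _ fun g => ?_
    have h2 : alg f (pairPow X.coeffMap n g s) = g s • (e k : (K k).carrier) ^ n := by
      rw [algHom_pairPow, hfc, pairPow_counitGen]
    refine (congrArg (evalOne k) h2).trans ?_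
    rw [map_smul, map_pow, evalOne_e, one_pow, smul_eq_mul, mul_one]
  exact hl'

end Diag

end ConicQS

/-! ### The axioms of a cobased category -/

namespace ConicQS

variable {k : Type u} [Field k]

theorem surjective_of_e_mem {H : ConicQS k} (f : H ⟶ K k) (x : H.gen) (hx : genMap f x = e k) :
    Function.Surjective (alg f) := by
  rw [← AlgHom.range_eq_top, eq_top_iff, ← (K k).adjoin_gen]
  refine Algebra.adjoin_le fun y hy => ?_
  obtain ⟨r, rfl⟩ := Submodule.mem_span_singleton.1
    (show y ∈ Submodule.span k {(e k : (K k).carrier)} from hy)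
  exact ⟨r • (x : H.carrier), by
    rw [AlgHom.toRingHom_eq_coe, RingHom.coe_coe, map_smul]
    exact congrArg _ (congrArg Subtype.val hx)⟩

theorem epi_of_surjective {H H' : ConicQS k} {f : H ⟶ H'} (hf : Function.Surjective (alg f)) :
    Epi f where
  left_cancellation g g' h := hom_ext_alg <| AlgHom.ext fun y => by
    obtain ⟨x, rfl⟩ := hf y
    exact congrArg (fun φ => alg φ x) h

namespace Diag

theorem convGen_tmul {A B C : ConicQS k} (X : Diag A B) (Y : Diag B C) {ι : Type*} [Fintype ι]
    (b : Module.Basis ι k B.gen) (c : Module.Dual k C.gen) (a : A.gen) :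
    X.convGen Y (c ⊗ₜ a) =
      ∑ j, genEquiv X.right Y.right (X.coeff (b.coord j ⊗ₜ a) ⊗ₜ Y.coeff (c ⊗ₜ b j)) := by
  simp [convGen, coevConv_eq_sum b]

theorem counitGen_tmul {A : ConicQS k} (f : Module.Dual k A.gen) (a : A.gen) :
    counitGen A (f ⊗ₜ a) = f a • e k := by
  simp [counitGen]

/-- The universal objects form a cobased category. -/
theorem exists_cobasedCategory {ψ : ∀ A : ConicQS k, Cochain2 k A.gen}
    {X : ∀ B A : ConicQS k, Diag A B} (hX : ∀ B A, (X B A).IsUniversal (ψ A) (ψ B)) :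
    ∃ S : CobasedCategory fun B A => (X B A).right,
      (∀ (A B C : ConicQS k) u, genMap (S.cocomp C B A) ((X C A).coeff u) =
        (X B A).convGen (X C B) u) ∧
      ∀ (A : ConicQS k) u, genMap (S.counit A) ((X A A).coeff u) = counitGen A u := by
  have hΔ : ∀ C B A : ConicQS k, ∃ f : (X C A).right ⟶ (X B A).right ⊗ (X C B).right,
      ∀ u, genMap f ((X C A).coeff u) = (X B A).convGen (X C B) u := fun C B A =>
    (hX C A).exists_lift _ fun n => pairKills_convGen ((hX B A).isTwisted.pairKills n)
      ((hX C B).isTwisted.pairKills n)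
  have hε : ∀ A : ConicQS k, ∃ f : (X A A).right ⟶ K k,
      ∀ u, genMap f ((X A A).coeff u) = counitGen A u := fun A =>
    (hX A A).exists_lift _ fun n => pairKills_counitGen _
  choose Δ hΔ using hΔ
  choose ε hε using hε
  refine ⟨{ cocomp := Δ, counit := ε, counit_left := ?_, counit_right := ?_, coassoc := ?_ },
    fun A B C => hΔ C B A, hε⟩
  · intro C A
    refine (hX C A).hom_ext fun u => ?_
    induction u with
    | zero => simp
    | add x y hx hy => simp only [map_add, hx, hy]
    | tmul c a =>
    let b := Module.finBasis k A.gen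
    change genMap (lunitIso (X C A).right).hom
      (genMap (circMap (ε A) (𝟙 (X C A).right)) (genMap (Δ C A A) _)) = (X C A).coeff (c ⊗ₜ a)
    rw [hΔ, convGen_tmul _ _ b]
    simp only [map_sum, genMap_circMap, hε, counitGen_tmul, genMap_id, LinearMap.id_apply,
      genMap_lunitIso, Submodule.coe_smul, map_smul, evalOne_e, smul_eq_mul, mul_one]
    -- The counit leaves the coordinates of a as scalars; collecting them inside the coefficient map
    -- restores the expansion of a. For the other counit law it is the functional c that is
    -- expanded.
    simp only [← map_smul, ← TensorProduct.tmul_smul, ← map_sum, ← TensorProduct.tmul_sum]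
    congr 2
    exact b.sum_repr a
  · intro C A
    refine (hX C A).hom_ext fun u => ?_
    induction u with
    | zero => simp
    | add x y hx hy => simp only [map_add, hx, hy]
    | tmul c a =>
    let b := Module.finBasis k C.gen
    change genMap (runitIso (X C A).right).hom
      (genMap (circMap (𝟙 (X C A).right) (ε C)) (genMap (Δ C C A) _)) = (X C A).coeff (c ⊗ₜ a)
    rw [hΔ, convGen_tmul _ _ b]
    simp only [map_sum, genMap_circMap, hε, counitGen_tmul, genMap_id, LinearMap.id_apply,
      genMap_runitIso, Submodule.coe_smul, map_smul, evalOne_e, smul_eq_mul, mul_one]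
    simp only [← map_smul, TensorProduct.smul_tmul', ← map_sum, ← TensorProduct.sum_tmul]
    congr 2
    exact b.sum_dual_apply_smul_coord c
  · intro D C B A
    refine (hX D A).hom_ext fun u => ?_
    induction u with
    | zero => simp
    | add x y hx hy => simp only [map_add, hx, hy]
    | tmul d a =>
    let b := Module.finBasis k B.gen
    let c := Module.finBasis k C.gen
    change genMap (assocIso (X B A).right (X C B).right (X D C).right).hom
      (genMap (circMap (Δ C B A) (𝟙 (X D C).right)) (genMap (Δ D C A) _)) =
      genMap (circMap (𝟙 (X B A).right) (Δ D C B)) (genMap (Δ D B A) _)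
    rw [hΔ, hΔ, convGen_tmul _ _ b, convGen_tmul _ _ c]
    simp only [map_sum, genMap_circMap, hΔ, convGen_tmul _ _ b, convGen_tmul _ _ c, genMap_id,
      LinearMap.id_apply, TensorProduct.sum_tmul, TensorProduct.tmul_sum]
    -- Both composites are the same double sum over bases of B₁ and C₁, and the associator matches
    -- it term by term.
    rw [Finset.sum_comm]
    exact Finset.sum_congr rfl fun i _ => Finset.sum_congr rfl fun j _ => genMap_assocIso _ _ _ _ _ _

end Diag

end ConicQS

namespace ConicQS.Diag

variable {k : Type u} [Field k]

/-- The properties of the cobased category of universal objects. -/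
theorem exists_cobasedCategory_coev {ψ : ∀ A : ConicQS k, Cochain2 k A.gen}
    {X : ∀ B A : ConicQS k, Diag A B} (hX : ∀ B A, (X B A).IsUniversal (ψ A) (ψ B)) :
    ∃ S : CobasedCategory fun B A => (X B A).right,
      (∀ (A B C : ConicQS k) (a : A.carrier),
        TensorProduct.assoc k _ _ _
            (TensorProduct.map
              ((circVal (X B A).right (X C B).right).comp (alg (S.cocomp C B A))).toLinearMap
              LinearMap.id (circVal (X C A).right C (grLin (X C A).map a))) =
          TensorProduct.map LinearMap.id
            ((circVal (X C B).right C).toLinearMap ∘ₗ grLin (X C B).map)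
            (circVal (X B A).right B (grLin (X B A).map a))) ∧
      (∀ (A B C : ConicQS k) (n : ℕ) (b : Module.Basis (Fin n) k B.gen)
        (c : Module.Dual k C.gen) (a : A.gen),
        genMap (S.cocomp C B A) ((X C A).coeff (c ⊗ₜ a)) =
          ∑ j, genEquiv (X B A).right (X C B).right
            ((X B A).coeff (b.coord j ⊗ₜ a) ⊗ₜ (X C B).coeff (c ⊗ₜ b j))) ∧
      (∀ A : ConicQS k, (X A A).map ≫ (forgetGr k).map (S.counit A ▷ A) =
        (forgetGr k).map (λ_ A).inv) ∧
      (∀ (A : ConicQS k) (f : Module.Dual k A.gen) (a : A.gen),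
        genMap (S.counit A) ((X A A).coeff (f ⊗ₜ a)) = f a • e k) ∧
      (∀ A : ConicQS k, A.gen ≠ ⊥ →
        Epi (S.counit A) ∧ Function.Surjective (alg (S.counit A))) ∧
      (∀ A : ConicQS k,
        Mono (S.cocomp A A A) ∧ Function.Injective (alg (S.cocomp A A A))) := by
  obtain ⟨S, hΔ, hε⟩ := exists_cobasedCategory hX
  refine ⟨S, fun A B C => coev_cocomp (hX B A).isTwisted (hX C B).isTwisted (hX C A).isTwisted
    (hΔ A B C), ?_, fun A => coev_counit (hX A A).isTwisted (hε A), ?_, ?_, ?_⟩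
  · intro A B C n b c a
    rw [hΔ, convGen_tmul _ _ b]
  · intro A f a
    rw [hε, counitGen_tmul]
  · intro A hA
    have hs : Function.Surjective (alg (S.counit A)) := by
      obtain ⟨a, ha, ha0⟩ := Submodule.exists_mem_ne_zero_of_ne_bot hA
      obtain ⟨f, hf⟩ := Module.Projective.exists_dual_ne_zero k
        (x := (⟨a, ha⟩ : A.gen)) fun h => ha0 (congrArg Subtype.val h)
      -- The coefficient of f ⊗ a goes to f(a)e, and f(a) ≠ 0; after normalization the generator e
      -- of 𝒦 is in the image.
      refine surjective_of_e_mem _ ((f ⟨a, ha⟩)⁻¹ • (X A A).coeff (f ⊗ₜ ⟨a, ha⟩)) ?_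
      rw [map_smul, hε, counitGen_tmul, smul_smul, inv_mul_cancel₀ hf, one_smul]
    exact ⟨epi_of_surjective hs, hs⟩
  · intro A
    -- The left counit law exhibits a retraction of the comultiplication, which gives the
    -- monomorphism property and injectivity of the algebra map alike.
    refine ⟨(SplitMono.mk _ (S.counit_left A A)).mono, fun x y hxy => ?_⟩
    have h : ∀ x, alg (λ_ (X A A).right).hom (alg (S.counit A ▷ (X A A).right)
        (alg (S.cocomp A A A) x)) = x :=
      fun x => congrArg (fun φ => alg φ x) (S.counit_left A A)
    rw [← h x, hxy, h y]

end ConicQS.Diag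

theorem mainTheorem6 {k : Type u} [Field k]
    (ω : ∀ A B : ConicQS k, Cochain2 k ((Module.Dual k B.gen ⊗[k] A.gen) ⊗[k] B.gen))
    (ψ : ∀ A : ConicQS k, Cochain2 k A.gen) (hω : ConicQS.Factorizes ω ψ)
    (hψ : ∀ A : ConicQS k, A.SecondAdmissible (ψ A).inv) :
    (∀ A B : ConicQS k, Limits.HasInitial (ConicQS.Omega A B (ω A B))) ∧
    ∀ hom : ∀ B A : ConicQS k, ConicQS.Omega A B (ω A B),
      (∀ B A, Nonempty (Limits.IsInitial (hom B A))) →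
      (∀ B A, Function.Bijective (hom B A).obj.coeff) ∧
      ∃ S : CobasedCategory fun B A => (hom B A).obj.right,
        (∀ (A B C : ConicQS k) (a : A.carrier),
          TensorProduct.assoc k _ _ _
              (TensorProduct.map
                ((ConicQS.circVal (hom B A).obj.right (hom C B).obj.right).comp
                  (ConicQS.alg (S.cocomp C B A))).toLinearMap LinearMap.id
                (ConicQS.circVal (hom C A).obj.right C (ConicQS.grLin (hom C A).obj.map a))) =
            TensorProduct.map LinearMap.id
              ((ConicQS.circVal (hom C B).obj.right C).toLinearMap ∘ₗ
                ConicQS.grLin (hom C B).obj.map)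
              (ConicQS.circVal (hom B A).obj.right B (ConicQS.grLin (hom B A).obj.map a))) ∧
        (∀ (A B C : ConicQS k) (n : ℕ) (b : Module.Basis (Fin n) k B.gen)
          (c : Module.Dual k C.gen) (a : A.gen),
          ConicQS.genMap (S.cocomp C B A) ((hom C A).obj.coeff (c ⊗ₜ a)) =
            ∑ j, ConicQS.genEquiv (hom B A).obj.right (hom C B).obj.right
              ((hom B A).obj.coeff (b.coord j ⊗ₜ a) ⊗ₜ (hom C B).obj.coeff (c ⊗ₜ b j))) ∧
        (∀ A : ConicQS k, (hom A A).obj.map ≫ (ConicQS.forgetGr k).map (S.counit A ▷ A) =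
          (ConicQS.forgetGr k).map (λ_ A).inv) ∧
        (∀ (A : ConicQS k) (f : Module.Dual k A.gen) (a : A.gen),
          ConicQS.genMap (S.counit A) ((hom A A).obj.coeff (f ⊗ₜ a)) = f a • ConicQS.e k) ∧
        (∀ A : ConicQS k, A.gen ≠ ⊥ →
          Epi (S.counit A) ∧ Function.Surjective (ConicQS.alg (S.counit A))) ∧
        (∀ A : ConicQS k,
          Mono (S.cocomp A A A) ∧ Function.Injective (ConicQS.alg (S.cocomp A A A))) := by
  obtain ⟨hZ, hω⟩ := hω
  obtain rfl : ω = fun A B => ((ψ B).dual.prod (ψ A)).prod Cochain2.one :=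
    funext fun A => funext fun B => hω A B
  refine ⟨fun A B => ?_, fun hom hi => ?_⟩
  · obtain ⟨X, hX, hXΩ⟩ := ConicQS.Diag.exists_isUniversal (hZ A) (hZ B) (hψ A) (hψ B)
    obtain ⟨h⟩ := ConicQS.Diag.IsUniversal.isInitial (hZ A) (hZ B)
      (X := (⟨X, hXΩ⟩ : ConicQS.Omega A B (((ψ B).dual.prod (ψ A)).prod Cochain2.one))) hX
    exact h.hasInitial
  -- Only the universal property enters from here on, so any choice of initial objects serves as
  -- well as the presented ones.
  · have hX : ∀ B A, (hom B A).obj.IsUniversal (ψ A) (ψ B) := fun B A =>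
      ConicQS.Diag.isUniversal_of_isInitial (hZ A) (hZ B) (hψ A) (hψ B) (hi B A).some
    exact ⟨fun B A => (hX B A).bijective, ConicQS.Diag.exists_cobasedCategory_coev hX⟩
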